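/- Let $d\ge 2$ and $d'\ge 1$ be integers and let $s\in(0,d)$. Let $\Omega:\mathbb{R}^d\to\mathbb{C}^{d'}$ satisfy $\Omega(\lambda x)=\lambda\,\Omega(x)$ for all $\lambda\in\mathbb{R}$, $x\in\mathbb{R}^d$, and be Hölder continuous on the unit sphere with some exponent $\alpha\in(0,1]$. Put, for $x\neq 0$ and $\delta>0$, $$K(x)=\frac{\Omega(x)}{|x|^{s+1}},\qquad K_\delta(x)=\frac{\Omega(x)}{\max(\delta,|x|)^{s+1}};$$ $K$ is an $s$-dimensional Calderón–Zygmund kernel (odd, homogeneous of degree $-s$, Hölder continuous on the unit sphere), and $T$ denotes the associated operator. A measure is a non-negative locally finite Borel measure on $\mathbb{R}^d$, and for such $\mu$ let $T_{\mu,\delta}(f)(x)=\int K_\delta(x-y)f(y)\,d\mu(y)$. For $\Lambda>0$, a measure $\mu$ is $\Lambda$-nice if $\mu(B(x,r))\le\Lambda r^s$ for every ball $B(x,r)$, and $\Lambda$-good if, in addition, $\|T_{\mu,\delta}\|_{L^2(\mu)\to L^2(\mu)}\le\Lambda$ for every $\delta>0$. It is $s$-dimensional if it is $\Lambda$-nice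 for some $\Lambda>0$ and $\mathcal{H}^s(\operatorname{supp}\mu)<\infty$, where $\operatorname{supp}\mu$ is the closed support. We say that $T_\mu$ is bounded in $L^2(\mu)$ if $\mu$ is $\Lambda$-good for some $\Lambda>0$; in that case $T_\mu$ denotes the weak limit of the $T_{\mu,\delta}$, i.e. $\langle T_\mu(f),g\rangle_\mu=\lim_{\delta\to0^+}\int T_{\mu,\delta}(f)\,g\,d\mu$ for $f,g\in L^2(\mu)$. If $\mu$ is $\Lambda$-good and $\psi$ is a compactly supported Lipschitz function with $\int\psi\,d\mu=0$, set $$\langle T_\mu(1),\psi\rangle_\mu=\langle T_\mu(\varphi),\psi\rangle_\mu+\int\psi(x)\int(1-\varphi(y))\,[K(x-y)-K(z-y)]\,d\mu(y)\,d\mu(x),$$ where $B$ is a ball containing $\operatorname{supp}\psi$, $z\in B$, and $\varphi\in L^2(\mu)$ satisfies $0\le\varphi\le1$ and $\varphi=1$ on $2B$; the value does not depend on the choice of $B$, $z$ and $\varphi$. The measure $\mu$ is reflectionless for $T$ if it is $\Lambda$-good for some $\Lambda>0$ and $\langle T_\mu(1),\psi\rangle_\mu=0$ for every such $\psi$. **Theorem.**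 If the only reflectionless measure for $T$ is the zero measure, then every $s$-dimensional measure $\mu$ for which $T_\mu$ is bounded in $L^2(\mu)$ is the zero measure. -/

import Mathlib

open MeasureTheory Filter Topology
open scoped NNReal ENNReal

noncomputable section

namespace CZReflectionless

/-- The numerator `Ω` of an `s`-dimensional Calderón–Zygmund kernel `K(x) = Ω(x) / |x|^(s+1)`:
it is homogeneous of degree one with respect to all real scalars (hence odd, with `Ω 0 = 0`) and
Hölder continuous on the unit sphere. In terms of `K` this says that `K` is odd, homogeneous of
degree `-s`, and Hölder continuous on the unit sphere. -/
structure IsCZNumerator {d d' : ℕ}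
    (Ω : EuclideanSpace ℝ (Fin d) → EuclideanSpace ℂ (Fin d')) : Prop where
  homogeneous : ∀ (t : ℝ) (x : EuclideanSpace ℝ (Fin d)), Ω (t • x) = t • Ω x
  holder : ∃ (L α : ℝ), 0 < α ∧ α ≤ 1 ∧ ∀ x y : EuclideanSpace ℝ (Fin d),
    ‖x‖ = 1 → ‖y‖ = 1 → ‖Ω x - Ω y‖ ≤ L * ‖x - y‖ ^ α

/-- The kernel `K(x) = Ω(x) / |x|^(s+1)`. -/
def czKernel {d d' : ℕ} (s : ℝ) (Ω : EuclideanSpace ℝ (Fin d) → EuclideanSpace ℂ (Fin d'))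
    (x : EuclideanSpace ℝ (Fin d)) : EuclideanSpace ℂ (Fin d') :=
  (‖x‖ ^ (s + 1))⁻¹ • Ω x

/-- The regularized kernel `K_δ(x) = Ω(x) / max(δ, |x|)^(s+1)`. -/
def czKernelReg {d d' : ℕ} (s : ℝ) (Ω : EuclideanSpace ℝ (Fin d) → EuclideanSpace ℂ (Fin d'))
    (δ : ℝ) (x : EuclideanSpace ℝ (Fin d)) : EuclideanSpace ℂ (Fin d') :=
  (max δ ‖x‖ ^ (s + 1))⁻¹ • Ω x

/-- The regularized operator `T_{μ,δ}(f)(x) = ∫ K_δ(x - y) f(y) dμ(y)`. The integral converges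
absolutely for every `x` when `δ > 0`, `μ` is `Λ`-nice and `f ∈ L²(μ)`. -/
def regOp {d d' : ℕ} (s : ℝ) (Ω : EuclideanSpace ℝ (Fin d) → EuclideanSpace ℂ (Fin d'))
    (μ : Measure (EuclideanSpace ℝ (Fin d))) (δ : ℝ) (f : EuclideanSpace ℝ (Fin d) → ℂ)
    (x : EuclideanSpace ℝ (Fin d)) : EuclideanSpace ℂ (Fin d') :=
  ∫ y, f y • czKernelReg s Ω δ (x - y) ∂μ

/-- `μ` is `Λ`-nice: `μ(B(x,r)) ≤ Λ r^s` for every ball. (This makes `μ` locally finite.) -/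
def IsNice {d : ℕ} (s Λ : ℝ) (μ : Measure (EuclideanSpace ℝ (Fin d))) : Prop :=
  ∀ (x : EuclideanSpace ℝ (Fin d)) (r : ℝ), 0 < r →
    μ (Metric.ball x r) ≤ ENNReal.ofReal (Λ * r ^ s)

/-- `μ` is `s`-dimensional: it is `Λ`-nice for some `Λ > 0`, and its closed support has finite
`s`-dimensional Hausdorff measure. (Normalizing Hausdorff measure by radii of balls instead of
by diameters of sets changes it only by a bounded factor, so finiteness is the same.) -/
def IsDimensional {d : ℕ} (s : ℝ) (μ : Measure (EuclideanSpace ℝ (Fin d))) : Prop :=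
  (∃ Λ : ℝ, 0 < Λ ∧ IsNice s Λ μ) ∧ Measure.hausdorffMeasure s μ.support < ∞

/-- `μ` is `Λ`-good: it is `Λ`-nice, and the norm of `T_{μ,δ}` on `L²(μ)` is at most `Λ` for
every `δ > 0`. -/
def IsGood {d d' : ℕ} (s : ℝ) (Ω : EuclideanSpace ℝ (Fin d) → EuclideanSpace ℂ (Fin d'))
    (Λ : ℝ) (μ : Measure (EuclideanSpace ℝ (Fin d))) : Prop :=
  IsNice s Λ μ ∧ ∀ δ : ℝ, 0 < δ → ∀ f : EuclideanSpace ℝ (Fin d) → ℂ, MemLp f 2 μ →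
    eLpNorm (regOp s Ω μ δ f) 2 μ ≤ ENNReal.ofReal Λ * eLpNorm f 2 μ

/-- `T_μ` is bounded in `L²(μ)`: `μ` is `Λ`-good for some `Λ > 0`. -/
def IsBoundedL2 {d d' : ℕ} (s : ℝ) (Ω : EuclideanSpace ℝ (Fin d) → EuclideanSpace ℂ (Fin d'))
    (μ : Measure (EuclideanSpace ℝ (Fin d))) : Prop :=
  ∃ Λ : ℝ, 0 < Λ ∧ IsGood s Ω Λ μ

/-- `⟨T_μ(f), g⟩_μ = v`, where `T_μ` is the weak limit of the operators `T_{μ,δ}` as `δ → 0⁺`: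
`v` is the limit of `⟨T_{μ,δ}(f), g⟩_μ` (a vector, as `f` and `g` are scalar functions). -/
def HasPairing {d d' : ℕ} (s : ℝ) (Ω : EuclideanSpace ℝ (Fin d) → EuclideanSpace ℂ (Fin d'))
    (μ : Measure (EuclideanSpace ℝ (Fin d))) (f g : EuclideanSpace ℝ (Fin d) → ℂ)
    (v : EuclideanSpace ℂ (Fin d')) : Prop :=
  Tendsto (fun δ : ℝ => ∫ x, g x • regOp s Ω μ δ f x ∂μ) (𝓝[>] 0) (𝓝 v)

/-- The tail term `⟨∫ (1 - φ(y)) [K(· - y) - K(z - y)] dμ(y), ψ⟩_μ`. -/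
def tailPairing {d d' : ℕ} (s : ℝ) (Ω : EuclideanSpace ℝ (Fin d) → EuclideanSpace ℂ (Fin d'))
    (μ : Measure (EuclideanSpace ℝ (Fin d))) (φ : EuclideanSpace ℝ (Fin d) → ℝ)
    (z : EuclideanSpace ℝ (Fin d)) (ψ : EuclideanSpace ℝ (Fin d) → ℂ) :
    EuclideanSpace ℂ (Fin d') :=
  ∫ x, ψ x • (∫ y, (1 - φ y) • (czKernel s Ω (x - y) - czKernel s Ω (z - y)) ∂μ) ∂μ

/-- `⟨T_μ(1), ψ⟩_μ = v`, for `μ` good and `ψ` compactly supported and Lipschitz with `μ`-mean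
zero: for each ball `B = B(x₀, R)` containing the support of `ψ`, each `z ∈ B`, and each
`φ ∈ L²(μ)` with `0 ≤ φ ≤ 1` and `φ = 1` on `2B`,
`v = ⟨T_μ(φ), ψ⟩_μ + ⟨∫ (1 - φ(y)) [K(· - y) - K(z - y)] dμ(y), ψ⟩_μ`.
For such `μ` and `ψ` the right-hand side exists and does not depend on `B`, `z`, `φ`. -/
def HasTOnePairing {d d' : ℕ} (s : ℝ)
    (Ω : EuclideanSpace ℝ (Fin d) → EuclideanSpace ℂ (Fin d'))
    (μ : Measure (EuclideanSpace ℝ (Fin d))) (ψ : EuclideanSpace ℝ (Fin d) → ℂ)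
    (v : EuclideanSpace ℂ (Fin d')) : Prop :=
  ∀ (x₀ : EuclideanSpace ℝ (Fin d)) (R : ℝ), tsupport ψ ⊆ Metric.ball x₀ R →
    ∀ z ∈ Metric.ball x₀ R, ∀ φ : EuclideanSpace ℝ (Fin d) → ℝ, MemLp φ 2 μ →
      (∀ y, 0 ≤ φ y ∧ φ y ≤ 1) → (∀ y ∈ Metric.ball x₀ (2 * R), φ y = 1) →
        HasPairing s Ω μ (fun y => (φ y : ℂ)) ψ (v - tailPairing s Ω μ φ z ψ)

/-- `μ` is reflectionless: it is `Λ`-good for some `Λ > 0`, and `⟨T_μ(1), ψ⟩_μ = 0` for all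
compactly supported Lipschitz functions `ψ` with `∫ ψ dμ = 0`. -/
def IsReflectionless {d d' : ℕ} (s : ℝ)
    (Ω : EuclideanSpace ℝ (Fin d) → EuclideanSpace ℂ (Fin d'))
    (μ : Measure (EuclideanSpace ℝ (Fin d))) : Prop :=
  (∃ Λ : ℝ, 0 < Λ ∧ IsGood s Ω Λ μ) ∧
    ∀ ψ : EuclideanSpace ℝ (Fin d) → ℂ, (∃ C : ℝ≥0, LipschitzWith C ψ) → HasCompactSupport ψ →
      ∫ x, ψ x ∂μ = 0 → HasTOnePairing s Ω μ ψ 0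

end CZReflectionless

end

/-! Suppose `μ` is good, nonzero, and has support of finite `s`-dimensional Hausdorff measure; a
blow-up produces a nonzero reflectionless measure.

If the upper `s`-density of `μ` vanished almost everywhere, comparison with Hausdorff measure would
make the total mass of `μ` arbitrarily small. So the density is positive on a set of positive
measure (`measure_upperDensity_pos_ne_zero`). The `L²` bound makes `T_μ` of a cutoff a function `F ∈
L²(μ)` in the weak sense (`IsGood.exists_memLp_tendsto_pairing`). Hence some point `x` of positive
upper density is a Lebesgue point of `F`.

Niceness and goodness are invariant under `s`-dimensional rescaling, so the blow-ups of `μ` at `x`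
have a vague limit `ν` along scales where the density is large. It is nonzero, since the unit ball
keeps a fixed mass, and good (`TendstoVaguely.isGood`). At scale `r`, pairing with a test function
of mean zero sees only `F - F(x)`, whose normalized integral over `B(x, Rr)` tends to `0`. Meanwhile
the rescaled cutoff becomes `1` on any given ball. In the limit `T_ν(1)` pairs to zero.

Two uniform estimates justify the limit. By oddness of the kernel, pairings of Lipschitz functions
converge as `δ → 0⁺` at a rate depending on the measure only through its niceness constant
(`exists_norm_pairing_sub_le`), so `δ → 0⁺` may be taken after the vague limit. By Hölder
regularity, mass far away contributes little to pairings with mean-zero functions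
(`exists_norm_renormPotential_le`), so the choice of cutoff does not matter. -/

noncomputable section

namespace CZReflectionless

variable {d d' : ℕ} {s : ℝ} {Ω : EuclideanSpace ℝ (Fin d) → EuclideanSpace ℂ (Fin d')}
  {μ ν : Measure (EuclideanSpace ℝ (Fin d))} {Λ : ℝ}

/-! ### The kernel -/

lemma IsCZNumerator.map_zero (hΩ : IsCZNumerator Ω) : Ω 0 = 0 := by
  simpa using hΩ.homogeneous 0 0

lemma IsCZNumerator.map_neg (hΩ : IsCZNumerator Ω) (x) : Ω (-x) = -Ω x := by
  simpa using hΩ.homogeneous (-1) x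

/-- Hölder continuity on the sphere with a positive constant. -/
lemma IsCZNumerator.exists_holder (hΩ : IsCZNumerator Ω) :
    ∃ L α : ℝ, 0 < L ∧ 0 < α ∧ α ≤ 1 ∧ ∀ x y : EuclideanSpace ℝ (Fin d),
      ‖x‖ = 1 → ‖y‖ = 1 → ‖Ω x - Ω y‖ ≤ L * ‖x - y‖ ^ α := by
  obtain ⟨L, α, h0, h1, h⟩ := hΩ.holder
  refine ⟨max L 1, α, by positivity, h0, h1, fun x y hx hy => (h x y hx hy).trans ?_⟩
  gcongr
  exact le_max_left _ _

lemma IsCZNumerator.eq_norm_smul (hΩ : IsCZNumerator Ω) (x) : Ω x = ‖x‖ • Ω (‖x‖⁻¹ • x) := by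
  rw [← hΩ.homogeneous, smul_smul]
  by_cases hx : ‖x‖ = 0
  · simp [norm_eq_zero.1 hx]
  · rw [mul_inv_cancel₀ hx, one_smul]

lemma norm_inv_norm_smul {x : EuclideanSpace ℝ (Fin d)} (hx : x ≠ 0) : ‖‖x‖⁻¹ • x‖ = 1 := by
  simpa using norm_smul_inv_norm (𝕜 := ℝ) hx

lemma IsCZNumerator.exists_norm_le (hΩ : IsCZNumerator Ω) :
    ∃ C : ℝ, 0 < C ∧ ∀ x, ‖Ω x‖ ≤ C * ‖x‖ := by
  obtain ⟨L, α, hL, h0, h1, h⟩ := hΩ.exists_holder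
  by_cases hd : ∃ e : EuclideanSpace ℝ (Fin d), ‖e‖ = 1
  · obtain ⟨e, he⟩ := hd
    refine ⟨‖Ω e‖ + L * 2 ^ α, by positivity, fun x => ?_⟩
    by_cases hx : x = 0
    · simp [hx, hΩ.map_zero]
    rw [hΩ.eq_norm_smul x, norm_smul, norm_norm, mul_comm]
    gcongr
    set u := ‖x‖⁻¹ • x
    have hu : ‖u‖ = 1 := norm_inv_norm_smul hx
    have h2 : ‖u - e‖ ≤ 2 := (norm_sub_le _ _).trans (by linarith)
    calc ‖Ω u‖ = ‖Ω e + (Ω u - Ω e)‖ := by congr 1; abel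
      _ ≤ ‖Ω e‖ + ‖Ω u - Ω e‖ := norm_add_le _ _
      _ ≤ ‖Ω e‖ + L * 2 ^ α := by
        gcongr
        exact (h u e hu he).trans (by gcongr)
  -- Without unit vectors the space is trivial, and any constant works.
  · refine ⟨1, one_pos, fun x => ?_⟩
    by_cases hx : x = 0
    · simp [hx, hΩ.map_zero]
    · exact absurd ⟨_, norm_inv_norm_smul hx⟩ hd

/-- After `‖w‖⁻¹` is factored out, a radial error and `v - w` remain, each of size at most `‖v -
w‖`. Only `‖w‖` enters the denominator, because tail estimates are centred at one fixed point. -/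
lemma norm_normalize_sub_le {v w : EuclideanSpace ℝ (Fin d)} (hv : v ≠ 0) (hw : w ≠ 0) :
    ‖‖v‖⁻¹ • v - ‖w‖⁻¹ • w‖ ≤ 2 * (‖v - w‖ / ‖w‖) := by
  have hv' : 0 < ‖v‖ := norm_pos_iff.2 hv
  have hw' : 0 < ‖w‖ := norm_pos_iff.2 hw
  have : ‖v‖⁻¹ • v - ‖w‖⁻¹ • w = ‖w‖⁻¹ • ((‖w‖ - ‖v‖) • (‖v‖⁻¹ • v) + (v - w)) := by
    rw [smul_add, smul_smul, smul_smul, smul_sub, ← add_sub_assoc, ← add_smul]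
    congr 2
    field_simp
    ring
  rw [this, norm_smul, norm_inv, norm_norm]
  have h1 : ‖(‖w‖ - ‖v‖) • (‖v‖⁻¹ • v) + (v - w)‖ ≤ 2 * ‖v - w‖ := by
    refine (norm_add_le _ _).trans ?_
    rw [norm_smul, norm_inv_norm_smul hv, mul_one, Real.norm_eq_abs]
    have := abs_norm_sub_norm_le w v
    rw [norm_sub_rev] at this
    linarith
  calc ‖w‖⁻¹ * _ ≤ ‖w‖⁻¹ * (2 * ‖v - w‖) := by gcongr
    _ = _ := by ring

/-- A power function with negative exponent is Hölder away from the origin. -/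
lemma exists_abs_rpow_neg_sub_le (hs : 0 < s) {α : ℝ} (hα : 0 < α) (hα1 : α ≤ 1) :
    ∃ C : ℝ, 0 < C ∧ ∀ a b : ℝ, 0 < a → 0 < b → b ≤ 3 * a →
      |a ^ (-s) - b ^ (-s)| ≤ C * (|a - b| ^ α * b ^ (-s - α)) := by
  -- By homogeneity it suffices to treat `b = 1` and `t = a / b`; the hypothesis `b ≤ 3 * a` keeps
  -- `t` away from the singularity.
  have key : ∀ t : ℝ, 1 / 3 ≤ t →
      |t ^ (-s) - 1| ≤ (3 ^ (s + 1) * s + 3 ^ s + 1) * |t - 1| ^ α := by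
    intro t ht
    have ht0 : 0 < t := by linarith
    have hbd : |t ^ (-s) - 1| ≤ 3 ^ (s + 1) * s * |t - 1| := by
      have := (convex_Ici (1 / 3 : ℝ)).norm_image_sub_le_of_norm_hasDerivWithin_le
        (f := fun t : ℝ => t ^ (-s)) (f' := fun t => -s * t ^ (-s - 1)) (C := 3 ^ (s + 1) * s)
        (x := 1) (y := t) (fun x hx => ?_) (fun x hx => ?_) (by norm_num) ht
      · simpa using this
      · have : (0 : ℝ) < x := lt_of_lt_of_le (by norm_num) hx
        exact (Real.hasDerivAt_rpow_const (Or.inl this.ne')).hasDerivWithinAt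
      · have hx' : (1 / 3 : ℝ) ≤ x := hx
        have h0 : (0 : ℝ) < x := lt_of_lt_of_le (by norm_num) hx
        rw [norm_mul, norm_neg, Real.norm_of_nonneg hs.le,
          Real.norm_of_nonneg (by positivity), mul_comm]
        gcongr
        calc x ^ (-s - 1) ≤ (1 / 3 : ℝ) ^ (-s - 1) :=
              Real.rpow_le_rpow_of_nonpos (by norm_num) hx' (by linarith)
          _ = 3 ^ (s + 1) := by
              rw [one_div, Real.inv_rpow (by norm_num), ← Real.rpow_neg (by norm_num)]
              congr 1; ring
    have hbd2 : |t ^ (-s) - 1| ≤ 3 ^ s + 1 := by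
      have : t ^ (-s) ≤ 3 ^ s := by
        calc t ^ (-s) ≤ (1 / 3 : ℝ) ^ (-s) :=
              Real.rpow_le_rpow_of_nonpos (by norm_num) ht (by linarith)
          _ = 3 ^ s := by
              rw [one_div, Real.inv_rpow (by norm_num), ← Real.rpow_neg (by norm_num)]
              congr 1; ring
      have h0 : 0 ≤ t ^ (-s) := by positivity
      rw [abs_le]
      constructor <;> linarith [Real.rpow_nonneg (show (0 : ℝ) ≤ 3 by norm_num) s]
    -- For `|t - 1| ≤ 1` the Lipschitz bound is stronger than the Hölder one as `α ≤ 1`; otherwise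
    -- plain boundedness suffices.
    rcases le_total |t - 1| 1 with h | h
    · have : |t - 1| ≤ |t - 1| ^ α := Real.self_le_rpow_of_le_one (abs_nonneg _) h hα1
      calc |t ^ (-s) - 1| ≤ 3 ^ (s + 1) * s * |t - 1| := hbd
        _ ≤ (3 ^ (s + 1) * s + 3 ^ s + 1) * |t - 1| ^ α := by
          gcongr
          have : (0 : ℝ) < 3 ^ s := by positivity
          linarith
    · have : 1 ≤ |t - 1| ^ α := Real.one_le_rpow h hα.le
      have h3 : (0 : ℝ) < 3 ^ (s + 1) * s := by positivity
      have h4 : (0 : ℝ) < 3 ^ s := by positivity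
      calc |t ^ (-s) - 1| ≤ (3 ^ s + 1) * 1 := by linarith
        _ ≤ (3 ^ (s + 1) * s + 3 ^ s + 1) * |t - 1| ^ α := by
          gcongr
          linarith
  refine ⟨3 ^ (s + 1) * s + 3 ^ s + 1, by positivity, fun a b ha hb hab => ?_⟩
  have h1 := key (a / b) (by rw [le_div_iff₀ hb]; linarith)
  have e1 : a ^ (-s) - b ^ (-s) = b ^ (-s) * ((a / b) ^ (-s) - 1) := by
    rw [Real.div_rpow ha.le hb.le]
    have : b ^ (-s) ≠ 0 := by positivity
    field_simp
  have e2 : a / b - 1 = (a - b) / b := by field_simp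
  rw [e1, abs_mul, abs_of_nonneg (by positivity : 0 ≤ b ^ (-s))]
  refine (mul_le_mul_of_nonneg_left h1 (by positivity)).trans (le_of_eq ?_)
  rw [e2, abs_div, abs_of_pos hb, Real.div_rpow (abs_nonneg _) hb.le, Real.rpow_sub hb]
  ring

lemma czKernel_eq (hΩ : IsCZNumerator Ω) {v : EuclideanSpace ℝ (Fin d)} (hv : v ≠ 0) :
    czKernel s Ω v = ‖v‖ ^ (-s) • Ω (‖v‖⁻¹ • v) := by
  have hv' : 0 < ‖v‖ := norm_pos_iff.2 hv
  rw [czKernel, hΩ.eq_norm_smul v, smul_smul]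
  congr 1
  rw [Real.rpow_add hv', Real.rpow_one, Real.rpow_neg hv'.le]
  field_simp

/-- Hölder regularity of the kernel, quantified with respect to the second point. -/
lemma exists_czKernel_sub_le (hs : 0 < s) (hΩ : IsCZNumerator Ω) :
    ∃ C α : ℝ, 0 < C ∧ 0 < α ∧ ∀ v w : EuclideanSpace ℝ (Fin d), w ≠ 0 → ‖w‖ ≤ 3 * ‖v‖ →
      ‖czKernel s Ω v - czKernel s Ω w‖ ≤ C * (‖v - w‖ ^ α * ‖w‖ ^ (-s - α)) := by
  obtain ⟨L, α, hL, h0, h1, h⟩ := hΩ.exists_holder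
  obtain ⟨A, hA, hA'⟩ := hΩ.exists_norm_le
  obtain ⟨B, hB, hB'⟩ := exists_abs_rpow_neg_sub_le hs h0 h1
  refine ⟨3 ^ s * (L * 2 ^ α) + B * A, α, by positivity, h0, fun v w hw hvw => ?_⟩
  have hw' : 0 < ‖w‖ := norm_pos_iff.2 hw
  have hv' : 0 < ‖v‖ := by linarith
  have hv : v ≠ 0 := norm_pos_iff.1 hv'
  rw [czKernel_eq hΩ hv, czKernel_eq hΩ hw]
  -- Split into an angular difference, controlled by Hölder continuity on the sphere, and a radial
  -- one, controlled by the power function.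
  have e : ‖v‖ ^ (-s) • Ω (‖v‖⁻¹ • v) - ‖w‖ ^ (-s) • Ω (‖w‖⁻¹ • w)
      = ‖v‖ ^ (-s) • (Ω (‖v‖⁻¹ • v) - Ω (‖w‖⁻¹ • w))
        + (‖v‖ ^ (-s) - ‖w‖ ^ (-s)) • Ω (‖w‖⁻¹ • w) := by
    rw [smul_sub, sub_smul]; abel
  rw [e, add_mul]
  refine (norm_add_le _ _).trans (add_le_add ?_ ?_)
  · rw [norm_smul, Real.norm_of_nonneg (by positivity)]
    have i1 : ‖v‖ ^ (-s) ≤ 3 ^ s * ‖w‖ ^ (-s) := by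
      calc ‖v‖ ^ (-s) ≤ (‖w‖ / 3) ^ (-s) :=
            Real.rpow_le_rpow_of_nonpos (by positivity) (by linarith) (by linarith)
        _ = 3 ^ s * ‖w‖ ^ (-s) := by
            rw [Real.div_rpow hw'.le (by norm_num), Real.rpow_neg (by norm_num : (0:ℝ) ≤ 3)]
            field_simp
    have i2 : ‖Ω (‖v‖⁻¹ • v) - Ω (‖w‖⁻¹ • w)‖ ≤ L * (2 * (‖v - w‖ / ‖w‖)) ^ α := by
      refine (h _ _ (norm_inv_norm_smul hv) (norm_inv_norm_smul hw)).trans ?_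
      gcongr
      exact norm_normalize_sub_le hv hw
    refine (mul_le_mul i1 i2 (norm_nonneg _) (by positivity)).trans (le_of_eq ?_)
    rw [Real.mul_rpow (by norm_num) (by positivity), Real.div_rpow (norm_nonneg _) hw'.le,
      Real.rpow_sub hw']
    ring
  · rw [norm_smul, Real.norm_eq_abs]
    have i1 := hB' ‖v‖ ‖w‖ hv' hw' hvw
    have i2 : |‖v‖ - ‖w‖| ^ α ≤ ‖v - w‖ ^ α := by
      gcongr
      exact abs_norm_sub_norm_le v w
    have i3 : ‖Ω (‖w‖⁻¹ • w)‖ ≤ A := by simpa [norm_inv_norm_smul hw] using hA' (‖w‖⁻¹ • w)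
    calc |‖v‖ ^ (-s) - ‖w‖ ^ (-s)| * ‖Ω (‖w‖⁻¹ • w)‖
        ≤ B * (‖v - w‖ ^ α * ‖w‖ ^ (-s - α)) * A := by
          refine mul_le_mul (i1.trans ?_) i3 (norm_nonneg _) (by positivity)
          gcongr
      _ = _ := by ring

lemma IsCZNumerator.continuous (hΩ : IsCZNumerator Ω) : Continuous Ω := by
  obtain ⟨L, α, hL, h0, h1, h⟩ := hΩ.exists_holder
  obtain ⟨A, hA, hA'⟩ := hΩ.exists_norm_le
  rw [continuous_iff_continuousAt]
  intro w
  by_cases hw : w = 0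
  · subst hw
    rw [ContinuousAt, hΩ.map_zero]
    refine squeeze_zero_norm hA' ?_
    have : Continuous fun x : EuclideanSpace ℝ (Fin d) => A * ‖x‖ := by fun_prop
    simpa using this.tendsto 0
  · have hw' : 0 < ‖w‖ := norm_pos_iff.2 hw
    have hsph : Tendsto (fun v : EuclideanSpace ℝ (Fin d) => Ω (‖v‖⁻¹ • v)) (𝓝 w)
        (𝓝 (Ω (‖w‖⁻¹ • w))) := by
      rw [tendsto_iff_norm_sub_tendsto_zero]
      have hc : ContinuousAt (fun v : EuclideanSpace ℝ (Fin d) =>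
          L * (2 * (‖v - w‖ / ‖w‖)) ^ α) w := by
        refine ContinuousAt.mul continuousAt_const
          (ContinuousAt.rpow_const (by fun_prop) (Or.inr h0.le))
      have hc0 : Tendsto (fun v : EuclideanSpace ℝ (Fin d) =>
          L * (2 * (‖v - w‖ / ‖w‖)) ^ α) (𝓝 w) (𝓝 0) := by
        simpa [Real.zero_rpow h0.ne'] using hc.tendsto
      refine squeeze_zero' (Eventually.of_forall fun _ => norm_nonneg _) ?_ hc0
      filter_upwards [isOpen_ne.mem_nhds hw] with v hv
      refine (h _ _ (norm_inv_norm_smul hv) (norm_inv_norm_smul hw)).trans ?_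
      gcongr
      exact norm_normalize_sub_le hv hw
    rw [ContinuousAt, hΩ.eq_norm_smul w]
    exact (continuous_norm.continuousAt.tendsto.smul hsph).congr
      fun v => (hΩ.eq_norm_smul v).symm

lemma continuous_czKernelReg (hs : 0 < s) (hΩ : IsCZNumerator Ω) {δ : ℝ} (hδ : 0 < δ) :
    Continuous (czKernelReg s Ω δ) := by
  have h1 : ∀ x : EuclideanSpace ℝ (Fin d), max δ ‖x‖ ^ (s + 1) ≠ 0 := fun x => by positivity
  have h2 : Continuous fun x : EuclideanSpace ℝ (Fin d) => max δ ‖x‖ ^ (s + 1) :=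
    (continuous_const.max continuous_norm).rpow_const fun x => Or.inr (by positivity)
  exact (h2.inv₀ h1).smul hΩ.continuous

lemma measurable_czKernel (hΩ : IsCZNumerator Ω) : Measurable (czKernel s Ω) := by
  have := hΩ.continuous.measurable
  unfold czKernel
  fun_prop

lemma czKernelReg_eq_czKernel {δ : ℝ} {x : EuclideanSpace ℝ (Fin d)} (h : δ ≤ ‖x‖) :
    czKernelReg s Ω δ x = czKernel s Ω x := by
  rw [czKernelReg, czKernel, max_eq_right h]

lemma czKernelReg_neg (hΩ : IsCZNumerator Ω) (δ : ℝ) (x : EuclideanSpace ℝ (Fin d)) :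
    czKernelReg s Ω δ (-x) = -czKernelReg s Ω δ x := by
  simp [czKernelReg, hΩ.map_neg]

/-- Homogeneity of degree `-s` survives regularization only if `δ` is rescaled too. A bound uniform
in `δ` is therefore scale invariant. -/
lemma czKernelReg_smul (hΩ : IsCZNumerator Ω) {r δ : ℝ} (hr : 0 < r) (hδ : 0 < δ)
    (x : EuclideanSpace ℝ (Fin d)) :
    czKernelReg s Ω δ (r⁻¹ • x) = r ^ s • czKernelReg s Ω (r * δ) x := by
  have e : max (r * δ) ‖x‖ = r * max δ ‖r⁻¹ • x‖ := by
    rw [mul_max_of_nonneg _ _ hr.le, norm_smul, norm_inv, Real.norm_of_nonneg hr.le,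
      mul_inv_cancel_left₀ hr.ne']
  rw [czKernelReg, czKernelReg, e, hΩ.homogeneous, smul_smul, smul_smul,
    Real.mul_rpow hr.le (by positivity), Real.rpow_add hr, Real.rpow_one]
  congr 1
  have : max δ ‖r⁻¹ • x‖ ^ (s + 1) ≠ 0 := by positivity
  field_simp

/-- The basic size bound for the regularized kernels. -/
lemma exists_norm_czKernelReg_le (hs : 0 < s) (hΩ : IsCZNumerator Ω) :
    ∃ C : ℝ, 0 < C ∧ ∀ δ : ℝ, 0 < δ → ∀ x : EuclideanSpace ℝ (Fin d),
      ‖czKernelReg s Ω δ x‖ ≤ C * δ ^ (-s) ∧ (x ≠ 0 → ‖czKernelReg s Ω δ x‖ ≤ C * ‖x‖ ^ (-s)) ∧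
      ‖x‖ * ‖czKernelReg s Ω δ x‖ ≤ C * ‖x‖ ^ (1 - s) := by
  obtain ⟨A, hA, hA'⟩ := hΩ.exists_norm_le
  refine ⟨A, hA, fun δ hδ x => ?_⟩
  have hm : 0 < max δ ‖x‖ := by positivity
  have main : ‖czKernelReg s Ω δ x‖ ≤ A * max δ ‖x‖ ^ (-s) := by
    rw [czKernelReg, norm_smul, norm_inv, Real.norm_of_nonneg (by positivity)]
    calc (max δ ‖x‖ ^ (s + 1))⁻¹ * ‖Ω x‖ ≤ (max δ ‖x‖ ^ (s + 1))⁻¹ * (A * max δ ‖x‖) := by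
          gcongr
          exact (hA' x).trans (by gcongr; exact le_max_right _ _)
      _ = A * max δ ‖x‖ ^ (-s) := by
          rw [Real.rpow_add hm, Real.rpow_one, Real.rpow_neg hm.le]
          field_simp
  have m2 : x ≠ 0 → ‖czKernelReg s Ω δ x‖ ≤ A * ‖x‖ ^ (-s) := fun hx => by
    refine main.trans (mul_le_mul_of_nonneg_left ?_ hA.le)
    exact Real.rpow_le_rpow_of_nonpos (norm_pos_iff.2 hx) (le_max_right _ _) (by linarith)
  refine ⟨main.trans ?_, m2, ?_⟩
  · refine mul_le_mul_of_nonneg_left ?_ hA.le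
    exact Real.rpow_le_rpow_of_nonpos hδ (le_max_left _ _) (by linarith)
  -- At the origin the left side is zero and the right side nonnegative, whatever the value of `0 ^
  -- (1 - s)`.
  · by_cases hx : x = 0
    · simp only [hx, norm_zero, zero_mul]
      positivity
    · have hx' : 0 < ‖x‖ := norm_pos_iff.2 hx
      refine (mul_le_mul_of_nonneg_left (m2 hx) (norm_nonneg _)).trans (le_of_eq ?_)
      rw [sub_eq_add_neg, Real.rpow_add hx', Real.rpow_one]
      ring

/-! ### Nice measures -/

lemma IsNice.isLocallyFiniteMeasure (h : IsNice s Λ μ) : IsLocallyFiniteMeasure μ :=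
  ⟨fun x => ⟨Metric.ball x 1, Metric.ball_mem_nhds x one_pos,
    (h x 1 one_pos).trans_lt ENNReal.ofReal_lt_top⟩⟩

lemma IsNice.measure_closedBall_le (h : IsNice s Λ μ) (x) {r : ℝ} (hr : 0 < r) :
    μ (Metric.closedBall x r) ≤ ENNReal.ofReal (Λ * (2 * r) ^ s) :=
  (measure_mono (Metric.closedBall_subset_ball (by linarith))).trans (h x _ (by positivity))

lemma IsNice.real_ball_le (h : IsNice s Λ μ) (hΛ : 0 ≤ Λ) (x) {r : ℝ} (hr : 0 < r) :
    μ.real (Metric.ball x r) ≤ Λ * r ^ s :=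
  ENNReal.toReal_le_of_le_ofReal (by positivity) (h x r hr)

lemma IsNice.measure_singleton (hs : 0 < s) (h : IsNice s Λ μ) (x) : μ {x} = 0 := by
  have hc : Tendsto (fun r : ℝ => ENNReal.ofReal (Λ * r ^ s)) (𝓝[>] 0) (𝓝 0) := by
    have : Continuous fun r : ℝ => ENNReal.ofReal (Λ * r ^ s) :=
      ENNReal.continuous_ofReal.comp
        (continuous_const.mul (continuous_id.rpow_const fun _ => Or.inr hs.le))
    have h2 := this.tendsto 0
    simp only [Real.zero_rpow hs.ne', mul_zero, ENNReal.ofReal_zero] at h2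
    exact h2.mono_left nhdsWithin_le_nhds
  refine le_antisymm (ge_of_tendsto hc ?_) zero_le
  filter_upwards [self_mem_nhdsWithin] with r hr
  exact (measure_mono (by simpa using hr)).trans (h x r hr)

lemma setLIntegral_le_tsum_of_cover {α : Type*} [MeasurableSpace α] {μ : Measure α} {S : Set α}
    {A : ℕ → Set α} (hA : ∀ k, MeasurableSet (A k)) (hS : S ⊆ ⋃ k, A k) {f : α → ℝ≥0∞}
    {c : ℕ → ℝ≥0∞} (hf : ∀ k, ∀ y ∈ A k, f y ≤ c k) :
    ∫⁻ y in S, f y ∂μ ≤ ∑' k, c k * μ (A k) := by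
  refine (lintegral_mono_set hS).trans ((lintegral_iUnion_le _ _).trans ?_)
  gcongr with k
  calc ∫⁻ y in A k, f y ∂μ ≤ ∫⁻ _ in A k, c k ∂μ := setLIntegral_mono' (hA k) (hf k)
    _ = c k * μ (A k) := setLIntegral_const _ _

lemma tsum_ofReal_geometric {c q : ℝ} (hc : 0 ≤ c) (hq : 0 ≤ q) (hq1 : q < 1) :
    ∑' k : ℕ, ENNReal.ofReal (c * q ^ k) = ENNReal.ofReal (c / (1 - q)) := by
  rw [← ENNReal.ofReal_tsum_of_nonneg (fun k => by positivity)
    ((summable_geometric_of_lt_one hq hq1).mul_left c), tsum_mul_left,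
    tsum_geometric_of_lt_one hq hq1, div_eq_mul_inv]

/-- Decay of the tail of a Riesz-type potential of a nice measure. -/
lemma IsNice.lintegral_far_le (hs : 0 < s) (hΛ : 0 ≤ Λ) (h : IsNice s Λ μ) {a : ℝ} (ha : 0 < a)
    (x : EuclideanSpace ℝ (Fin d)) {M : ℝ} (hM : 0 < M) :
    ∫⁻ y in (Metric.ball x M)ᶜ, ENNReal.ofReal (‖x - y‖ ^ (-s - a)) ∂μ ≤
      ENNReal.ofReal (Λ * 2 ^ s / (1 - 2 ^ (-a)) * M ^ (-a)) := by
  -- Dyadic annuli: on the `k`-th one the integrand is at most `(2 ^ k * M) ^ (-s - a)` and the mass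
  -- at most `Λ * (2 ^ (k + 1) * M) ^ s`, so the products form a geometric series of ratio `2 ^
  -- (-a)`.
  set A : ℕ → Set (EuclideanSpace ℝ (Fin d)) :=
    fun k => {y | 2 ^ k * M ≤ dist y x} ∩ {y | dist y x < 2 ^ (k + 1) * M}
  have hA : ∀ k, MeasurableSet (A k) := fun k =>
    (measurableSet_le measurable_const (by fun_prop)).inter
      (measurableSet_lt (by fun_prop) measurable_const)
  have hcov : (Metric.ball x M)ᶜ ⊆ ⋃ k, A k := by
    intro y hy
    simp only [Set.mem_compl_iff, Metric.mem_ball, not_lt] at hy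
    obtain ⟨n, h1, h2⟩ := exists_nat_pow_near (x := dist y x / M) (y := 2)
      (by rwa [one_le_div₀ hM]) one_lt_two
    exact Set.mem_iUnion.2 ⟨n, (le_div_iff₀ hM).1 h1, (div_lt_iff₀ hM).1 h2⟩
  have hq : (2 : ℝ) ^ (-a) < 1 := Real.rpow_lt_one_of_one_lt_of_neg one_lt_two (by linarith)
  refine (setLIntegral_le_tsum_of_cover hA hcov
    (c := fun k => ENNReal.ofReal ((2 ^ k * M) ^ (-s - a))) ?_).trans ?_
  · rintro k y ⟨h1, h2⟩
    rw [← dist_eq_norm, dist_comm]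
    exact ENNReal.ofReal_le_ofReal
      (Real.rpow_le_rpow_of_nonpos (by positivity) h1 (by linarith))
  · have key : ∀ k : ℕ, ENNReal.ofReal ((2 ^ k * M) ^ (-s - a)) * μ (A k) ≤
        ENNReal.ofReal (Λ * 2 ^ s * M ^ (-a) * (2 ^ (-a)) ^ k) := by
      intro k
      have : μ (A k) ≤ ENNReal.ofReal (Λ * (2 ^ (k + 1) * M) ^ s) :=
        (measure_mono fun y hy => hy.2).trans (h x _ (by positivity))
      refine (mul_le_mul_right this _).trans (le_of_eq ?_)
      rw [← ENNReal.ofReal_mul (by positivity)]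
      congr 1
      have e : (2 : ℝ) ^ (k + 1) * M = 2 * (2 ^ k * M) := by ring
      have hp : (0 : ℝ) < 2 ^ k * M := by positivity
      rw [e, Real.mul_rpow (by norm_num) hp.le, Real.rpow_sub hp, Real.rpow_neg hp.le s,
        Real.mul_rpow (by positivity) hM.le (z := a), Real.rpow_neg hM.le,
        Real.rpow_neg (by norm_num) a, inv_pow, ← Real.rpow_natCast (2 ^ a), ← Real.rpow_mul
        (by norm_num), mul_comm a, Real.rpow_mul (by norm_num), Real.rpow_natCast]
      field_simp
    refine (ENNReal.tsum_le_tsum key).trans (le_of_eq ?_)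
    rw [tsum_ofReal_geometric (by positivity) (by positivity) hq]
    congr 1
    ring

/-- The local singular integral with one order of cancellation. -/
lemma IsNice.lintegral_near_le (hs : 0 < s) (hΛ : 0 ≤ Λ) (h : IsNice s Λ μ)
    (x : EuclideanSpace ℝ (Fin d)) {δ : ℝ} (hδ : 0 < δ) :
    ∫⁻ y in Metric.ball x δ, ENNReal.ofReal (‖x - y‖ ^ (1 - s)) ∂μ ≤
      ENNReal.ofReal (Λ * 2 ^ (2 * s + 1) * δ) := by
  set A : ℕ → Set (EuclideanSpace ℝ (Fin d)) :=
    fun k => {y | (1 / 2) ^ (k + 1) * δ < dist y x} ∩ {y | dist y x ≤ (1 / 2) ^ k * δ}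
  have hA : ∀ k, MeasurableSet (A k) := fun k =>
    (measurableSet_lt measurable_const (by fun_prop)).inter
      (measurableSet_le (by fun_prop) measurable_const)
  have hcov : Metric.ball x δ \ {x} ⊆ ⋃ k, A k := by
    rintro y ⟨hy, hyx⟩
    have hpos : 0 < dist y x := dist_pos.2 hyx
    obtain ⟨n, h1, h2⟩ := exists_nat_pow_near_of_lt_one (x := dist y x / δ) (y := (1 / 2 : ℝ))
      (by positivity) (by rw [div_le_one hδ]; exact (Metric.mem_ball.1 hy).le) (by norm_num)
      (by norm_num)
    exact Set.mem_iUnion.2 ⟨n, (lt_div_iff₀ hδ).1 h1, (div_le_iff₀ hδ).1 h2⟩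
  -- The centre lies in none of the shrinking annuli, but it is a null set.
  have hae : (Metric.ball x δ \ {x} : Set _) =ᵐ[μ] Metric.ball x δ :=
    sdiff_null_ae_eq_self (h.measure_singleton hs x)
  rw [← setLIntegral_congr hae]
  -- The factor `2 ^ s` covers both signs of `1 - s`: the power is largest at the outer radius if `s
  -- ≤ 1`, and at the inner one if `s ≥ 1`, where passing to the outer radius costs `2 ^ (s - 1)`.
  refine (setLIntegral_le_tsum_of_cover hA hcov
    (c := fun k => ENNReal.ofReal (2 ^ s * ((1 / 2) ^ k * δ) ^ (1 - s))) ?_).trans ?_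
  · rintro k y ⟨h1, h2⟩
    rw [← dist_eq_norm, dist_comm]
    refine ENNReal.ofReal_le_ofReal ?_
    have hp : (0 : ℝ) < (1 / 2) ^ k * δ := by positivity
    have hpy : 0 < dist y x := lt_trans (by positivity) h1
    rcases le_total s 1 with h3 | h3
    · calc dist y x ^ (1 - s) ≤ 1 * ((1 / 2) ^ k * δ) ^ (1 - s) := by
            rw [one_mul]; exact Real.rpow_le_rpow hpy.le h2 (by linarith)
        _ ≤ _ := by
            gcongr
            exact Real.one_le_rpow (by norm_num) hs.le
    · calc dist y x ^ (1 - s) ≤ ((1 / 2) ^ (k + 1) * δ) ^ (1 - s) :=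
            Real.rpow_le_rpow_of_nonpos (by positivity) h1.le (by linarith)
        _ = 2 ^ (s - 1) * ((1 / 2) ^ k * δ) ^ (1 - s) := by
            have e : (1 / 2 : ℝ) ^ (k + 1) * δ = 2⁻¹ * ((1 / 2) ^ k * δ) := by ring
            rw [e, Real.mul_rpow (by norm_num) hp.le, Real.inv_rpow (by norm_num),
              ← Real.rpow_neg (by norm_num)]
            congr 2
            ring
        _ ≤ _ := by
            gcongr
            · norm_num
            · linarith
  · have key : ∀ k : ℕ, ENNReal.ofReal (2 ^ s * ((1 / 2) ^ k * δ) ^ (1 - s)) * μ (A k) ≤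
        ENNReal.ofReal (Λ * 2 ^ (2 * s) * δ * (1 / 2) ^ k) := by
      intro k
      have hp : (0 : ℝ) < (1 / 2) ^ k * δ := by positivity
      have : μ (A k) ≤ ENNReal.ofReal (Λ * (2 * ((1 / 2) ^ k * δ)) ^ s) :=
        (measure_mono fun y hy => hy.2).trans (h.measure_closedBall_le x hp)
      refine (mul_le_mul_right this _).trans (le_of_eq ?_)
      rw [← ENNReal.ofReal_mul (by positivity)]
      congr 1
      rw [Real.mul_rpow (by norm_num) hp.le, Real.rpow_sub hp, Real.rpow_one, two_mul s,
        Real.rpow_add (by norm_num)]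
      field_simp
    refine (ENNReal.tsum_le_tsum key).trans (le_of_eq ?_)
    rw [tsum_ofReal_geometric (by positivity) (by positivity) (by norm_num)]
    congr 1
    rw [Real.rpow_add (by norm_num), Real.rpow_one]
    ring

lemma IsNice.integrableOn_far (hs : 0 < s) (hΛ : 0 ≤ Λ) (h : IsNice s Λ μ) {a : ℝ} (ha : 0 < a)
    (x : EuclideanSpace ℝ (Fin d)) {M : ℝ} (hM : 0 < M) :
    IntegrableOn (fun y => ‖x - y‖ ^ (-s - a)) (Metric.ball x M)ᶜ μ := by
  refine ⟨Measurable.aestronglyMeasurable (by fun_prop), ?_⟩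
  rw [hasFiniteIntegral_iff_ofReal (Eventually.of_forall fun y => by positivity)]
  exact (h.lintegral_far_le hs hΛ ha x hM).trans_lt ENNReal.ofReal_lt_top

lemma IsNice.setIntegral_far_le (hs : 0 < s) (hΛ : 0 ≤ Λ) (h : IsNice s Λ μ) {a : ℝ} (ha : 0 < a)
    (x : EuclideanSpace ℝ (Fin d)) {M : ℝ} (hM : 0 < M) :
    ∫ y in (Metric.ball x M)ᶜ, ‖x - y‖ ^ (-s - a) ∂μ ≤
      Λ * 2 ^ s / (1 - 2 ^ (-a)) * M ^ (-a) := by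
  have hq : (2 : ℝ) ^ (-a) < 1 := Real.rpow_lt_one_of_one_lt_of_neg one_lt_two (by linarith)
  have hq' : 0 < 1 - (2 : ℝ) ^ (-a) := by linarith
  rw [integral_eq_lintegral_of_nonneg_ae (Eventually.of_forall fun y => by positivity)
    (Measurable.aestronglyMeasurable (by fun_prop))]
  exact ENNReal.toReal_le_of_le_ofReal (by positivity) (h.lintegral_far_le hs hΛ ha x hM)

/-- The regularized kernel is square integrable against a nice measure. -/
lemma IsNice.memLp_czKernelReg (hs : 0 < s) (hΛ : 0 ≤ Λ) (hΩ : IsCZNumerator Ω)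
    (h : IsNice s Λ μ) {δ : ℝ} (hδ : 0 < δ) (x : EuclideanSpace ℝ (Fin d)) :
    MemLp (fun y => czKernelReg s Ω δ (x - y)) 2 μ := by
  obtain ⟨C, hC, hK⟩ := exists_norm_czKernelReg_le hs hΩ
  have hm : AEStronglyMeasurable (fun y => czKernelReg s Ω δ (x - y)) μ :=
    ((continuous_czKernelReg hs hΩ hδ).comp (by fun_prop)).aestronglyMeasurable
  rw [memLp_two_iff_integrable_sq_norm hm, ← integrableOn_univ,
    ← Set.union_compl_self (Metric.ball x 1)]
  refine IntegrableOn.union ?_ ?_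
  · refine Measure.integrableOn_of_bounded (M := (C * δ ^ (-s)) ^ 2)
      ((h x 1 one_pos).trans_lt ENNReal.ofReal_lt_top).ne (hm.norm.pow 2) ?_
    refine Eventually.of_forall fun y => ?_
    rw [Real.norm_of_nonneg (by positivity)]
    gcongr
    exact (hK δ hδ _).1
  -- The squared kernel decays like `‖x - y‖ ^ (-s - s)`, so the tail bound applies with `a = s`.
  · refine Integrable.mono' ((h.integrableOn_far hs hΛ hs x one_pos).const_mul (C ^ 2))
      ((hm.norm.pow 2).restrict) ?_
    filter_upwards [ae_restrict_mem Metric.isOpen_ball.measurableSet.compl] with y hy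
    have hxy : x - y ≠ 0 := by
      rintro h0
      rw [sub_eq_zero] at h0
      simp [h0] at hy
    rw [Real.norm_of_nonneg (by positivity)]
    calc ‖czKernelReg s Ω δ (x - y)‖ ^ 2 ≤ (C * ‖x - y‖ ^ (-s)) ^ 2 := by
          gcongr
          exact (hK δ hδ _).2.1 hxy
      _ = C ^ 2 * ‖x - y‖ ^ (-s - s) := by
          rw [mul_pow, ← Real.rpow_natCast (‖x - y‖ ^ (-s)), ← Real.rpow_mul (norm_nonneg _)]
          congr 2
          push_cast
          ring

/-! ### Pairings -/

/-- The pairing `⟨T_{μ,δ}(f), g⟩_μ`. -/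
def pairing (s : ℝ) (Ω : EuclideanSpace ℝ (Fin d) → EuclideanSpace ℂ (Fin d'))
    (μ : Measure (EuclideanSpace ℝ (Fin d))) (δ : ℝ) (f g : EuclideanSpace ℝ (Fin d) → ℂ) :
    EuclideanSpace ℂ (Fin d') :=
  ∫ x, g x • regOp s Ω μ δ f x ∂μ

/-- The potential of `f`, renormalized to vanish at `z`. -/
def renormPotential (s : ℝ) (Ω : EuclideanSpace ℝ (Fin d) → EuclideanSpace ℂ (Fin d'))
    (μ : Measure (EuclideanSpace ℝ (Fin d))) (f : EuclideanSpace ℝ (Fin d) → ℂ)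
    (z x : EuclideanSpace ℝ (Fin d)) : EuclideanSpace ℂ (Fin d') :=
  ∫ y, f y • (czKernel s Ω (x - y) - czKernel s Ω (z - y)) ∂μ

lemma continuous_integral_of_hasCompactSupport [IsLocallyFiniteMeasure μ]
    {E : Type*} [NormedAddCommGroup E] [NormedSpace ℝ E]
    {Y : Type*} [TopologicalSpace Y] [FirstCountableTopology Y] [LocallyCompactSpace Y]
    {H : Y → EuclideanSpace ℝ (Fin d) → E} (hH : Continuous H.uncurry)
    {L : Set (EuclideanSpace ℝ (Fin d))} (hL : IsCompact L) (h0 : ∀ x, ∀ y ∉ L, H x y = 0) :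
    Continuous fun x => ∫ y, H x y ∂μ := by
  have := continuous_parametric_integral_of_continuous (μ := μ) hH hL
  refine this.congr fun x => ?_
  exact setIntegral_eq_integral_of_forall_compl_eq_zero fun y hy => h0 x y hy

lemma integrable_smul_czKernelReg (hs : 0 < s) (hΛ : 0 ≤ Λ) (hΩ : IsCZNumerator Ω)
    (h : IsNice s Λ μ) {δ : ℝ} (hδ : 0 < δ) {f : EuclideanSpace ℝ (Fin d) → ℂ}
    (hf : MemLp f 2 μ) (x : EuclideanSpace ℝ (Fin d)) :
    Integrable (fun y => f y • czKernelReg s Ω δ (x - y)) μ :=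
  memLp_one_iff_integrable.1 ((h.memLp_czKernelReg hs hΛ hΩ hδ x).smul hf)

lemma continuous_regOp (hs : 0 < s) (hΩ : IsCZNumerator Ω) [IsLocallyFiniteMeasure μ]
    {δ : ℝ} (hδ : 0 < δ) {f : EuclideanSpace ℝ (Fin d) → ℂ} (hf : Continuous f)
    (hfc : HasCompactSupport f) : Continuous (regOp s Ω μ δ f) := by
  have hK := continuous_czKernelReg hs hΩ hδ
  refine continuous_integral_of_hasCompactSupport (L := tsupport f) ?_ hfc.isCompact ?_
  · exact (hf.comp continuous_snd).smul (hK.comp (continuous_fst.sub continuous_snd))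
  · intro x y hy
    rw [image_eq_zero_of_notMem_tsupport hy, zero_smul]

lemma integrable_smul_regOp (hs : 0 < s) (hΩ : IsCZNumerator Ω) [IsLocallyFiniteMeasure μ]
    {δ : ℝ} (hδ : 0 < δ) {f g : EuclideanSpace ℝ (Fin d) → ℂ} (hf : Continuous f)
    (hfc : HasCompactSupport f) (hg : Continuous g) (hgc : HasCompactSupport g) :
    Integrable (fun x => g x • regOp s Ω μ δ f x) μ :=
  (hg.smul (continuous_regOp hs hΩ hδ hf hfc)).integrable_of_hasCompactSupport hgc.smul_right

/-! #### Antisymmetrization -/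

lemma integrable_smul_sub_kernel [IsLocallyFiniteMeasure μ]
    {k : EuclideanSpace ℝ (Fin d) → EuclideanSpace ℂ (Fin d')} (hk : Continuous k)
    {f g : EuclideanSpace ℝ (Fin d) → ℂ} (hf : Continuous f)
    (hfc : HasCompactSupport f) (hg : Continuous g) (hgc : HasCompactSupport g) :
    Integrable (Function.uncurry fun x y => (g x * f y) • k (x - y)) (μ.prod μ) := by
  refine Continuous.integrable_of_hasCompactSupport ?_ ?_
  · exact ((hg.comp continuous_fst).mul (hf.comp continuous_snd)).smul
      (hk.comp (continuous_fst.sub continuous_snd))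
  · refine HasCompactSupport.intro (hgc.isCompact.prod hfc.isCompact) ?_
    rintro ⟨x, y⟩ hxy
    simp only [Set.mem_prod, not_and_or] at hxy
    rcases hxy with hx | hy
    · simp [Function.uncurry, image_eq_zero_of_notMem_tsupport hx]
    · simp [Function.uncurry, image_eq_zero_of_notMem_tsupport hy]

/-- Exchanging the variables flips the sign of the kernel. For Lipschitz `f` and `g` the
antisymmetrized factor vanishes to first order on the diagonal, which lowers the singularity from
`-s` to the integrable `1 - s`. -/
lemma two_smul_integral_odd_kernel [IsLocallyFiniteMeasure μ]
    {k : EuclideanSpace ℝ (Fin d) → EuclideanSpace ℂ (Fin d')} (hk : Continuous k)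
    (hodd : ∀ x, k (-x) = -k x)
    {f g : EuclideanSpace ℝ (Fin d) → ℂ} (hf : Continuous f)
    (hfc : HasCompactSupport f) (hg : Continuous g) (hgc : HasCompactSupport g) :
    (2 : ℝ) • ∫ x, g x • ∫ y, f y • k (x - y) ∂μ ∂μ =
      ∫ x, ∫ y, (g x * f y - g y * f x) • k (x - y) ∂μ ∂μ := by
  have i1 := integrable_smul_sub_kernel (μ := μ) hk hf hfc hg hgc
  have i2 := integrable_smul_sub_kernel (μ := μ) hk hg hgc hf hfc
  have e1 : ∫ x, g x • ∫ y, f y • k (x - y) ∂μ ∂μ = ∫ x, ∫ y, (g x * f y) • k (x - y) ∂μ ∂μ := by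
    congr 1 with x : 1
    rw [← integral_smul]
    simp only [smul_smul]
  have e2 : ∫ x, ∫ y, (g x * f y) • k (x - y) ∂μ ∂μ =
      -∫ x, ∫ y, (f x * g y) • k (x - y) ∂μ ∂μ := by
    rw [integral_integral_swap i1, ← integral_neg]
    congr 1 with x : 1
    rw [← integral_neg]
    congr 1 with y : 1
    rw [← neg_sub x y, hodd, smul_neg, mul_comm]
  have e3 : ∫ x, ∫ y, (g x * f y - g y * f x) • k (x - y) ∂μ ∂μ =
      ∫ x, ∫ y, (g x * f y) • k (x - y) ∂μ ∂μ - ∫ x, ∫ y, (f x * g y) • k (x - y) ∂μ ∂μ := by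
    refine Eq.trans ?_ (integral_integral_sub i1 i2)
    simp only [Function.uncurry, ← sub_smul, mul_comm (f _)]
  rw [e1, e3, two_smul]
  nth_rw 2 [e2]
  rw [sub_eq_add_neg]

/-- Uniform Cauchy estimate for the regularized pairings of Lipschitz functions. -/
lemma exists_norm_pairing_sub_le (hs : 0 < s) (hΩ : IsCZNumerator Ω) :
    ∃ C : ℝ, 0 < C ∧ ∀ (Λ : ℝ) (μ : Measure (EuclideanSpace ℝ (Fin d))), 0 ≤ Λ → IsNice s Λ μ →
      ∀ f g : EuclideanSpace ℝ (Fin d) → ℂ, Continuous f → HasCompactSupport f →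
      Continuous g → HasCompactSupport g → ∀ (x₀ : EuclideanSpace ℝ (Fin d)) (R A : ℝ), 0 < R →
      0 ≤ A → (∀ x, x ∉ Metric.ball x₀ R → g x = 0) →
      (∀ x y, ‖g x * f y - g y * f x‖ ≤ A * ‖x - y‖) →
      ∀ δ δ' : ℝ, 0 < δ' → δ' ≤ δ →
      ‖pairing s Ω μ δ f g - pairing s Ω μ δ' f g‖ ≤ C * A * Λ ^ 2 * R ^ s * δ := by
  obtain ⟨C, hC, hK⟩ := exists_norm_czKernelReg_le hs hΩ
  refine ⟨2 * C * 2 ^ (2 * s + 1), by positivity, ?_⟩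
  intro Λ μ hΛ hμ f g hf hfc hg hgc x₀ R A hR hA hg0 hA' δ δ' hδ' hδδ'
  have hδ : 0 < δ := hδ'.trans_le hδδ'
  have := hμ.isLocallyFiniteMeasure
  set k : EuclideanSpace ℝ (Fin d) → EuclideanSpace ℂ (Fin d') :=
    fun x => czKernelReg s Ω δ x - czKernelReg s Ω δ' x with hkdef
  have hkc : Continuous k :=
    (continuous_czKernelReg hs hΩ hδ).sub (continuous_czKernelReg hs hΩ hδ')
  have hodd : ∀ x, k (-x) = -k x := fun x => by
    simp only [hkdef, czKernelReg_neg hΩ]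
    abel
  have hL2 : MemLp f 2 μ := hf.memLp_of_hasCompactSupport hfc
  have e : pairing s Ω μ δ f g - pairing s Ω μ δ' f g =
      ∫ x, g x • ∫ y, f y • k (x - y) ∂μ ∂μ := by
    rw [pairing, pairing, ← integral_sub (integrable_smul_regOp hs hΩ hδ hf hfc hg hgc)
      (integrable_smul_regOp hs hΩ hδ' hf hfc hg hgc)]
    congr 1 with x : 1
    rw [← smul_sub, regOp, regOp, ← integral_sub
      (integrable_smul_czKernelReg hs hΛ hΩ hμ hδ hL2 x)
      (integrable_smul_czKernelReg hs hΛ hΩ hμ hδ' hL2 x)]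
    simp only [hkdef, smul_sub]
  -- Where `‖x‖ ≥ δ ≥ δ'` both regularizations equal the full kernel, so their difference lives in
  -- the `δ`-ball; this produces the factor `δ` in the estimate.
  have hkW : ∀ x, ‖x‖ * ‖k x‖ ≤ 2 * C * (Metric.ball (0 : EuclideanSpace ℝ (Fin d)) δ).indicator
      (fun x => ‖x‖ ^ (1 - s)) x := by
    intro x
    by_cases hx : x ∈ Metric.ball (0 : EuclideanSpace ℝ (Fin d)) δ
    · rw [Set.indicator_of_mem hx]
      calc ‖x‖ * ‖k x‖ ≤ ‖x‖ * (‖czKernelReg s Ω δ x‖ + ‖czKernelReg s Ω δ' x‖) := by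
            gcongr
            exact norm_sub_le _ _
        _ ≤ _ := by
            rw [mul_add]
            linarith [(hK δ hδ x).2.2, (hK δ' hδ' x).2.2]
    · rw [Set.indicator_of_notMem hx]
      have : δ ≤ ‖x‖ := by simpa using hx
      simp [hkdef, czKernelReg_eq_czKernel this, czKernelReg_eq_czKernel (hδδ'.trans this)]
  set W : EuclideanSpace ℝ (Fin d) → ℝ≥0∞ := fun x => ENNReal.ofReal (2 * C * A) *
    (Metric.ball (0 : EuclideanSpace ℝ (Fin d)) δ).indicator
      (fun x => ENNReal.ofReal (‖x‖ ^ (1 - s))) x with hW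
  have hWm : Measurable W :=
    (Measurable.indicator (by fun_prop) Metric.isOpen_ball.measurableSet).const_mul _
  have hWsymm : ∀ x y : EuclideanSpace ℝ (Fin d), W (x - y) = W (y - x) := by
    intro x y
    simp only [hW, Set.indicator, Metric.mem_ball, dist_zero_right, norm_sub_rev x y]
  set B := Metric.ball x₀ R
  set one : EuclideanSpace ℝ (Fin d) → ℝ≥0∞ := B.indicator 1 with hone
  -- The antisymmetrized factor vanishes unless one of the two points lies in `B`, since each of its
  -- terms contains a value of `g`.
  have hbd : ∀ x y, ‖(g x * f y - g y * f x) • k (x - y)‖ₑ ≤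
      one x * W (x - y) + one y * W (x - y) := by
    intro x y
    by_cases hxy : x ∈ B ∨ y ∈ B
    · have h1 : 1 ≤ one x + one y := by
        rcases hxy with h | h
        · simp [hone, h]
        · simp [hone, h]
      rw [← add_mul]
      refine le_trans ?_ (mul_le_mul_left h1 _)
      rw [one_mul, ← ofReal_norm, norm_smul]
      have : ‖g x * f y - g y * f x‖ * ‖k (x - y)‖ ≤ 2 * C * A *
        (Metric.ball (0 : EuclideanSpace ℝ (Fin d)) δ).indicator
        (fun x => ‖x‖ ^ (1 - s)) (x - y) := by
        calc _ ≤ A * ‖x - y‖ * ‖k (x - y)‖ := by gcongr; exact hA' x y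
          _ = A * (‖x - y‖ * ‖k (x - y)‖) := by ring
          _ ≤ A * _ := mul_le_mul_of_nonneg_left (hkW _) hA
          _ = _ := by ring
      refine (ENNReal.ofReal_le_ofReal this).trans (le_of_eq ?_)
      rw [ENNReal.ofReal_mul (by positivity), hW]
      simp only [Set.indicator]
      split_ifs <;> simp
    · push Not at hxy
      simp [hg0 x hxy.1, hg0 y hxy.2]
  have hin : ∀ x, ∫⁻ y, W (x - y) ∂μ ≤
      ENNReal.ofReal (2 * C * A * (Λ * 2 ^ (2 * s + 1) * δ)) := by
    intro x
    have e1 : ∀ y, W (x - y) = ENNReal.ofReal (2 * C * A) * (Metric.ball x δ).indicator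
        (fun y => ENNReal.ofReal (‖x - y‖ ^ (1 - s))) y := by
      intro y
      simp only [hW, Set.indicator, Metric.mem_ball, dist_zero_right, ← dist_eq_norm, dist_comm x y]
    simp_rw [e1]
    rw [lintegral_const_mul' _ _ ENNReal.ofReal_ne_top,
      lintegral_indicator Metric.isOpen_ball.measurableSet,
      ENNReal.ofReal_mul (p := 2 * C * A) (by positivity)]
    exact mul_le_mul_right (hμ.lintegral_near_le hs hΛ x hδ) _
  have hone_m : Measurable one := measurable_const.indicator Metric.isOpen_ball.measurableSet
  have hWm2 : Measurable fun p : EuclideanSpace ℝ (Fin d) × EuclideanSpace ℝ (Fin d) =>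
      W (p.1 - p.2) := hWm.comp (measurable_fst.sub measurable_snd)
  have hJ : ∫⁻ x, ∫⁻ y, one x * W (x - y) ∂μ ∂μ ≤
      ENNReal.ofReal (2 * C * A * (Λ * 2 ^ (2 * s + 1) * δ) * (Λ * R ^ s)) := by
    calc ∫⁻ x, ∫⁻ y, one x * W (x - y) ∂μ ∂μ
        ≤ ∫⁻ x, ENNReal.ofReal (2 * C * A * (Λ * 2 ^ (2 * s + 1) * δ)) * one x ∂μ := by
          refine lintegral_mono fun x => ?_
          rw [lintegral_const_mul _ (by fun_prop), mul_comm]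
          exact mul_le_mul_left (hin x) _
      _ = ENNReal.ofReal (2 * C * A * (Λ * 2 ^ (2 * s + 1) * δ)) * μ B := by
          rw [lintegral_const_mul _ hone_m, hone,
            lintegral_indicator_one Metric.isOpen_ball.measurableSet]
      _ ≤ _ := by
          rw [ENNReal.ofReal_mul (p := 2 * C * A * _) (by positivity)]
          exact mul_le_mul_right (hμ x₀ R hR) _
  -- Since `W` is even the two halves agree; their sum is absorbed by the factor `2` of the
  -- antisymmetrization.
  have hJ2 : ∫⁻ x, ∫⁻ y, one y * W (x - y) ∂μ ∂μ = ∫⁻ x, ∫⁻ y, one x * W (x - y) ∂μ ∂μ := by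
    rw [lintegral_lintegral_swap]
    · simp_rw [hWsymm]
    · exact ((hone_m.comp measurable_snd).mul hWm2).aemeasurable
  have hfin : ‖(2 : ℝ) • ∫ x, g x • ∫ y, f y • k (x - y) ∂μ ∂μ‖ₑ ≤ ENNReal.ofReal
      (2 * (2 * C * A * (Λ * 2 ^ (2 * s + 1) * δ) * (Λ * R ^ s))) := by
    rw [two_smul_integral_odd_kernel hkc hodd hf hfc hg hgc]
    calc _ ≤ ∫⁻ x, ∫⁻ y, ‖(g x * f y - g y * f x) • k (x - y)‖ₑ ∂μ ∂μ :=
          (enorm_integral_le_lintegral_enorm _).trans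
            (lintegral_mono fun x => enorm_integral_le_lintegral_enorm _)
      _ ≤ ∫⁻ x, ∫⁻ y, (one x * W (x - y) + one y * W (x - y)) ∂μ ∂μ :=
          lintegral_mono fun x => lintegral_mono fun y => hbd x y
      _ = ∫⁻ x, ∫⁻ y, one x * W (x - y) ∂μ ∂μ + ∫⁻ x, ∫⁻ y, one y * W (x - y) ∂μ ∂μ := by
          rw [← lintegral_add_left]
          · congr 1 with x : 1
            rw [lintegral_add_left]
            exact (hWm.comp (measurable_const.sub measurable_id)).const_mul _
          · exact Measurable.lintegral_prod_right' (f := fun p => one p.1 * W (p.1 - p.2))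
              ((hone_m.comp measurable_fst).mul hWm2)
      _ ≤ _ := by
          rw [hJ2, ← two_mul, ENNReal.ofReal_mul (by norm_num)]
          refine mul_le_mul' (by simp) hJ
  rw [← ofReal_norm, ENNReal.ofReal_le_ofReal_iff (by positivity), norm_smul,
    Real.norm_of_nonneg (by norm_num)] at hfin
  rw [e]
  have : ‖∫ x, g x • ∫ y, f y • k (x - y) ∂μ ∂μ‖ ≤
      2 * C * A * (Λ * 2 ^ (2 * s + 1) * δ) * (Λ * R ^ s) := by linarith
  refine this.trans (le_of_eq ?_)
  ring

/-! #### Tails -/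

/-- Convergence and decay of the renormalized potential of a function vanishing on a large ball. -/
lemma exists_norm_renormPotential_le (hs : 0 < s) (hΩ : IsCZNumerator Ω) :
    ∃ C α : ℝ, 0 < C ∧ 0 < α ∧ ∀ (Λ : ℝ) (μ : Measure (EuclideanSpace ℝ (Fin d))), 0 ≤ Λ →
      IsNice s Λ μ → ∀ f : EuclideanSpace ℝ (Fin d) → ℂ, AEStronglyMeasurable f μ →
      (∀ y, ‖f y‖ ≤ 1) → ∀ (x₀ : EuclideanSpace ℝ (Fin d)) (R M : ℝ), 0 < R → 2 * R ≤ M →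
      (∀ y ∈ Metric.ball x₀ M, f y = 0) → ∀ x ∈ Metric.ball x₀ R, ∀ z ∈ Metric.ball x₀ R,
      Integrable (fun y => f y • (czKernel s Ω (x - y) - czKernel s Ω (z - y))) μ ∧
      ‖renormPotential s Ω μ f z x‖ ≤ C * Λ * R ^ α * M ^ (-α) := by
  obtain ⟨C, α, hC, hα, hK⟩ := exists_czKernel_sub_le (d := d) hs hΩ
  have hq : (2 : ℝ) ^ (-α) < 1 := Real.rpow_lt_one_of_one_lt_of_neg one_lt_two (by linarith)
  have hq' : 0 < 1 - (2 : ℝ) ^ (-α) := by linarith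
  -- One `2 ^ α` comes from `‖x - z‖ ≤ 2 * R`, the other from the radius `M / 2` after recentring
  -- the tail at `z`.
  refine ⟨C * 2 ^ s / (1 - 2 ^ (-α)) * 2 ^ α * 2 ^ α, α, by positivity, hα, ?_⟩
  intro Λ μ hΛ hμ f hf hf1 x₀ R M hR hM hf0 x hx z hz
  have hM2 : 0 < M / 2 := by linarith
  set S := (Metric.ball z (M / 2))ᶜ with hS
  have hSm : MeasurableSet S := Metric.isOpen_ball.measurableSet.compl
  have hpt : ∀ y, ‖f y • (czKernel s Ω (x - y) - czKernel s Ω (z - y))‖ ≤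
      S.indicator (fun y => C * (2 * R) ^ α * ‖z - y‖ ^ (-s - α)) y := by
    intro y
    by_cases hy : y ∈ Metric.ball x₀ M
    · rw [hf0 y hy, zero_smul, norm_zero]
      exact Set.indicator_nonneg (fun y _ => by positivity) y
    · rw [Metric.mem_ball, not_lt] at hy
      have hx' := Metric.mem_ball.1 hx
      have hz' := Metric.mem_ball.1 hz
      have t1 := dist_triangle y x x₀
      have t2 := dist_triangle y z x₀
      have t3 := dist_triangle_right x z x₀
      have t4 := dist_triangle_left z y x
      rw [dist_comm x y] at t4
      have hyS : y ∈ S := by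
        simp only [hS, Set.mem_compl_iff, Metric.mem_ball, not_lt]
        linarith
      rw [Set.indicator_of_mem hyS, norm_smul]
      have hw : z - y ≠ 0 := by
        rw [← norm_pos_iff, ← dist_eq_norm, dist_comm]
        linarith
      -- Here `‖x - y‖ ≥ M - R ≥ R`, whereas `‖x - z‖ ≤ 2 * R`.
      have h3 : ‖z - y‖ ≤ 3 * ‖x - y‖ := by
        rw [← dist_eq_norm, ← dist_eq_norm, dist_comm x y]
        linarith
      have h4 : ‖(x - y) - (z - y)‖ ≤ 2 * R := by
        rw [sub_sub_sub_cancel_right, ← dist_eq_norm]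
        linarith
      calc ‖f y‖ * ‖czKernel s Ω (x - y) - czKernel s Ω (z - y)‖
          ≤ 1 * (C * (‖(x - y) - (z - y)‖ ^ α * ‖z - y‖ ^ (-s - α))) := by
            gcongr
            · exact hf1 y
            · exact hK _ _ hw h3
        _ ≤ 1 * (C * ((2 * R) ^ α * ‖z - y‖ ^ (-s - α))) := by gcongr
        _ = _ := by ring
  have hmaj : Integrable (S.indicator fun y => C * (2 * R) ^ α * ‖z - y‖ ^ (-s - α)) μ :=
    (integrable_indicator_iff hSm).2 ((hμ.integrableOn_far hs hΛ hα z hM2).const_mul _)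
  have hKm := measurable_czKernel (s := s) hΩ
  have hm : AEStronglyMeasurable
      (fun y => f y • (czKernel s Ω (x - y) - czKernel s Ω (z - y))) μ :=
    hf.smul (Measurable.aestronglyMeasurable (by fun_prop))
  refine ⟨hmaj.mono' hm (Eventually.of_forall hpt), ?_⟩
  calc ‖renormPotential s Ω μ f z x‖
      ≤ ∫ y, S.indicator (fun y => C * (2 * R) ^ α * ‖z - y‖ ^ (-s - α)) y ∂μ :=
        norm_integral_le_of_norm_le hmaj (Eventually.of_forall hpt)
    _ = C * (2 * R) ^ α * ∫ y in S, ‖z - y‖ ^ (-s - α) ∂μ := by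
        rw [integral_indicator hSm, integral_const_mul]
    _ ≤ C * (2 * R) ^ α * (Λ * 2 ^ s / (1 - 2 ^ (-α)) * (M / 2) ^ (-α)) := by
        gcongr
        exact hμ.setIntegral_far_le hs hΛ hα z hM2
    _ = _ := by
        rw [Real.mul_rpow (by norm_num) hR.le, Real.div_rpow (by linarith) (by norm_num),
          Real.rpow_neg (by norm_num) α]
        field_simp

lemma norm_integral_smul_le_of_tsupport (hΛ : 0 ≤ Λ) (hμ : IsNice s Λ μ)
    {g : EuclideanSpace ℝ (Fin d) → ℂ} (hg : Continuous g) {x₀ : EuclideanSpace ℝ (Fin d)}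
    {R B D : ℝ} (hR : 0 < R) (hgs : ∀ x ∉ Metric.ball x₀ R, g x = 0) (hB : ∀ x, ‖g x‖ ≤ B)
    {T : EuclideanSpace ℝ (Fin d) → EuclideanSpace ℂ (Fin d')} (hT : AEStronglyMeasurable T μ)
    (hTD : ∀ x ∈ Metric.ball x₀ R, ‖T x‖ ≤ D) :
    Integrable (fun x => g x • T x) μ ∧ ‖∫ x, g x • T x ∂μ‖ ≤ B * D * (Λ * R ^ s) := by
  have hB0 : 0 ≤ B := (norm_nonneg _).trans (hB x₀)
  have hD0 : 0 ≤ D := (norm_nonneg _).trans (hTD x₀ (Metric.mem_ball_self hR))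
  have hSm : MeasurableSet (Metric.ball x₀ R) := Metric.isOpen_ball.measurableSet
  have hfin : μ (Metric.ball x₀ R) ≠ ∞ := ((hμ x₀ R hR).trans_lt ENNReal.ofReal_lt_top).ne
  have hmaj : Integrable ((Metric.ball x₀ R).indicator fun _ => B * D) μ :=
    (integrable_indicator_iff hSm).2 (integrableOn_const hfin)
  have hpt : ∀ x, ‖g x • T x‖ ≤ (Metric.ball x₀ R).indicator (fun _ => B * D) x := by
    intro x
    by_cases hx : x ∈ Metric.ball x₀ R
    · rw [Set.indicator_of_mem hx, norm_smul]
      exact mul_le_mul (hB x) (hTD x hx) (norm_nonneg _) hB0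
    · simp [hgs x hx, Set.indicator_of_notMem hx]
  refine ⟨hmaj.mono' (hg.aestronglyMeasurable.smul hT) (Eventually.of_forall hpt), ?_⟩
  refine (norm_integral_le_of_norm_le hmaj (Eventually.of_forall hpt)).trans ?_
  rw [integral_indicator hSm, setIntegral_const, smul_eq_mul, mul_comm]
  gcongr
  exact hμ.real_ball_le hΛ x₀ hR

lemma aestronglyMeasurable_renormPotential [SFinite μ] (hΩ : IsCZNumerator Ω)
    {f : EuclideanSpace ℝ (Fin d) → ℂ} (hf : AEStronglyMeasurable f μ)
    (z : EuclideanSpace ℝ (Fin d)) : AEStronglyMeasurable (renormPotential s Ω μ f z) μ := by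
  have hKm := measurable_czKernel (s := s) hΩ
  refine AEStronglyMeasurable.integral_prod_right'
    (f := fun p : EuclideanSpace ℝ (Fin d) × EuclideanSpace ℝ (Fin d) =>
      f p.2 • (czKernel s Ω (p.1 - p.2) - czKernel s Ω (z - p.2))) ?_
  exact hf.comp_snd.smul (Measurable.aestronglyMeasurable (by fun_prop))

/-- Wherever `g x` and `f y` are both nonzero the points are at distance at least `R ≥ δ`, so the
regularization is invisible. Subtracting the potential at `z` is free because `g` has mean zero. In
particular the pairing does not depend on such `δ`. -/
lemma pairing_eq_integral_renormPotential (hs : 0 < s) (hΛ : 0 ≤ Λ) (hΩ : IsCZNumerator Ω)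
    (hμ : IsNice s Λ μ) {f g : EuclideanSpace ℝ (Fin d) → ℂ} (hf : MemLp f 2 μ)
    (hf1 : ∀ y, ‖f y‖ ≤ 1) (hg : Continuous g) (hgc : HasCompactSupport g)
    {x₀ : EuclideanSpace ℝ (Fin d)} {R : ℝ} (hR : 0 < R)
    (hgs : ∀ x ∉ Metric.ball x₀ R, g x = 0) (hf0 : ∀ y ∈ Metric.ball x₀ (2 * R), f y = 0)
    (hg0 : ∫ x, g x ∂μ = 0) {z : EuclideanSpace ℝ (Fin d)} (hz : z ∈ Metric.ball x₀ R)
    {δ : ℝ} (hδ : 0 < δ) (hδR : δ ≤ R) :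
    Integrable (fun x => g x • regOp s Ω μ δ f x) μ ∧
      Integrable (fun x => g x • renormPotential s Ω μ f z x) μ ∧
      pairing s Ω μ δ f g = ∫ x, g x • renormPotential s Ω μ f z x ∂μ := by
  have := hμ.isLocallyFiniteMeasure
  obtain ⟨C, α, hC, hα, hP⟩ := exists_norm_renormPotential_le (d := d) hs hΩ
  obtain ⟨B, hB⟩ := hg.bounded_above_of_compact_support hgc
  have hgi : Integrable g μ := hg.integrable_of_hasCompactSupport hgc
  have hi := (norm_integral_smul_le_of_tsupport hΛ hμ hg hR hgs hB
    (aestronglyMeasurable_renormPotential (s := s) hΩ hf.1 z)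
    (fun x hx => (hP Λ μ hΛ hμ f hf.1 hf1 x₀ R _ hR le_rfl hf0 x hx z hz).2)).1
  have hker : ∀ x ∈ Metric.ball x₀ R, ∀ y,
      f y • czKernelReg s Ω δ (x - y) = f y • czKernel s Ω (x - y) := by
    intro x hx y
    by_cases hy : y ∈ Metric.ball x₀ (2 * R)
    · simp [hf0 y hy]
    · rw [czKernelReg_eq_czKernel]
      rw [Metric.mem_ball, not_lt] at hy
      have hx' := Metric.mem_ball.1 hx
      have t1 := dist_triangle y x x₀
      rw [← dist_eq_norm, dist_comm]
      linarith
  have key : ∀ x, g x • regOp s Ω μ δ f x =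
      g x • renormPotential s Ω μ f z x + g x • regOp s Ω μ δ f z := by
    intro x
    by_cases hx : x ∈ Metric.ball x₀ R
    · rw [← smul_add]
      congr 1
      rw [← sub_eq_iff_eq_add, regOp, regOp, ← integral_sub
        (integrable_smul_czKernelReg hs hΛ hΩ hμ hδ hf x)
        (integrable_smul_czKernelReg hs hΛ hΩ hμ hδ hf z), renormPotential]
      congr 1 with y : 1
      rw [hker x hx, hker z hz, smul_sub]
    · simp [hgs x hx]
  have hi2 : Integrable (fun x => g x • regOp s Ω μ δ f z) μ := hgi.smul_const _
  refine ⟨(hi.add hi2).congr (Eventually.of_forall fun x => (key x).symm), hi, ?_⟩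
  rw [pairing]
  simp_rw [key]
  rw [integral_add hi hi2, integral_smul_const, hg0, zero_smul, add_zero]

/-! ### Vague limits -/

/-- Vague convergence of measures, tested on continuous functions with compact support. -/
def TendstoVaguely {ι : Type*} (m : ι → Measure (EuclideanSpace ℝ (Fin d))) (l : Filter ι)
    (ν : Measure (EuclideanSpace ℝ (Fin d))) : Prop :=
  ∀ f : EuclideanSpace ℝ (Fin d) → ℝ, Continuous f → HasCompactSupport f →
    Tendsto (fun i => ∫ x, f x ∂(m i)) l (𝓝 (∫ x, f x ∂ν))

lemma IsNice.norm_integral_le {E : Type*} [NormedAddCommGroup E] [NormedSpace ℝ E]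
    (hΛ : 0 ≤ Λ) (h : IsNice s Λ μ) {F : EuclideanSpace ℝ (Fin d) → E} {ρ B : ℝ} (hρ : 0 < ρ)
    (hB : 0 ≤ B) (h0 : ∀ x ∉ Metric.closedBall 0 ρ, F x = 0)
    (hF : ∀ x ∈ Metric.closedBall 0 ρ, ‖F x‖ ≤ B) :
    ‖∫ x, F x ∂μ‖ ≤ B * (Λ * (2 * ρ) ^ s) := by
  have hm := h.measure_closedBall_le 0 hρ
  rw [← setIntegral_eq_integral_of_forall_compl_eq_zero h0]
  refine (norm_setIntegral_le_of_norm_le_const (hm.trans_lt ENNReal.ofReal_lt_top) hF).trans ?_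
  gcongr
  exact ENNReal.toReal_le_of_le_ofReal (by positivity) hm

lemma exists_tsupport_subset_closedBall {E : Type*} [Zero E] {f : EuclideanSpace ℝ (Fin d) → E}
    (hf : HasCompactSupport f) : ∃ ρ : ℝ, 0 < ρ ∧ tsupport f ⊆ Metric.closedBall 0 ρ := by
  obtain ⟨ρ, hρ⟩ := hf.isCompact.isBounded.subset_closedBall 0
  exact ⟨max ρ 1, by positivity, hρ.trans (Metric.closedBall_subset_closedBall (le_max_left _ _))⟩

/-- Nice measures with a common constant are vaguely compact. -/
theorem exists_tendstoVaguely {ι : Type*} (U : Ultrafilter ι) (hΛ : 0 ≤ Λ)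
    {m : ι → Measure (EuclideanSpace ℝ (Fin d))} (hm : ∀ᶠ i in U, IsNice s Λ (m i)) :
    ∃ ν, IsNice s Λ ν ∧ TendstoVaguely m U ν := by
  have hlim : ∀ f : EuclideanSpace ℝ (Fin d) → ℝ, Continuous f → HasCompactSupport f →
      ∃ v, Tendsto (fun i => ∫ x, f x ∂(m i)) U (𝓝 v) := by
    intro f hf hfc
    obtain ⟨B, hB⟩ := hf.bounded_above_of_compact_support hfc
    obtain ⟨ρ, hρ, hρf⟩ := exists_tsupport_subset_closedBall hfc
    have hev : ∀ᶠ i in U, ∫ x, f x ∂(m i) ∈ Metric.closedBall (0 : ℝ) (B * (Λ * (2 * ρ) ^ s)) := by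
      filter_upwards [hm] with i hi
      rw [mem_closedBall_zero_iff]
      exact hi.norm_integral_le hΛ hρ ((norm_nonneg _).trans (hB 0))
        (fun x hx => image_eq_zero_of_notMem_tsupport fun h => hx (hρf h)) (fun x _ => hB x)
    -- Along an ultrafilter every bounded family of integrals converges, so no diagonal subsequence
    -- is needed; the limits form a positive functional, represented by a measure.
    obtain ⟨v, -, hv⟩ := (isCompact_closedBall (0 : ℝ) _).ultrafilter_le_nhds
      (U.map fun i => ∫ x, f x ∂(m i)) (by rw [le_principal_iff]; exact hev)
    exact ⟨v, hv⟩
  choose! I hI using hlim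
  have hI' : ∀ f : CompactlySupportedContinuousMap (EuclideanSpace ℝ (Fin d)) ℝ,
      Tendsto (fun i => ∫ x, f x ∂(m i)) U (𝓝 (I f)) :=
    fun f => hI f f.continuous f.hasCompactSupport
  have hint : ∀ᶠ i in U, ∀ f : CompactlySupportedContinuousMap (EuclideanSpace ℝ (Fin d)) ℝ,
      Integrable f (m i) := by
    filter_upwards [hm] with i hi f
    have := hi.isLocallyFiniteMeasure
    exact f.continuous.integrable_of_hasCompactSupport f.hasCompactSupport
  let L : CompactlySupportedContinuousMap (EuclideanSpace ℝ (Fin d)) ℝ →ₚ[ℝ] ℝ :=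
    PositiveLinearMap.mk₀
      { toFun := fun f => I f
        map_add' := fun f g => by
          refine tendsto_nhds_unique (hI' (f + g)) (((hI' f).add (hI' g)).congr' ?_)
          filter_upwards [hint] with i hi
          rw [← integral_add (hi f) (hi g)]
          rfl
        map_smul' := fun c f => by
          refine tendsto_nhds_unique (hI' (c • f)) (((hI' f).const_smul c).congr' ?_)
          filter_upwards with i
          rw [← integral_smul]
          rfl }
      (fun f hf => ge_of_tendsto (hI' f)
        (Eventually.of_forall fun i => integral_nonneg fun x => hf x))
  have hL : ∀ f, L f = I f := fun f => rfl
  refine ⟨RealRMK.rieszMeasure L, ?_, ?_⟩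
  · intro x r hr
    -- Inner regularity and Urysohn functions supported in the ball itself keep the constant `Λ`
    -- unchanged.
    rw [Metric.isOpen_ball.measure_eq_iSup_isCompact]
    refine iSup₂_le fun K hK => iSup_le fun hKc => ?_
    obtain ⟨f, hf1, hf2, hf3, hf4⟩ :=
      exists_continuousMap_one_of_isCompact_subset_isOpen hKc Metric.isOpen_ball hK
    let F : CompactlySupportedContinuousMap (EuclideanSpace ℝ (Fin d)) ℝ := ⟨f, hf2⟩
    refine (RealRMK.rieszMeasure_le_of_eq_one L (f := F) (fun x => (hf4 x).1) hKc hf1).trans ?_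
    refine ENNReal.ofReal_le_ofReal (le_of_tendsto (hI' F) ?_)
    filter_upwards [hm] with i hi
    have hfin : m i (Metric.ball x r) ≠ ∞ := ((hi x r hr).trans_lt ENNReal.ofReal_lt_top).ne
    calc ∫ y, f y ∂(m i) ≤ ∫ y, (Metric.ball x r).indicator (fun _ => (1 : ℝ)) y ∂(m i) := by
          refine integral_mono_of_nonneg (Eventually.of_forall fun y => (hf4 y).1)
            ((integrable_indicator_iff Metric.isOpen_ball.measurableSet).2
              (integrableOn_const hfin)) (Eventually.of_forall fun y => ?_)
          by_cases hy : y ∈ Metric.ball x r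
          · simpa [hy] using (hf4 y).2
          · simp [hy, image_eq_zero_of_notMem_tsupport fun h => hy (hf3 h)]
      _ = (m i).real (Metric.ball x r) := by
          rw [integral_indicator Metric.isOpen_ball.measurableSet]
          simp
      _ ≤ Λ * r ^ s := hi.real_ball_le hΛ x hr
  · intro f hf hfc
    have := RealRMK.integral_rieszMeasure L ⟨⟨f, hf⟩, hfc⟩
    rw [hL] at this
    have h2 := hI' ⟨⟨f, hf⟩, hfc⟩
    rw [← this] at h2
    exact h2

section VagueLimit

variable {ι : Type*} {l : Filter ι} {m : ι → Measure (EuclideanSpace ℝ (Fin d))}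

lemma TendstoVaguely.tendsto_integral {E : Type*} [NormedAddCommGroup E] [NormedSpace ℝ E]
    [FiniteDimensional ℝ E] (hv : TendstoVaguely m l ν) (hm : ∀ᶠ i in l, IsNice s Λ (m i))
    (hν : IsNice s Λ ν) {f : EuclideanSpace ℝ (Fin d) → E} (hf : Continuous f)
    (hfc : HasCompactSupport f) :
    Tendsto (fun i => ∫ x, f x ∂(m i)) l (𝓝 (∫ x, f x ∂ν)) := by
  have := hν.isLocallyFiniteMeasure
  let e := (Module.finBasis ℝ E).equivFun.toContinuousLinearEquiv
  have h1 : Tendsto (fun i => e (∫ x, f x ∂(m i))) l (𝓝 (e (∫ x, f x ∂ν))) := by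
    rw [tendsto_pi_nhds]
    intro j
    let p : E →L[ℝ] ℝ := (ContinuousLinearMap.proj (R := ℝ) (φ := fun _ => ℝ) j).comp
      (e : E →L[ℝ] _)
    have hp : ∀ κ : Measure (EuclideanSpace ℝ (Fin d)), IsNice s Λ κ →
        e (∫ x, f x ∂κ) j = ∫ x, p (f x) ∂κ := by
      intro κ hκ
      have := hκ.isLocallyFiniteMeasure
      exact (p.integral_comp_comm (hf.integrable_of_hasCompactSupport hfc)).symm
    rw [hp ν hν]
    refine (hv (fun x => p (f x)) (p.continuous.comp hf)
      (hfc.comp_left (map_zero p))).congr' ?_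
    filter_upwards [hm] with i hi using (hp _ hi).symm
  simpa [Function.comp_def] using (e.symm.continuous.tendsto _).comp h1

/-- Integrals depending continuously on a parameter converge uniformly on compact sets. -/
lemma TendstoVaguely.tendstoUniformlyOn {E : Type*} [NormedAddCommGroup E] [NormedSpace ℝ E]
    [FiniteDimensional ℝ E] (hΛ : 0 ≤ Λ) (hv : TendstoVaguely m l ν)
    (hm : ∀ᶠ i in l, IsNice s Λ (m i)) (hν : IsNice s Λ ν)
    {H : EuclideanSpace ℝ (Fin d) → EuclideanSpace ℝ (Fin d) → E} (hH : Continuous H.uncurry)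
    {ρ : ℝ} (hρ : 0 < ρ) (h0 : ∀ x, ∀ y ∉ Metric.closedBall 0 ρ, H x y = 0)
    {K : Set (EuclideanSpace ℝ (Fin d))} (hK : IsCompact K) :
    TendstoUniformlyOn (fun i x => ∫ y, H x y ∂(m i)) (fun x => ∫ y, H x y ∂ν) l K := by
  rw [← tendstoLocallyUniformlyOn_iff_tendstoUniformlyOn_of_compact hK,
    Metric.tendstoLocallyUniformlyOn_iff]
  intro ε hε x₀ _
  set V := Λ * (2 * ρ) ^ s with hVdef
  have hV : 0 ≤ V := by positivity
  -- `V` bounds the mass of the `ρ`-ball for every `Λ`-nice measure, so an `η`-perturbation of the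
  -- integrand moves all the integrals at once by less than `ε / 3`.
  set η := ε / (3 * (V + 1)) with hη
  have hηp : 0 < η := by positivity
  have hηV : η * V < ε / 3 := by
    rw [hη, div_mul_eq_mul_div, div_lt_div_iff₀ (by positivity) (by norm_num)]
    nlinarith
  have hLc : IsCompact (Metric.closedBall (0 : EuclideanSpace ℝ (Fin d)) ρ) :=
    isCompact_closedBall _ _
  have hHx : ∀ x, Continuous (H x) := fun x => hH.comp (by fun_prop : Continuous fun y => (x, y))
  have hcs : ∀ x, HasCompactSupport (H x) := fun x => HasCompactSupport.intro hLc (h0 x)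
  have hnear : ∀ᶠ x in 𝓝 x₀, ∀ y ∈ Metric.closedBall (0 : EuclideanSpace ℝ (Fin d)) ρ,
      ‖H x y - H x₀ y‖ < η := by
    refine hLc.eventually_forall_of_forall_eventually fun y _ => ?_
    have hc : Continuous fun p : EuclideanSpace ℝ (Fin d) × EuclideanSpace ℝ (Fin d) =>
        ‖H p.1 p.2 - H x₀ p.2‖ := (hH.sub ((hHx x₀).comp continuous_snd)).norm
    exact hc.tendsto (x₀, y) (Iio_mem_nhds (by simpa using hηp))
  have hdiff : ∀ κ : Measure (EuclideanSpace ℝ (Fin d)), IsNice s Λ κ → ∀ x,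
      (∀ y ∈ Metric.closedBall (0 : EuclideanSpace ℝ (Fin d)) ρ, ‖H x y - H x₀ y‖ < η) →
      ‖∫ y, H x y ∂κ - ∫ y, H x₀ y ∂κ‖ < ε / 3 := by
    intro κ hκ x hx
    have := hκ.isLocallyFiniteMeasure
    rw [← integral_sub ((hHx x).integrable_of_hasCompactSupport (hcs x))
      ((hHx x₀).integrable_of_hasCompactSupport (hcs x₀))]
    refine lt_of_le_of_lt (hκ.norm_integral_le hΛ hρ hηp.le (fun y hy => ?_)
      (fun y hy => (hx y hy).le)) hηV
    simp [h0 _ y hy]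
  refine ⟨_, mem_nhdsWithin_of_mem_nhds hnear, ?_⟩
  filter_upwards [hm, (hv.tendsto_integral hm hν (hHx x₀) (hcs x₀)).eventually
    (Metric.ball_mem_nhds _ (by positivity : 0 < ε / 3))] with i hi hi2 x hx
  have a1 := hdiff ν hν x hx
  have a2 := hdiff (m i) hi x hx
  rw [dist_comm, dist_eq_norm] at hi2
  rw [dist_eq_norm]
  have e : ∫ y, H x y ∂ν - ∫ y, H x y ∂(m i) =
      (∫ y, H x y ∂ν - ∫ y, H x₀ y ∂ν) + (∫ y, H x₀ y ∂ν - ∫ y, H x₀ y ∂(m i))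
        - (∫ y, H x y ∂(m i) - ∫ y, H x₀ y ∂(m i)) := by abel
  rw [e]
  refine (norm_sub_le _ _).trans_lt ?_
  have := norm_add_le (∫ y, H x y ∂ν - ∫ y, H x₀ y ∂ν) (∫ y, H x₀ y ∂ν - ∫ y, H x₀ y ∂(m i))
  linarith

lemma TendstoVaguely.tendstoUniformlyOn_regOp (hs : 0 < s) (hΛ : 0 ≤ Λ) (hΩ : IsCZNumerator Ω)
    (hv : TendstoVaguely m l ν) (hm : ∀ᶠ i in l, IsNice s Λ (m i)) (hν : IsNice s Λ ν)
    {δ : ℝ} (hδ : 0 < δ) {f : EuclideanSpace ℝ (Fin d) → ℂ} (hf : Continuous f)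
    (hfc : HasCompactSupport f) {K : Set (EuclideanSpace ℝ (Fin d))} (hK : IsCompact K) :
    TendstoUniformlyOn (fun i => regOp s Ω (m i) δ f) (regOp s Ω ν δ f) l K := by
  obtain ⟨ρ, hρ, hρf⟩ := exists_tsupport_subset_closedBall hfc
  have hKc := continuous_czKernelReg hs hΩ hδ
  have hfd : FiniteDimensional ℝ (EuclideanSpace ℂ (Fin d')) := FiniteDimensional.complexToReal _
  refine hv.tendstoUniformlyOn (H := fun x y => f y • czKernelReg s Ω δ (x - y)) hΛ hm hν
    ?_ hρ ?_ hK
  · exact (hf.comp continuous_snd).smul (hKc.comp (continuous_fst.sub continuous_snd))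
  · intro x y hy
    rw [image_eq_zero_of_notMem_tsupport fun h => hy (hρf h), zero_smul]

/-- The regularized pairings are continuous under vague convergence of nice measures. -/
lemma TendstoVaguely.tendsto_pairing (hs : 0 < s) (hΛ : 0 ≤ Λ) (hΩ : IsCZNumerator Ω)
    (hv : TendstoVaguely m l ν) (hm : ∀ᶠ i in l, IsNice s Λ (m i)) (hν : IsNice s Λ ν)
    {δ : ℝ} (hδ : 0 < δ) {f g : EuclideanSpace ℝ (Fin d) → ℂ} (hf : Continuous f)
    (hfc : HasCompactSupport f) (hg : Continuous g) (hgc : HasCompactSupport g) :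
    Tendsto (fun i => pairing s Ω (m i) δ f g) l (𝓝 (pairing s Ω ν δ f g)) := by
  have := hν.isLocallyFiniteMeasure
  have hfd : FiniteDimensional ℝ (EuclideanSpace ℂ (Fin d')) := FiniteDimensional.complexToReal _
  obtain ⟨ρ, hρ, hρg⟩ := exists_tsupport_subset_closedBall hgc
  obtain ⟨B, hB⟩ := hg.bounded_above_of_compact_support hgc
  have hB0 : 0 ≤ B := (norm_nonneg _).trans (hB 0)
  have hT := continuous_regOp (μ := ν) hs hΩ hδ hf hfc
  have hgT : Continuous fun x => g x • regOp s Ω ν δ f x := hg.smul hT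
  have hgTc : HasCompactSupport fun x => g x • regOp s Ω ν δ f x := hgc.smul_right
  have h1 := hv.tendsto_integral hm hν hgT hgTc
  -- In the pairing the measure also enters the integrand. Uniform convergence on the support of `g`
  -- allows the limiting potential to be inserted first, leaving a fixed test function.
  have h2 : Tendsto (fun i => pairing s Ω (m i) δ f g - ∫ x, g x • regOp s Ω ν δ f x ∂(m i)) l
      (𝓝 0) := by
    rw [Metric.tendsto_nhds]
    intro ε hε
    set V := Λ * (2 * ρ) ^ s with hVdef
    have hV : 0 ≤ V := by positivity
    have hu := Metric.tendstoUniformlyOn_iff.1 (hv.tendstoUniformlyOn_regOp hs hΛ hΩ hm hν hδ hf hfc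
      (isCompact_closedBall (0 : EuclideanSpace ℝ (Fin d)) ρ)) (ε / ((B + 1) * (V + 1)))
      (by positivity)
    filter_upwards [hm, hu] with i hi hi2
    have := hi.isLocallyFiniteMeasure
    rw [dist_zero_right, pairing, ← integral_sub (integrable_smul_regOp hs hΩ hδ hf hfc hg hgc)
      (hgT.integrable_of_hasCompactSupport hgTc)]
    refine (hi.norm_integral_le (B := B * (ε / ((B + 1) * (V + 1)))) hΛ hρ (by positivity)
      (fun y hy => ?_) (fun y hy => ?_)).trans_lt ?_
    · simp [image_eq_zero_of_notMem_tsupport fun h => hy (hρg h)]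
    · rw [← smul_sub, norm_smul]
      have := hi2 y hy
      rw [dist_comm, dist_eq_norm] at this
      gcongr
      exact hB y
    · have : B * (ε / ((B + 1) * (V + 1))) * V = ε * (B / (B + 1)) * (V / (V + 1)) := by
        field_simp
      rw [← hVdef, this]
      have b1 : B / (B + 1) < 1 := by rw [div_lt_one (by positivity)]; linarith
      have b2 : V / (V + 1) < 1 := by rw [div_lt_one (by positivity)]; linarith
      have b3 : 0 ≤ V / (V + 1) := by positivity
      have b4 : 0 ≤ B / (B + 1) := by positivity
      rw [mul_assoc]
      exact mul_lt_of_lt_one_right hε (mul_lt_one_of_nonneg_of_lt_one_left b4 b1 b2.le)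
  have h3 := h2.add h1
  simp only [sub_add_cancel, zero_add] at h3
  exact h3

end VagueLimit

/-! ### Cutoff functions -/

/-- The cutoff function equal to `1` on the ball of radius `M` and to `0` off the ball of radius
`2 * M`. -/
def cutoff (M : ℝ) (x : EuclideanSpace ℝ (Fin d)) : ℝ := max 0 (min 1 (2 - ‖x‖ / M))

lemma cutoff_nonneg (M : ℝ) (x : EuclideanSpace ℝ (Fin d)) : 0 ≤ cutoff M x := le_max_left _ _

lemma cutoff_le_one (M : ℝ) (x : EuclideanSpace ℝ (Fin d)) : cutoff M x ≤ 1 :=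
  max_le zero_le_one (min_le_left _ _)

lemma cutoff_eq_one {M : ℝ} (hM : 0 < M) {x : EuclideanSpace ℝ (Fin d)} (hx : ‖x‖ ≤ M) :
    cutoff M x = 1 := by
  have : ‖x‖ / M ≤ 1 := (div_le_one hM).2 hx
  rw [cutoff, min_eq_left (by linarith), max_eq_right zero_le_one]

lemma cutoff_eq_zero {M : ℝ} (hM : 0 < M) {x : EuclideanSpace ℝ (Fin d)} (hx : 2 * M ≤ ‖x‖) :
    cutoff M x = 0 := by
  have : 2 ≤ ‖x‖ / M := (le_div_iff₀ hM).2 hx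
  rw [cutoff, max_eq_left ((min_le_right _ _).trans (by linarith))]

lemma continuous_cutoff (M : ℝ) : Continuous (cutoff (d := d) M) := by
  unfold cutoff
  fun_prop

lemma hasCompactSupport_cutoff {M : ℝ} (hM : 0 < M) : HasCompactSupport (cutoff (d := d) M) :=
  HasCompactSupport.intro (isCompact_closedBall 0 (2 * M)) fun x hx =>
    cutoff_eq_zero hM (by simpa using (not_le.1 (by simpa using hx)).le)

lemma abs_cutoff_sub_le {M : ℝ} (hM : 0 < M) (x y : EuclideanSpace ℝ (Fin d)) :
    |cutoff M x - cutoff M y| ≤ M⁻¹ * ‖x - y‖ := by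
  have h1 : |cutoff M x - cutoff M y| ≤ |(2 - ‖x‖ / M) - (2 - ‖y‖ / M)| := by
    refine (abs_max_sub_max_le_max _ _ _ _).trans ?_
    rw [sub_self, abs_zero, max_eq_right (abs_nonneg _)]
    refine (abs_min_sub_min_le_max _ _ _ _).trans ?_
    rw [sub_self, abs_zero, max_eq_right (abs_nonneg _)]
  refine h1.trans ?_
  have e : (2 - ‖x‖ / M) - (2 - ‖y‖ / M) = M⁻¹ * (‖y‖ - ‖x‖) := by ring
  rw [e, abs_mul, abs_of_pos (by positivity : 0 < M⁻¹), norm_sub_rev]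
  gcongr
  exact abs_norm_sub_norm_le y x

/-! ### Goodness passes to vague limits -/

lemma eLpNorm_two_sq {E : Type*} [NormedAddCommGroup E] (f : EuclideanSpace ℝ (Fin d) → E)
    (μ : Measure (EuclideanSpace ℝ (Fin d))) :
    eLpNorm f 2 μ ^ 2 = ∫⁻ x, ‖f x‖ₑ ^ 2 ∂μ := by
  have := eLpNorm_nnreal_pow_eq_lintegral (μ := μ) (f := f) (p := 2) (by norm_num)
  simpa using this

lemma ofReal_integral_norm_sq {E : Type*} [NormedAddCommGroup E]
    {f : EuclideanSpace ℝ (Fin d) → E} (hf : MemLp f 2 μ) :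
    ENNReal.ofReal (∫ x, ‖f x‖ ^ 2 ∂μ) = eLpNorm f 2 μ ^ 2 := by
  rw [eLpNorm_two_sq, ofReal_integral_eq_lintegral_ofReal
    ((memLp_two_iff_integrable_sq_norm hf.1).1 hf) (Eventually.of_forall fun x => by positivity)]
  simp_rw [ENNReal.ofReal_pow (norm_nonneg _), ofReal_norm]

lemma IsGood.memLp_regOp (hs : 0 < s) (hΩ : IsCZNumerator Ω)
    (hμ : IsGood s Ω Λ μ) {δ : ℝ} (hδ : 0 < δ) {f : EuclideanSpace ℝ (Fin d) → ℂ}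
    (hf : Continuous f) (hfc : HasCompactSupport f) : MemLp (regOp s Ω μ δ f) 2 μ := by
  have := hμ.1.isLocallyFiniteMeasure
  have hL : MemLp f 2 μ := hf.memLp_of_hasCompactSupport hfc
  exact ⟨(continuous_regOp hs hΩ hδ hf hfc).aestronglyMeasurable,
    (hμ.2 δ hδ f hL).trans_lt (ENNReal.mul_lt_top ENNReal.ofReal_lt_top hL.2)⟩

lemma IsGood.integral_norm_regOp_sq_le (hs : 0 < s) (hΛ : 0 ≤ Λ) (hΩ : IsCZNumerator Ω)
    (hμ : IsGood s Ω Λ μ) {δ : ℝ} (hδ : 0 < δ) {f : EuclideanSpace ℝ (Fin d) → ℂ}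
    (hf : Continuous f) (hfc : HasCompactSupport f) :
    ∫ x, ‖regOp s Ω μ δ f x‖ ^ 2 ∂μ ≤ Λ ^ 2 * ∫ x, ‖f x‖ ^ 2 ∂μ := by
  have := hμ.1.isLocallyFiniteMeasure
  have hL : MemLp f 2 μ := hf.memLp_of_hasCompactSupport hfc
  have hI : 0 ≤ ∫ x, ‖f x‖ ^ 2 ∂μ := integral_nonneg fun x => by positivity
  rw [← ENNReal.ofReal_le_ofReal_iff (by positivity),
    ofReal_integral_norm_sq (hμ.memLp_regOp hs hΩ hδ hf hfc), ENNReal.ofReal_mul (by positivity),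
    ofReal_integral_norm_sq hL, ENNReal.ofReal_pow hΛ, ← mul_pow]
  gcongr
  exact hμ.2 δ hδ f hL

section VagueLimit

variable {ι : Type*} {l : Filter ι} {m : ι → Measure (EuclideanSpace ℝ (Fin d))}

/-- Young's inequality `2 * b * ε ≤ ε * b ^ 2 + ε`. The weight `c`, a cutoff in the application,
stays on the additive error so that it can be integrated against an infinite measure. -/
lemma mul_sq_le_of_le_add {a b c ε : ℝ} (ha : 0 ≤ a) (hc : 0 ≤ c) (hc1 : c ≤ 1) (hε : 0 < ε)
    (h : a ≤ b + ε) : c * a ^ 2 ≤ (1 + ε) * b ^ 2 + (ε + ε ^ 2) * c := by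
  have h1 : a ^ 2 ≤ (b + ε) ^ 2 := by gcongr
  have h2 : 0 ≤ ε * (b - 1) ^ 2 := by positivity
  have h3 : a ^ 2 ≤ (1 + ε) * b ^ 2 + (ε + ε ^ 2) := by linarith
  have h4 : c * ((1 + ε) * b ^ 2) ≤ (1 + ε) * b ^ 2 := mul_le_of_le_one_left (by positivity) hc1
  linarith [mul_le_mul_of_nonneg_left h3 hc]

lemma IsNice.integral_cutoff_mul_norm_sq_le {E : Type*} [NormedAddCommGroup E] (hΛ : 0 ≤ Λ)
    (hμ : IsNice s Λ μ) {T T' : EuclideanSpace ℝ (Fin d) → E} (hT : Continuous T)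
    (hT' : MemLp T' 2 μ) {M ε : ℝ} (hM : 0 < M) (hε : 0 < ε)
    (hd : ∀ x ∈ Metric.closedBall 0 (2 * M), ‖T x - T' x‖ ≤ ε) :
    ∫ x, cutoff M x * ‖T x‖ ^ 2 ∂μ ≤
      (1 + ε) * ∫ x, ‖T' x‖ ^ 2 ∂μ + (ε + ε ^ 2) * (Λ * (2 * (2 * M)) ^ s) := by
  have := hμ.isLocallyFiniteMeasure
  have hc := continuous_cutoff (d := d) M
  have hcc := hasCompactSupport_cutoff (d := d) hM
  have hsq := (memLp_two_iff_integrable_sq_norm hT'.1).1 hT'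
  have hci : Integrable (cutoff (d := d) M) μ := hc.integrable_of_hasCompactSupport hcc
  have h0 : ∀ x ∉ Metric.closedBall (0 : EuclideanSpace ℝ (Fin d)) (2 * M), cutoff M x = 0 :=
    fun x hx => cutoff_eq_zero hM (by simpa using (not_le.1 (by simpa using hx)).le)
  have hcV : ∫ x, cutoff M x ∂μ ≤ Λ * (2 * (2 * M)) ^ s := by
    refine (le_abs_self _).trans ((hμ.norm_integral_le (B := 1) hΛ (by positivity : 0 < 2 * M)
      zero_le_one h0 (fun x _ => ?_)).trans (by rw [one_mul]))
    rw [Real.norm_of_nonneg (cutoff_nonneg _ _)]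
    exact cutoff_le_one _ _
  have hpt : ∀ x, cutoff M x * ‖T x‖ ^ 2 ≤ (1 + ε) * ‖T' x‖ ^ 2 + (ε + ε ^ 2) * cutoff M x := by
    intro x
    by_cases hx : x ∈ Metric.closedBall 0 (2 * M)
    · refine mul_sq_le_of_le_add (norm_nonneg _) (cutoff_nonneg _ _) (cutoff_le_one _ _) hε ?_
      linarith [norm_sub_norm_le (T x) (T' x), hd x hx]
    · rw [h0 x hx, zero_mul, mul_zero]
      positivity
  have hi1 : Integrable (fun x => cutoff M x * ‖T x‖ ^ 2) μ :=
    (hc.mul (hT.norm.pow 2)).integrable_of_hasCompactSupport hcc.mul_right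
  calc ∫ x, cutoff M x * ‖T x‖ ^ 2 ∂μ
      ≤ ∫ x, ((1 + ε) * ‖T' x‖ ^ 2 + (ε + ε ^ 2) * cutoff M x) ∂μ :=
        integral_mono hi1 ((hsq.const_mul _).add (hci.const_mul _)) hpt
    _ = (1 + ε) * ∫ x, ‖T' x‖ ^ 2 ∂μ + (ε + ε ^ 2) * ∫ x, cutoff M x ∂μ := by
        rw [integral_add (hsq.const_mul _) (hci.const_mul _), integral_const_mul,
          integral_const_mul]
    _ ≤ _ := by gcongr

/-- The potentials converge uniformly only on compact sets, hence the cutoff. The error depends on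
`M` but disappears as `ε → 0`, leaving a bound free of `M`. -/
lemma TendstoVaguely.integral_cutoff_mul_norm_regOp_sq_le [l.NeBot] (hs : 0 < s) (hΛ : 0 ≤ Λ)
    (hΩ : IsCZNumerator Ω)
    (hv : TendstoVaguely m l ν) (hm : ∀ᶠ i in l, IsGood s Ω Λ (m i)) (hν : IsNice s Λ ν)
    {δ : ℝ} (hδ : 0 < δ) {f : EuclideanSpace ℝ (Fin d) → ℂ} (hf : Continuous f)
    (hfc : HasCompactSupport f) {M : ℝ} (hM : 0 < M) :
    ∫ x, cutoff M x * ‖regOp s Ω ν δ f x‖ ^ 2 ∂ν ≤ Λ ^ 2 * ∫ x, ‖f x‖ ^ 2 ∂ν := by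
  have := hν.isLocallyFiniteMeasure
  have hT := continuous_regOp (μ := ν) hs hΩ hδ hf hfc
  have hm' : ∀ᶠ i in l, IsNice s Λ (m i) := hm.mono fun i hi => hi.1
  have c1 : Continuous fun x => cutoff M x * ‖regOp s Ω ν δ f x‖ ^ 2 :=
    (continuous_cutoff M).mul (hT.norm.pow 2)
  have c2 : HasCompactSupport fun x => cutoff M x * ‖regOp s Ω ν δ f x‖ ^ 2 :=
    (hasCompactSupport_cutoff hM).mul_right
  have c3 : HasCompactSupport fun x => ‖f x‖ ^ 2 :=
    HasCompactSupport.intro hfc.isCompact fun x hx => by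
      simp [image_eq_zero_of_notMem_tsupport hx]
  have h1 := hv _ c1 c2
  have h2 := hv _ (hf.norm.pow 2) c3
  set V := Λ * (2 * (2 * M)) ^ s
  set J := ∫ x, ‖f x‖ ^ 2 ∂ν
  have key : ∀ ε : ℝ, 0 < ε → ∫ x, cutoff M x * ‖regOp s Ω ν δ f x‖ ^ 2 ∂ν ≤
      (1 + ε) * (Λ ^ 2 * J) + (ε + ε ^ 2) * V := by
    intro ε hε
    refine le_of_tendsto_of_tendsto h1 (((h2.const_mul (Λ ^ 2)).const_mul (1 + ε)).add_const _) ?_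
    have hu := Metric.tendstoUniformlyOn_iff.1 (hv.tendstoUniformlyOn_regOp hs hΛ hΩ hm' hν hδ hf
      hfc (isCompact_closedBall (0 : EuclideanSpace ℝ (Fin d)) (2 * M))) ε hε
    filter_upwards [hm, hu] with i hi hi2
    refine (hi.1.integral_cutoff_mul_norm_sq_le hΛ hT (hi.memLp_regOp hs hΩ hδ hf hfc) hM hε
      fun x hx => by rw [← dist_eq_norm]; exact (hi2 x hx).le).trans ?_
    have h3 := hi.integral_norm_regOp_sq_le hs hΛ hΩ hδ hf hfc
    exact add_le_add_left (mul_le_mul_of_nonneg_left h3 (by positivity)) _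
  have hlim : Tendsto (fun ε : ℝ => (1 + ε) * (Λ ^ 2 * J) + (ε + ε ^ 2) * V)
      (𝓝[>] 0) (𝓝 (Λ ^ 2 * J)) := by
    have : Continuous fun ε : ℝ => (1 + ε) * (Λ ^ 2 * J) + (ε + ε ^ 2) * V := by
      fun_prop
    simpa using (this.tendsto 0).mono_left nhdsWithin_le_nhds
  exact ge_of_tendsto hlim (eventually_nhdsWithin_of_forall fun ε hε => key ε hε)

/-- The localized bound does not depend on the cutoff radius, so monotone exhaustion of the space by
balls removes the cutoff. -/
lemma TendstoVaguely.eLpNorm_regOp_le_of_continuous [l.NeBot] (hs : 0 < s) (hΛ : 0 ≤ Λ)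
    (hΩ : IsCZNumerator Ω)
    (hv : TendstoVaguely m l ν) (hm : ∀ᶠ i in l, IsGood s Ω Λ (m i)) (hν : IsNice s Λ ν)
    {δ : ℝ} (hδ : 0 < δ) {f : EuclideanSpace ℝ (Fin d) → ℂ} (hf : Continuous f)
    (hfc : HasCompactSupport f) :
    eLpNorm (regOp s Ω ν δ f) 2 ν ≤ ENNReal.ofReal Λ * eLpNorm f 2 ν := by
  have := hν.isLocallyFiniteMeasure
  have hT := continuous_regOp (μ := ν) hs hΩ hδ hf hfc
  have hL : MemLp f 2 ν := hf.memLp_of_hasCompactSupport hfc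
  rw [← ENNReal.pow_le_pow_left_iff two_ne_zero, mul_pow, eLpNorm_two_sq (regOp s Ω ν δ f),
    ← ofReal_integral_norm_sq hL, ← ENNReal.ofReal_pow hΛ, ← ENNReal.ofReal_mul (by positivity)]
  have hmono : Monotone fun (n : ℕ) => Metric.closedBall (0 : EuclideanSpace ℝ (Fin d)) (n + 1) :=
    fun a b hab => Metric.closedBall_subset_closedBall (by
      have : (a : ℝ) ≤ b := by exact_mod_cast hab
      linarith)
  have hU : ⋃ n : ℕ, Metric.closedBall (0 : EuclideanSpace ℝ (Fin d)) (n + 1) = Set.univ := by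
    refine Set.eq_univ_of_forall fun x => Set.mem_iUnion.2 ?_
    obtain ⟨n, hn⟩ := exists_nat_ge ‖x‖
    exact ⟨n, by simpa using hn.trans (by linarith)⟩
  rw [← setLIntegral_univ, ← hU, setLIntegral_iUnion_of_directed _ hmono.directed_le]
  refine iSup_le fun n => ?_
  have hn : (0 : ℝ) < n + 1 := by positivity
  have hcm := (continuous_cutoff (d := d) (n + 1 : ℝ)).mul (hT.norm.pow 2)
  calc ∫⁻ x in Metric.closedBall 0 ((n : ℝ) + 1), ‖regOp s Ω ν δ f x‖ₑ ^ 2 ∂ν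
      ≤ ∫⁻ x, ENNReal.ofReal (cutoff (n + 1 : ℝ) x * ‖regOp s Ω ν δ f x‖ ^ 2) ∂ν := by
        rw [← lintegral_indicator Metric.isClosed_closedBall.measurableSet]
        refine lintegral_mono fun x => ?_
        by_cases hx : x ∈ Metric.closedBall (0 : EuclideanSpace ℝ (Fin d)) ((n : ℝ) + 1)
        · rw [Set.indicator_of_mem hx, cutoff_eq_one hn (by simpa using hx), one_mul,
            ENNReal.ofReal_pow (norm_nonneg _), ofReal_norm]
        · simp [Set.indicator_of_notMem hx]
    _ = ENNReal.ofReal (∫ x, cutoff (n + 1 : ℝ) x * ‖regOp s Ω ν δ f x‖ ^ 2 ∂ν) := by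
        rw [ofReal_integral_eq_lintegral_ofReal]
        · exact hcm.integrable_of_hasCompactSupport (hasCompactSupport_cutoff hn).mul_right
        · exact Eventually.of_forall fun x => mul_nonneg (cutoff_nonneg _ _) (by positivity)
    _ ≤ _ := ENNReal.ofReal_le_ofReal
        (hv.integral_cutoff_mul_norm_regOp_sq_le hs hΛ hΩ hm hν hδ hf hfc hn)

/-- A vague limit of good measures is good. -/
theorem TendstoVaguely.isGood [l.NeBot] (hs : 0 < s) (hΛ : 0 ≤ Λ) (hΩ : IsCZNumerator Ω)
    (hv : TendstoVaguely m l ν) (hm : ∀ᶠ i in l, IsGood s Ω Λ (m i)) (hν : IsNice s Λ ν) :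
    IsGood s Ω Λ ν := by
  have := hν.isLocallyFiniteMeasure
  refine ⟨hν, fun δ hδ f hf => ?_⟩
  -- For a general `f ∈ L²` approximate by continuous functions of compact support: since the kernel
  -- is square integrable the potentials converge at every point, and Fatou's lemma transfers the
  -- bound.
  have happ : ∀ n : ℕ, ∃ g : EuclideanSpace ℝ (Fin d) → ℂ, HasCompactSupport g ∧
      eLpNorm (f - g) 2 ν ≤ (n + 1 : ℝ≥0∞)⁻¹ ∧ Continuous g ∧ MemLp g 2 ν := fun n =>
    hf.exists_hasCompactSupport_eLpNorm_sub_le ENNReal.ofNat_ne_top (by simp)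
  choose g hgc hgn hg hgL using happ
  have hε : Tendsto (fun n : ℕ => (n + 1 : ℝ≥0∞)⁻¹) atTop (𝓝 0) := by
    have := (tendsto_add_atTop_iff_nat 1).2 ENNReal.tendsto_inv_nat_nhds_zero
    simpa using this
  have hfg : Tendsto (fun n => eLpNorm (f - g n) 2 ν) atTop (𝓝 0) :=
    tendsto_of_tendsto_of_tendsto_of_le_of_le tendsto_const_nhds hε (fun _ => zero_le) hgn
  have hpt : ∀ x, Tendsto (fun n => regOp s Ω ν δ (g n) x) atTop (𝓝 (regOp s Ω ν δ f x)) := by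
    intro x
    have hK := hν.memLp_czKernelReg hs hΛ hΩ hδ x
    rw [tendsto_iff_edist_tendsto_0]
    have hbd : ∀ n, edist (regOp s Ω ν δ (g n) x) (regOp s Ω ν δ f x) ≤
        eLpNorm (f - g n) 2 ν * eLpNorm (fun y => czKernelReg s Ω δ (x - y)) 2 ν := by
      intro n
      rw [edist_comm, edist_eq_enorm_sub, regOp, regOp, ← integral_sub
        (integrable_smul_czKernelReg hs hΛ hΩ hν hδ hf x)
        (integrable_smul_czKernelReg hs hΛ hΩ hν hδ (hgL n) x)]
      refine (enorm_integral_le_lintegral_enorm _).trans ?_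
      rw [← eLpNorm_one_eq_lintegral_enorm]
      have := eLpNorm_smul_le_mul_eLpNorm (p := 2) (q := 2) (r := 1) hK.1 (hf.sub (hgL n)).1
      refine (le_of_eq ?_).trans this
      congr 1
      ext1 y
      simp [sub_smul]
    refine tendsto_of_tendsto_of_tendsto_of_le_of_le tendsto_const_nhds ?_ (fun _ => zero_le) hbd
    have := ENNReal.Tendsto.mul_const hfg (Or.inr hK.2.ne)
    simpa using this
  refine (Lp.eLpNorm_lim_le_liminf_eLpNorm
    (fun n => (continuous_regOp hs hΩ hδ (hg n) (hgc n)).aestronglyMeasurable) _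
    (Eventually.of_forall hpt)).trans ?_
  have hle : ∀ n, eLpNorm (regOp s Ω ν δ (g n)) 2 ν ≤
      ENNReal.ofReal Λ * (eLpNorm f 2 ν + eLpNorm (f - g n) 2 ν) := by
    intro n
    refine (hv.eLpNorm_regOp_le_of_continuous hs hΛ hΩ hm hν hδ (hg n) (hgc n)).trans ?_
    gcongr
    have : g n = f - (f - g n) := by simp
    calc eLpNorm (g n) 2 ν = eLpNorm (f - (f - g n)) 2 ν := by rw [← this]
      _ ≤ _ := eLpNorm_sub_le hf.1 (hf.sub (hgL n)).1 (by norm_num)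
  have hlim : Tendsto (fun n => ENNReal.ofReal Λ * (eLpNorm f 2 ν + eLpNorm (f - g n) 2 ν)) atTop
      (𝓝 (ENNReal.ofReal Λ * eLpNorm f 2 ν)) := by
    have := ENNReal.Tendsto.const_mul (a := ENNReal.ofReal Λ) (hfg.const_add (eLpNorm f 2 ν))
      (Or.inr ENNReal.ofReal_ne_top)
    simpa using this
  exact (liminf_le_liminf (Eventually.of_forall hle)).trans hlim.liminf_eq.le

end VagueLimit

/-! ### Blow-ups -/

/-- The affine map that sends the ball `B(x, r)` to the unit ball. -/
def zoom (x : EuclideanSpace ℝ (Fin d)) (r : ℝ) (y : EuclideanSpace ℝ (Fin d)) :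
    EuclideanSpace ℝ (Fin d) := r⁻¹ • (y - x)

/-- The `s`-dimensional rescaling of `μ` that sends `B(x, r)` to the unit ball. -/
def blowUp (s : ℝ) (μ : Measure (EuclideanSpace ℝ (Fin d))) (x : EuclideanSpace ℝ (Fin d))
    (r : ℝ) : Measure (EuclideanSpace ℝ (Fin d)) :=
  ENNReal.ofReal (r ^ (-s)) • μ.map (zoom x r)

lemma measurableEmbedding_zoom (x : EuclideanSpace ℝ (Fin d)) {r : ℝ} (hr : 0 < r) :
    MeasurableEmbedding (zoom x r) :=
  ((Homeomorph.subRight x).trans (Homeomorph.smulOfNeZero r⁻¹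
    (inv_ne_zero hr.ne'))).toMeasurableEquiv.measurableEmbedding

lemma continuous_zoom (x : EuclideanSpace ℝ (Fin d)) (r : ℝ) : Continuous (zoom x r) := by
  unfold zoom
  fun_prop

lemma zoom_add_smul (x u : EuclideanSpace ℝ (Fin d)) {r : ℝ} (hr : 0 < r) :
    zoom x r (x + r • u) = u := by
  simp [zoom, smul_smul, inv_mul_cancel₀ hr.ne']

lemma zoom_sub_zoom (x : EuclideanSpace ℝ (Fin d)) (r : ℝ) (y w : EuclideanSpace ℝ (Fin d)) :
    zoom x r y - zoom x r w = r⁻¹ • (y - w) := by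
  rw [zoom, zoom, ← smul_sub, sub_sub_sub_cancel_right]

lemma zoom_preimage_ball (x u : EuclideanSpace ℝ (Fin d)) {r : ℝ} (hr : 0 < r) (ρ : ℝ) :
    zoom x r ⁻¹' Metric.ball u ρ = Metric.ball (x + r • u) (r * ρ) := by
  ext y
  rw [Set.mem_preimage, Metric.mem_ball, Metric.mem_ball, dist_eq_norm, dist_eq_norm]
  nth_rw 1 [← zoom_add_smul x u hr]
  rw [zoom_sub_zoom, norm_smul, norm_inv, Real.norm_of_nonneg hr.le, inv_mul_lt_iff₀ hr]

lemma HasCompactSupport.comp_zoom {E : Type*} [Zero E] {f : EuclideanSpace ℝ (Fin d) → E}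
    (hf : HasCompactSupport f) (x : EuclideanSpace ℝ (Fin d)) {r : ℝ} (hr : 0 < r) :
    HasCompactSupport fun y => f (zoom x r y) :=
  hf.comp_homeomorph ((Homeomorph.subRight x).trans (Homeomorph.smulOfNeZero r⁻¹
    (inv_ne_zero hr.ne')))

lemma integral_blowUp {E : Type*} [NormedAddCommGroup E] [NormedSpace ℝ E]
    (f : EuclideanSpace ℝ (Fin d) → E) (x : EuclideanSpace ℝ (Fin d)) {r : ℝ} (hr : 0 < r) :
    ∫ y, f y ∂(blowUp s μ x r) = r ^ (-s) • ∫ y, f (zoom x r y) ∂μ := by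
  rw [blowUp, integral_smul_measure, (measurableEmbedding_zoom x hr).integral_map,
    ENNReal.toReal_ofReal (by positivity)]

lemma blowUp_ball (x u : EuclideanSpace ℝ (Fin d)) {r : ℝ} (hr : 0 < r) (ρ : ℝ) :
    blowUp s μ x r (Metric.ball u ρ) =
      ENNReal.ofReal (r ^ (-s)) * μ (Metric.ball (x + r • u) (r * ρ)) := by
  rw [blowUp, Measure.smul_apply, (measurableEmbedding_zoom x hr).map_apply,
    zoom_preimage_ball x u hr, smul_eq_mul]

lemma IsNice.isNice_blowUp (h : IsNice s Λ μ) (x : EuclideanSpace ℝ (Fin d)) {r : ℝ} (hr : 0 < r) :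
    IsNice s Λ (blowUp s μ x r) := by
  intro u ρ hρ
  rw [blowUp_ball x u hr]
  refine (mul_le_mul_right (h _ _ (by positivity)) _).trans (le_of_eq ?_)
  rw [← ENNReal.ofReal_mul (by positivity), Real.mul_rpow hr.le hρ.le, Real.rpow_neg hr.le]
  congr 1
  field_simp

/-- The normalization `r ^ (-s)` of the measure cancels the factor `r ^ s` from the homogeneity of
the kernel. -/
lemma regOp_blowUp (hΩ : IsCZNumerator Ω) (x : EuclideanSpace ℝ (Fin d)) {r δ : ℝ} (hr : 0 < r)
    (hδ : 0 < δ) (f : EuclideanSpace ℝ (Fin d) → ℂ) (w : EuclideanSpace ℝ (Fin d)) :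
    regOp s Ω (blowUp s μ x r) δ f (zoom x r w) =
      regOp s Ω μ (r * δ) (fun y => f (zoom x r y)) w := by
  rw [regOp, regOp, integral_blowUp _ x hr, ← integral_smul]
  congr 1 with y : 1
  rw [zoom_sub_zoom, czKernelReg_smul hΩ hr hδ, smul_comm (f _), smul_smul, ← Real.rpow_add hr,
    neg_add_cancel, Real.rpow_zero, one_smul]

lemma pairing_blowUp (hΩ : IsCZNumerator Ω) (x : EuclideanSpace ℝ (Fin d)) {r δ : ℝ} (hr : 0 < r)
    (hδ : 0 < δ) (f g : EuclideanSpace ℝ (Fin d) → ℂ) :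
    pairing s Ω (blowUp s μ x r) δ f g =
      r ^ (-s) • pairing s Ω μ (r * δ) (fun y => f (zoom x r y)) (fun y => g (zoom x r y)) := by
  rw [pairing, integral_blowUp _ x hr, pairing]
  simp_rw [regOp_blowUp hΩ x hr hδ]

lemma eLpNorm_two_blowUp {E : Type*} [NormedAddCommGroup E] (f : EuclideanSpace ℝ (Fin d) → E)
    (x : EuclideanSpace ℝ (Fin d)) {r : ℝ} (hr : 0 < r) :
    eLpNorm f 2 (blowUp s μ x r) =
      ENNReal.ofReal (r ^ (-s)) ^ (1 / (2 : ℝ≥0∞)).toReal * eLpNorm (f ∘ zoom x r) 2 μ := by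
  rw [blowUp, eLpNorm_smul_measure_of_ne_top ENNReal.ofNat_ne_top,
    (measurableEmbedding_zoom x hr).eLpNorm_map_measure, smul_eq_mul]

lemma memLp_two_comp_zoom {E : Type*} [NormedAddCommGroup E] {f : EuclideanSpace ℝ (Fin d) → E}
    {x : EuclideanSpace ℝ (Fin d)} {r : ℝ} (hr : 0 < r) (hf : MemLp f 2 (blowUp s μ x r)) :
    MemLp (f ∘ zoom x r) 2 μ := by
  rw [← (measurableEmbedding_zoom x hr).memLp_map_measure_iff]
  have hc : ENNReal.ofReal (r ^ (-s)) ≠ 0 := by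
    rw [Ne, ENNReal.ofReal_eq_zero, not_le]
    positivity
  have := hf.smul_measure (ENNReal.inv_ne_top.2 hc)
  rwa [blowUp, smul_smul, ENNReal.inv_mul_cancel hc ENNReal.ofReal_ne_top, one_smul] at this

/-- Both `L²` norms acquire the same power of `r`, so the bound at level `δ` is the original one at
level `r * δ`. -/
lemma IsGood.isGood_blowUp (hΩ : IsCZNumerator Ω) (h : IsGood s Ω Λ μ) (x : EuclideanSpace ℝ (Fin d))
    {r : ℝ} (hr : 0 < r) : IsGood s Ω Λ (blowUp s μ x r) := by
  refine ⟨h.1.isNice_blowUp x hr, fun δ hδ f hf => ?_⟩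
  have h1 := h.2 (r * δ) (by positivity) _ (memLp_two_comp_zoom hr hf)
  rw [eLpNorm_two_blowUp _ x hr, eLpNorm_two_blowUp _ x hr, mul_left_comm]
  refine mul_le_mul_right ?_ _
  refine le_of_eq_of_le ?_ h1
  congr 1
  ext1 w
  exact regOp_blowUp hΩ x hr hδ f w

/-! ### The operator on a cutoff function as a square integrable function -/

/-- Banach–Alaoglu, transported to `H` by the Riesz identification with its dual; the conjugations
compensate for that map being conjugate linear. -/
lemma exists_tendsto_inner_of_bounded {H : Type*} [NormedAddCommGroup H] [InnerProductSpace ℂ H]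
    [CompleteSpace H] {ι : Type*} (U : Ultrafilter ι) {h : ι → H} {B : ℝ}
    (hB : ∀ᶠ i in U, ‖h i‖ ≤ B) :
    ∃ F : H, ∀ g : H, Tendsto (fun i => inner ℂ g (h i)) U (𝓝 (inner ℂ g F)) := by
  let D : ι → WeakDual ℂ H := fun i => StrongDual.toWeakDual (InnerProductSpace.toDual ℂ H (h i))
  obtain ⟨F, -, hF⟩ := (WeakDual.isCompact_closedBall (𝕜 := ℂ) (E := H) 0 B).ultrafilter_le_nhds
    (U.map D) (by
      rw [le_principal_iff]
      refine hB.mono fun i hi => ?_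
      simpa [D] using hi)
  refine ⟨(InnerProductSpace.toDual ℂ H).symm (WeakDual.toStrongDual F), fun g => ?_⟩
  have h1 : Tendsto (fun i => D i g) U (𝓝 (F g)) :=
    ((WeakDual.eval_continuous g).tendsto F).comp hF
  have h2 := (Complex.continuous_conj.tendsto _).comp h1
  have e1 : ∀ i, (starRingEnd ℂ) (D i g) = inner ℂ g (h i) := fun i => by
    simp [D]
  have e2 : (starRingEnd ℂ) (F g) =
      inner ℂ g ((InnerProductSpace.toDual ℂ H).symm (WeakDual.toStrongDual F)) := by
    rw [← inner_conj_symm, InnerProductSpace.toDual_symm_apply]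
    rfl
  rw [← e2]
  exact h2.congr e1

/-- Supplies the antisymmetric Lipschitz constant required by `exists_norm_pairing_sub_le`. -/
lemma norm_mul_cutoff_sub_le {g : EuclideanSpace ℝ (Fin d) → ℂ} {C : ℝ≥0} (hg : LipschitzWith C g)
    {B M : ℝ} (hB : ∀ x, ‖g x‖ ≤ B) (hM : 0 < M) (x y : EuclideanSpace ℝ (Fin d)) :
    ‖g x * (cutoff M y : ℂ) - g y * (cutoff M x : ℂ)‖ ≤ (C + B * M⁻¹) * ‖x - y‖ := by
  have e : g x * (cutoff M y : ℂ) - g y * (cutoff M x : ℂ) =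
      (g x - g y) * (cutoff M y : ℂ) + g y * ((cutoff M y - cutoff M x : ℝ) : ℂ) := by
    push_cast
    ring
  have hB0 : 0 ≤ B := (norm_nonneg _).trans (hB x)
  rw [e, add_mul]
  refine (norm_add_le _ _).trans (add_le_add ?_ ?_)
  · rw [norm_mul, Complex.norm_real, Real.norm_of_nonneg (cutoff_nonneg _ _)]
    calc _ ≤ ‖g x - g y‖ * 1 := by gcongr; exact cutoff_le_one _ _
      _ ≤ C * ‖x - y‖ := by rw [mul_one]; exact hg.norm_sub_le x y
  · rw [norm_mul, Complex.norm_real, Real.norm_eq_abs, mul_assoc]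
    refine mul_le_mul (hB y) ?_ (abs_nonneg _) hB0
    rw [norm_sub_rev]
    exact abs_cutoff_sub_le hM y x

lemma continuous_ofReal_cutoff (M : ℝ) :
    Continuous fun x : EuclideanSpace ℝ (Fin d) => (cutoff M x : ℂ) :=
  Complex.continuous_ofReal.comp (continuous_cutoff M)

lemma hasCompactSupport_ofReal_cutoff {M : ℝ} (hM : 0 < M) :
    HasCompactSupport fun x : EuclideanSpace ℝ (Fin d) => (cutoff M x : ℂ) :=
  (hasCompactSupport_cutoff hM).comp_left (g := fun t : ℝ => (t : ℂ)) (by simp)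

/-- `T_μ` applied to a cutoff function is a square integrable function, in the weak sense. -/
theorem IsGood.exists_memLp_tendsto_pairing (hs : 0 < s) (hΛ : 0 ≤ Λ) (hΩ : IsCZNumerator Ω)
    (h : IsGood s Ω Λ μ) {N : ℝ} (hN : 0 < N) :
    ∃ F : EuclideanSpace ℝ (Fin d) → EuclideanSpace ℂ (Fin d'), MemLp F 2 μ ∧
      ∀ g : EuclideanSpace ℝ (Fin d) → ℂ, (∃ C : ℝ≥0, LipschitzWith C g) → HasCompactSupport g →
        Tendsto (fun δ => pairing s Ω μ δ (fun x => (cutoff N x : ℂ)) g) (𝓝[>] 0)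
          (𝓝 (∫ x, g x • F x ∂μ)) := by
  have := h.1.isLocallyFiniteMeasure
  obtain ⟨C₀, hC₀, hcauchy⟩ := exists_norm_pairing_sub_le (d := d) hs hΩ
  set φ : EuclideanSpace ℝ (Fin d) → ℂ := fun x => (cutoff N x : ℂ) with hφ
  have hφc : Continuous φ := continuous_ofReal_cutoff N
  have hφs : HasCompactSupport φ := hasCompactSupport_ofReal_cutoff hN
  have hφL : MemLp φ 2 μ := hφc.memLp_of_hasCompactSupport hφs
  -- Weak compactness gives `F` only along an ultrafilter; the uniform Cauchy estimate below
  -- upgrades this to a limit as `δ → 0⁺`.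
  set U : Ultrafilter ℝ := Ultrafilter.of (𝓝[>] 0) with hU
  have hUle : (U : Filter ℝ) ≤ 𝓝[>] 0 := Ultrafilter.of_le _
  have hpos : ∀ᶠ δ in U, (0 : ℝ) < δ := hUle self_mem_nhdsWithin
  have hT : ∀ δ : ℝ, 0 < δ → MemLp (regOp s Ω μ δ φ) 2 μ :=
    fun δ hδ => h.memLp_regOp hs hΩ hδ hφc hφs
  let T : ℝ → Lp (EuclideanSpace ℂ (Fin d')) 2 μ :=
    fun δ => if hδ : 0 < δ then (hT δ hδ).toLp else 0
  have hTB : ∀ᶠ δ in U, ‖T δ‖ ≤ (ENNReal.ofReal Λ * eLpNorm φ 2 μ).toReal := by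
    filter_upwards [hpos] with δ hδ
    simp only [T, hδ, dif_pos, Lp.norm_toLp]
    exact ENNReal.toReal_mono (ENNReal.mul_ne_top ENNReal.ofReal_ne_top hφL.2.ne) (h.2 δ hδ φ hφL)
  obtain ⟨F, hF⟩ := exists_tendsto_inner_of_bounded U hTB
  refine ⟨F, Lp.memLp F, fun g ⟨C, hgC⟩ hgs => ?_⟩
  have hg : Continuous g := hgC.continuous
  have hgL : MemLp g 2 μ := hg.memLp_of_hasCompactSupport hgs
  -- Weak convergence in the vector-valued `L²` is tested on `conj g • e`, which isolates the
  -- `e`-component of the vector pairing.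
  have hpair : ∀ (e : EuclideanSpace ℂ (Fin d')) (G : EuclideanSpace ℝ (Fin d) →
      EuclideanSpace ℂ (Fin d')), MemLp G 2 μ →
      ∫ x, inner ℂ (starRingEnd ℂ (g x) • e) (G x) ∂μ = inner ℂ e (∫ x, g x • G x ∂μ) := by
    intro e G hG
    have hi : Integrable (fun x => g x • G x) μ := memLp_one_iff_integrable.1 (hG.smul hgL)
    rw [← integral_inner hi]
    congr 1 with x
    rw [inner_smul_left, inner_smul_right, Complex.conj_conj]
  have hinner : ∀ e : EuclideanSpace ℂ (Fin d'),
      Tendsto (fun δ => inner ℂ e (pairing s Ω μ δ φ g)) U (𝓝 (inner ℂ e (∫ x, g x • F x ∂μ))) := by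
    intro e
    have hGL : MemLp (fun x => starRingEnd ℂ (g x) • e) 2 μ := by
      refine Continuous.memLp_of_hasCompactSupport
        ((Complex.continuous_conj.comp hg).smul continuous_const) ?_
      exact HasCompactSupport.intro hgs.isCompact fun x hx => by
        simp [image_eq_zero_of_notMem_tsupport hx]
    have h1 := hF hGL.toLp
    have e1 : ∀ (G : EuclideanSpace ℝ (Fin d) → EuclideanSpace ℂ (Fin d')) (hG : MemLp G 2 μ)
        (G' : Lp (EuclideanSpace ℂ (Fin d')) 2 μ), G' =ᵐ[μ] G →
        inner ℂ hGL.toLp G' = inner ℂ e (∫ x, g x • G x ∂μ) := by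
      intro G hG G' hGG'
      rw [L2.inner_def, ← hpair e G hG]
      refine integral_congr_ae ?_
      filter_upwards [hGL.coeFn_toLp, hGG'] with x hx1 hx2
      rw [hx1, hx2]
    rw [e1 F (Lp.memLp F) F EventuallyEq.rfl] at h1
    refine h1.congr' ?_
    filter_upwards [hpos] with δ hδ
    simp only [T, hδ, dif_pos]
    exact e1 _ (hT δ hδ) _ (hT δ hδ).coeFn_toLp
  obtain ⟨B, hB⟩ := hg.bounded_above_of_compact_support hgs
  have hB0 : 0 ≤ B := (norm_nonneg _).trans (hB 0)
  obtain ⟨ρ, hρ, hρg⟩ := exists_tsupport_subset_closedBall hgs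
  set A := C₀ * (C + B * N⁻¹) * Λ ^ 2 * (ρ + 1) ^ s with hA
  have hest : ∀ δ δ' : ℝ, 0 < δ' → δ' ≤ δ →
      ‖pairing s Ω μ δ φ g - pairing s Ω μ δ' φ g‖ ≤ A * δ :=
    hcauchy Λ μ hΛ h.1 φ g hφc hφs hg hgs 0 (ρ + 1) _ (by positivity) (by positivity)
      (fun x hx => image_eq_zero_of_notMem_tsupport fun hx' => hx (by
        have := hρg hx'
        simp only [Metric.mem_closedBall, Metric.mem_ball] at this ⊢
        linarith)) (norm_mul_cutoff_sub_le hgC hB hN)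
  have hfin : ∀ δ : ℝ, 0 < δ → ‖pairing s Ω μ δ φ g - ∫ x, g x • F x ∂μ‖ ≤ A * δ := by
    intro δ hδ
    set D := pairing s Ω μ δ φ g - ∫ x, g x • F x ∂μ with hD
    -- Convergence is known only componentwise, so the difference `D` is tested against itself;
    -- letting `δ'` tend to `0` gives `‖D‖ ^ 2 ≤ ‖D‖ * (A * δ)`.
    have h1 : Tendsto (fun δ' => ‖inner ℂ D (pairing s Ω μ δ φ g - pairing s Ω μ δ' φ g)‖) U
        (𝓝 ‖(inner ℂ D D : ℂ)‖) := by
      nth_rw 3 [hD]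
      simp_rw [inner_sub_right]
      exact ((hinner D).const_sub _).norm
    have hlt : ∀ᶠ δ' in U, δ' < δ := hUle (mem_nhdsWithin_of_mem_nhds (Iio_mem_nhds hδ))
    have h2 : ‖(inner ℂ D D : ℂ)‖ ≤ ‖D‖ * (A * δ) := by
      refine le_of_tendsto h1 ?_
      filter_upwards [hpos, hlt] with δ' h0 h1
      refine (norm_inner_le_norm _ _).trans ?_
      gcongr
      exact hest δ δ' h0 h1.le
    rw [inner_self_eq_norm_sq_to_K] at h2
    have h3 : ‖D‖ * ‖D‖ ≤ ‖D‖ * (A * δ) := by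
      simpa [sq] using h2
    rcases (norm_nonneg D).eq_or_lt with h0 | h0
    · rw [← h0]
      positivity
    · exact le_of_mul_le_mul_left h3 h0
  rw [tendsto_iff_norm_sub_tendsto_zero]
  have hlim : Tendsto (fun δ : ℝ => A * δ) (𝓝[>] 0) (𝓝 0) := by
    have : Continuous fun δ : ℝ => A * δ := by fun_prop
    simpa using (this.tendsto 0).mono_left nhdsWithin_le_nhds
  exact squeeze_zero' (Eventually.of_forall fun _ => norm_nonneg _)
    (eventually_nhdsWithin_of_forall hfin) hlim

/-! ### Density and Lebesgue points -/

/-- Mass distribution principle: a small set of diameter `D > 0` meeting `E` at `x` lies in `B(x,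
2D)`, hence the factor `2 ^ s`; restricting to diameters at most `ε / 4` gives `2D < ε`. -/
lemma measure_le_mul_hausdorffMeasure (hs : 0 < s) (hμ : IsNice s Λ μ) {c ε : ℝ} (hc : 0 < c)
    (hε : 0 < ε) {E : Set (EuclideanSpace ℝ (Fin d))}
    (hE : ∀ x ∈ E, ∀ r : ℝ, 0 < r → r < ε → μ (Metric.ball x r) ≤ ENNReal.ofReal (c * r ^ s)) :
    μ E ≤ ENNReal.ofReal (c * 2 ^ s) * Measure.hausdorffMeasure s E := by
  set a := ENNReal.ofReal (c * 2 ^ s) with ha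
  have ha0 : a ≠ 0 := by
    rw [ha, Ne, ENNReal.ofReal_eq_zero, not_le]
    positivity
  have hat : a ≠ ∞ := ENNReal.ofReal_ne_top
  have hle : a⁻¹ • μ.restrict E ≤ Measure.hausdorffMeasure s := by
    refine Measure.le_hausdorffMeasure s _ (ENNReal.ofReal (ε / 4)) (by simpa using hε) ?_
    intro t ht
    rw [Measure.smul_apply, smul_eq_mul, ENNReal.inv_mul_le_iff ha0 hat]
    -- The closure is measurable and has the same diameter.
    refine (measure_mono subset_closure).trans ?_
    rw [Measure.restrict_apply isClosed_closure.measurableSet]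
    rcases (closure t ∩ E).eq_empty_or_nonempty with h0 | ⟨x, hxt, hxE⟩
    · simp [h0]
    have hdt : Metric.ediam t ≠ ∞ := (ht.trans_lt ENNReal.ofReal_lt_top).ne
    set D := (Metric.ediam t).toReal with hD
    have hsub : ∀ y ∈ closure t, dist y x ≤ D := by
      intro y hy
      rw [dist_edist, hD, ← Metric.ediam_closure t]
      refine ENNReal.toReal_mono (by rwa [Metric.ediam_closure]) (Metric.edist_le_ediam_of_mem hy hxt)
    have hDε : D ≤ ε / 4 := ENNReal.toReal_le_of_le_ofReal (by positivity) ht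
    -- Diameter zero must be treated apart, as `B(x, 2D)` is then empty; a single point is null.
    rcases (show 0 ≤ D from ENNReal.toReal_nonneg).eq_or_lt with h0 | h0
    · have : closure t ∩ E ⊆ {x} := fun y hy => by
        have := hsub y hy.1
        rw [← h0] at this
        exact dist_le_zero.1 this
      exact (measure_mono this).trans ((hμ.measure_singleton hs x).le.trans zero_le)
    · have : closure t ∩ E ⊆ Metric.ball x (2 * D) := fun y hy => by
        rw [Metric.mem_ball]
        linarith [hsub y hy.1]
      refine (measure_mono this).trans ((hE x hxE (2 * D) (by positivity) (by linarith)).trans ?_)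
      rw [Real.mul_rpow (by norm_num) h0.le, ← mul_assoc, ENNReal.ofReal_mul (by positivity),
        ← ENNReal.ofReal_rpow_of_pos h0, hD, ENNReal.ofReal_toReal hdt]
  have := hle E
  rwa [Measure.smul_apply, Measure.restrict_apply_self, smul_eq_mul,
    ENNReal.inv_mul_le_iff ha0 hat] at this

/-- A nonzero nice measure carried by a set of finite Hausdorff measure has positive upper density
on a set of positive measure. -/
lemma measure_upperDensity_pos_ne_zero (hs : 0 < s) (hμ : IsNice s Λ μ)
    (hH : Measure.hausdorffMeasure s μ.support < ∞) (hμ0 : μ ≠ 0) :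
    μ {x | ∃ c : ℝ, 0 < c ∧ ∃ᶠ r in 𝓝[>] (0 : ℝ),
      ENNReal.ofReal (c * r ^ s) < μ (Metric.ball x r)} ≠ 0 := by
  intro h0
  apply hμ0
  rw [← Measure.measure_univ_eq_zero]
  have key : ∀ c : ℝ, 0 < c → μ Set.univ ≤
      ENNReal.ofReal (c * 2 ^ s) * Measure.hausdorffMeasure s μ.support := by
    intro c hc
    set E : ℕ → Set (EuclideanSpace ℝ (Fin d)) := fun n => {x | x ∈ μ.support ∧
      ∀ r : ℝ, 0 < r → r < 1 / (n + 1) → μ (Metric.ball x r) ≤ ENNReal.ofReal (c * r ^ s)}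
    have hmono : Monotone E := by
      rintro a b hab x ⟨hx, hx'⟩
      refine ⟨hx, fun r hr hrb => hx' r hr (hrb.trans_le ?_)⟩
      exact one_div_le_one_div_of_le (by positivity) (by gcongr)
    -- Outside the null set of positive upper density, and up to the null complement of the support,
    -- the small-density inequality holds at all small radii. Intersecting with the support keeps
    -- the Hausdorff measure finite as `c → 0`.
    have hae : (⋃ n, E n) =ᵐ[μ] Set.univ := by
      rw [ae_eq_univ]
      refine measure_mono_null ?_ (measure_union_null h0 (Measure.measure_compl_support (μ := μ)))
      intro x hx
      by_contra hx'
      simp only [Set.mem_union, Set.mem_ofPred_eq, Set.mem_compl_iff, not_or, not_not, not_exists,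
        not_and, not_frequently, not_lt] at hx'
      obtain ⟨h1, h2⟩ := hx'
      have h3 := h1 c hc
      rw [eventually_nhdsWithin_iff, Metric.eventually_nhds_iff] at h3
      obtain ⟨ε, hε, h3⟩ := h3
      obtain ⟨n, hn⟩ := exists_nat_one_div_lt hε
      refine hx (Set.mem_iUnion.2 ⟨n, h2, fun r hr hrn => h3 ?_ hr⟩)
      rw [dist_zero_right, Real.norm_of_nonneg hr.le]
      exact hrn.trans hn
    rw [← measure_congr hae, hmono.measure_iUnion]
    refine iSup_le fun n => ?_
    refine (measure_le_mul_hausdorffMeasure hs hμ hc (by positivity : (0 : ℝ) < 1 / (n + 1))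
      fun x hx => hx.2).trans ?_
    gcongr
    exact fun x hx => hx.1
  have hlim : Tendsto (fun c : ℝ => ENNReal.ofReal (c * 2 ^ s) *
      Measure.hausdorffMeasure s μ.support) (𝓝[>] 0) (𝓝 0) := by
    have h1 : Tendsto (fun c : ℝ => ENNReal.ofReal (c * 2 ^ s)) (𝓝[>] 0) (𝓝 0) := by
      have : Continuous fun c : ℝ => ENNReal.ofReal (c * 2 ^ s) :=
        ENNReal.continuous_ofReal.comp (by fun_prop)
      simpa using (this.tendsto 0).mono_left nhdsWithin_le_nhds
    simpa using ENNReal.Tendsto.mul_const h1 (Or.inr hH.ne)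
  exact le_antisymm (ge_of_tendsto hlim (eventually_nhdsWithin_of_forall key)) zero_le

/-- Almost every point is a Lebesgue point at scale `r ^ s`. -/
lemma IsNice.ae_tendsto_rpow_mul_setIntegral (hΛ : 0 ≤ Λ) (hμ : IsNice s Λ μ)
    {E : Type*} [NormedAddCommGroup E]
    {F : EuclideanSpace ℝ (Fin d) → E} (hF : LocallyIntegrable F μ) :
    ∀ᵐ x ∂μ, ∀ R : ℝ, 0 < R →
      Tendsto (fun r => r ^ (-s) * ∫ y in Metric.closedBall x (R * r), ‖F y - F x‖ ∂μ)
        (𝓝[>] 0) (𝓝 0) := by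
  have := hμ.isLocallyFiniteMeasure
  -- `μ` need not be doubling, so differentiation rests on the Besicovitch covering theorem.
  -- Niceness then replaces division by the mass of the ball with multiplication by `r ^ (-s)`.
  filter_upwards [(Besicovitch.vitaliFamily μ).ae_tendsto_average_norm_sub hF] with x hx R hR
  have hx1 := hx.comp (Besicovitch.tendsto_filterAt μ x)
  have hR1 : Tendsto (fun r : ℝ => R * r) (𝓝[>] 0) (𝓝[>] 0) := by
    refine tendsto_nhdsWithin_iff.2 ⟨?_, eventually_nhdsWithin_of_forall fun r hr => mul_pos hR hr⟩
    have : Continuous fun r : ℝ => R * r := by fun_prop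
    simpa using (this.tendsto 0).mono_left nhdsWithin_le_nhds
  have hx2 := (hx1.comp hR1).const_mul (Λ * (2 * R) ^ s)
  rw [mul_zero] at hx2
  refine squeeze_zero' ?_ ?_ hx2
  · filter_upwards [self_mem_nhdsWithin] with r hr
    have : (0 : ℝ) < r := hr
    exact mul_nonneg (by positivity) (integral_nonneg fun _ => norm_nonneg _)
  · filter_upwards [self_mem_nhdsWithin] with r hr
    have hr' : (0 : ℝ) < r := hr
    have hm := hμ.measure_closedBall_le x (by positivity : 0 < R * r)
    have hm' : μ.real (Metric.closedBall x (R * r)) ≤ Λ * (2 * (R * r)) ^ s :=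
      ENNReal.toReal_le_of_le_ofReal (by positivity) hm
    have hav : 0 ≤ ⨍ y in Metric.closedBall x (R * r), ‖F y - F x‖ ∂μ := by
      rw [setAverage_eq]
      exact smul_nonneg (by positivity) (integral_nonneg fun _ => norm_nonneg _)
    rw [← measure_smul_setAverage _ (hm.trans_lt ENNReal.ofReal_lt_top).ne, smul_eq_mul]
    calc r ^ (-s) * (μ.real (Metric.closedBall x (R * r)) *
          ⨍ y in Metric.closedBall x (R * r), ‖F y - F x‖ ∂μ)
        ≤ r ^ (-s) * (Λ * (2 * (R * r)) ^ s *
          ⨍ y in Metric.closedBall x (R * r), ‖F y - F x‖ ∂μ) := by gcongr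
      _ = _ := by
        rw [← mul_assoc 2, Real.mul_rpow (by positivity) hr'.le, Real.rpow_neg hr'.le]
        simp only [Function.comp]
        field_simp

/-! ### Linearity of the pairings -/

/-- The outer integrability is assumed because `f₁` is merely square integrable; for the difference
it can come from separation of supports, through `pairing_eq_integral_renormPotential`. -/
lemma pairing_sub_left (hs : 0 < s) (hΛ : 0 ≤ Λ) (hΩ : IsCZNumerator Ω) (hμ : IsNice s Λ μ)
    {δ : ℝ} (hδ : 0 < δ) {f₁ f₂ g : EuclideanSpace ℝ (Fin d) → ℂ} (h₁ : MemLp f₁ 2 μ)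
    (h₂ : MemLp f₂ 2 μ) (i₁ : Integrable (fun x => g x • regOp s Ω μ δ (fun y => f₁ y - f₂ y) x) μ)
    (i₂ : Integrable (fun x => g x • regOp s Ω μ δ f₂ x) μ) :
    pairing s Ω μ δ f₁ g = pairing s Ω μ δ (fun y => f₁ y - f₂ y) g + pairing s Ω μ δ f₂ g := by
  rw [pairing, pairing, pairing, ← integral_add i₁ i₂]
  congr 1 with x : 1
  rw [← smul_add]
  congr 1
  have j₁ : Integrable (fun y => (f₁ y - f₂ y) • czKernelReg s Ω δ (x - y)) μ :=
    integrable_smul_czKernelReg hs hΛ hΩ hμ hδ (h₁.sub h₂) x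
  rw [regOp, regOp, regOp, ← integral_add j₁ (integrable_smul_czKernelReg hs hΛ hΩ hμ hδ h₂ x)]
  congr 1 with y : 1
  rw [← add_smul, sub_add_cancel]

lemma pairing_mul_sub_mul_right (hs : 0 < s) (hΩ : IsCZNumerator Ω) [IsLocallyFiniteMeasure μ]
    {δ : ℝ} (hδ : 0 < δ) {f g₁ g₂ : EuclideanSpace ℝ (Fin d) → ℂ} (hf : Continuous f)
    (hfc : HasCompactSupport f) (h₁ : Continuous g₁) (c₁ : HasCompactSupport g₁)
    (h₂ : Continuous g₂) (c₂ : HasCompactSupport g₂) (a b : ℂ) :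
    pairing s Ω μ δ f (fun x => a * g₁ x - b * g₂ x) =
      a • pairing s Ω μ δ f g₁ - b • pairing s Ω μ δ f g₂ := by
  have i₁ : Integrable (fun x => a • g₁ x • regOp s Ω μ δ f x) μ :=
    (integrable_smul_regOp hs hΩ hδ hf hfc h₁ c₁).smul a
  have i₂ : Integrable (fun x => b • g₂ x • regOp s Ω μ δ f x) μ :=
    (integrable_smul_regOp hs hΩ hδ hf hfc h₂ c₂).smul b
  rw [pairing, pairing, pairing, ← integral_smul, ← integral_smul, ← integral_sub i₁ i₂]
  congr 1 with x : 1
  rw [sub_smul, mul_smul, mul_smul]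

/-- Decay of pairings with disjoint supports and cancellation. -/
lemma exists_norm_pairing_le (hs : 0 < s) (hΩ : IsCZNumerator Ω) :
    ∃ C α : ℝ, 0 < C ∧ 0 < α ∧ ∀ (Λ : ℝ) (μ : Measure (EuclideanSpace ℝ (Fin d))), 0 ≤ Λ →
      IsNice s Λ μ → ∀ f g : EuclideanSpace ℝ (Fin d) → ℂ, MemLp f 2 μ → (∀ y, ‖f y‖ ≤ 1) →
      Continuous g → HasCompactSupport g → ∀ R M B : ℝ, 0 < R → 2 * R ≤ M →
      (∀ y ∈ Metric.ball 0 M, f y = 0) → (∀ x ∉ Metric.ball 0 R, g x = 0) →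
      (∀ x, ‖g x‖ ≤ B) → ∫ x, g x ∂μ = 0 → ∀ δ : ℝ, 0 < δ → δ ≤ R →
      ‖pairing s Ω μ δ f g‖ ≤ C * Λ ^ 2 * R ^ (s + α) * B * M ^ (-α) := by
  obtain ⟨C, α, hC, hα, hP⟩ := exists_norm_renormPotential_le (d := d) hs hΩ
  refine ⟨C, α, hC, hα, ?_⟩
  intro Λ μ hΛ hμ f g hf hf1 hg hgc R M B hR hM hf0 hgs hB hg0 δ hδ hδR
  have := hμ.isLocallyFiniteMeasure
  have h0 : (0 : EuclideanSpace ℝ (Fin d)) ∈ Metric.ball 0 R := Metric.mem_ball_self hR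
  rw [(pairing_eq_integral_renormPotential hs hΛ hΩ hμ hf hf1 hg hgc hR hgs
    (fun y hy => hf0 y (Metric.ball_subset_ball hM hy)) hg0 h0 hδ hδR).2.2]
  refine (norm_integral_smul_le_of_tsupport hΛ hμ hg hR hgs hB
    (aestronglyMeasurable_renormPotential (s := s) hΩ hf.1 0)
    (fun x hx => (hP Λ μ hΛ hμ f hf.1 hf1 0 R M hR hM hf0 x hx 0 h0).2)).2.trans (le_of_eq ?_)
  rw [Real.rpow_add hR]
  ring

/-! ### Tangent measures at Lebesgue points -/

/-- Undoing the zoom turns the pairing into `r ^ (-s)` times the integral of `F` against a rescaled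
copy of `g`. As that copy has mean zero, `F` may be replaced by `F - F x`, which is what a Lebesgue
point controls. -/
lemma exists_tendsto_pairing_blowUp (hΩ : IsCZNumerator Ω) [IsLocallyFiniteMeasure μ] {N : ℝ}
    {F : EuclideanSpace ℝ (Fin d) → EuclideanSpace ℂ (Fin d')} (hF : MemLp F 2 μ)
    (hFp : ∀ g : EuclideanSpace ℝ (Fin d) → ℂ, (∃ C : ℝ≥0, LipschitzWith C g) →
      HasCompactSupport g → Tendsto (fun δ => pairing s Ω μ δ (fun x => (cutoff N x : ℂ)) g)
        (𝓝[>] 0) (𝓝 (∫ x, g x • F x ∂μ)))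
    (x : EuclideanSpace ℝ (Fin d)) {r R B : ℝ} (hr : 0 < r)
    {g : EuclideanSpace ℝ (Fin d) → ℂ} {L : ℝ≥0} (hgL : LipschitzWith L g)
    (hgc : HasCompactSupport g) (hgs : ∀ y ∉ Metric.ball 0 R, g y = 0) (hB : ∀ y, ‖g y‖ ≤ B)
    (hg0 : ∫ y, g y ∂(blowUp s μ x r) = 0) :
    ∃ v, Tendsto (fun δ => pairing s Ω (blowUp s μ x r) δ (fun u => (cutoff N (x + r • u) : ℂ)) g)
      (𝓝[>] 0) (𝓝 v) ∧
      ‖v‖ ≤ B * (r ^ (-s) * ∫ y in Metric.closedBall x (R * r), ‖F y - F x‖ ∂μ) := by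
  set G : EuclideanSpace ℝ (Fin d) → ℂ := fun y => g (zoom x r y) with hG
  have hGc : HasCompactSupport G := HasCompactSupport.comp_zoom hgc x hr
  have hGcont : Continuous G := hgL.continuous.comp (continuous_zoom x r)
  have hGL : ∃ C : ℝ≥0, LipschitzWith C G := by
    refine ⟨L * (r⁻¹).toNNReal, hgL.comp (LipschitzWith.of_dist_le_mul fun y w => ?_)⟩
    rw [dist_eq_norm, zoom_sub_zoom, norm_smul, dist_eq_norm, norm_inv, Real.norm_of_nonneg hr.le,
      Real.coe_toNNReal _ (by positivity)]
  have hG0 : ∫ y, G y ∂μ = 0 := by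
    rw [integral_blowUp _ x hr, smul_eq_zero] at hg0
    exact hg0.resolve_left (by positivity)
  refine ⟨r ^ (-s) • ∫ y, G y • F y ∂μ, ?_, ?_⟩
  · have hsc : Tendsto (fun δ : ℝ => r * δ) (𝓝[>] 0) (𝓝[>] 0) := by
      refine tendsto_nhdsWithin_iff.2
        ⟨?_, eventually_nhdsWithin_of_forall fun δ hδ => mul_pos hr hδ⟩
      have : Continuous fun δ : ℝ => r * δ := by fun_prop
      simpa using (this.tendsto 0).mono_left nhdsWithin_le_nhds
    refine (((hFp G hGL hGc).comp hsc).const_smul (r ^ (-s))).congr' ?_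
    filter_upwards [self_mem_nhdsWithin] with δ hδ
    rw [pairing_blowUp hΩ x hr hδ]
    have e : ∀ y, x + r • zoom x r y = y := fun y => by
      simp [zoom, smul_smul, mul_inv_cancel₀ hr.ne']
    simp only [e, Function.comp, hG]
  · have hGi : Integrable G μ := hGcont.integrable_of_hasCompactSupport hGc
    have hGF : Integrable (fun y => G y • F y) μ :=
      memLp_one_iff_integrable.1 (hF.smul (hGcont.memLp_of_hasCompactSupport (p := 2) hGc))
    have e : ∫ y, G y • F y ∂μ = ∫ y, G y • (F y - F x) ∂μ := by
      simp_rw [smul_sub]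
      rw [integral_sub hGF (hGi.smul_const _), integral_smul_const, hG0, zero_smul, sub_zero]
    have hbd : ‖∫ y, G y • (F y - F x) ∂μ‖ ≤
        B * ∫ y in Metric.closedBall x (R * r), ‖F y - F x‖ ∂μ := by
      have hFi : IntegrableOn (fun y => F y - F x) (Metric.closedBall x (R * r)) μ :=
        ((hF.locallyIntegrable one_le_two).integrableOn_isCompact (isCompact_closedBall _ _)).sub
          (integrableOn_const (isCompact_closedBall _ _).measure_lt_top.ne)
      rw [← integral_const_mul, ← integral_indicator Metric.isClosed_closedBall.measurableSet]
      refine norm_integral_le_of_norm_le ((integrable_indicator_iff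
        Metric.isClosed_closedBall.measurableSet).2 (hFi.norm.const_mul B))
        (Eventually.of_forall fun y => ?_)
      by_cases hy : y ∈ Metric.closedBall x (R * r)
      · rw [Set.indicator_of_mem hy, norm_smul]
        gcongr
        exact hB _
      · have h0 : G y = 0 := by
          refine hgs _ fun h => hy ?_
          have h1 : y ∈ zoom x r ⁻¹' Metric.ball 0 R := h
          rw [zoom_preimage_ball x 0 hr, smul_zero, add_zero, mul_comm] at h1
          exact Metric.ball_subset_closedBall h1
        simp [h0, Set.indicator_of_notMem hy]
    rw [norm_smul, Real.norm_of_nonneg (by positivity), e, mul_left_comm]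
    gcongr

/-- Trades a cutoff `φ` that varies with the blow-up scale, with its limit `v` as `δ → 0⁺`, for the
fixed `cutoff M` at a fixed `δ`; only the latter pairing is continuous under vague limits. All
constants are uniform over `Λ`-nice measures. -/
lemma exists_norm_pairing_cutoff_le (hs : 0 < s) (hΩ : IsCZNumerator Ω) :
    ∃ C α : ℝ, 0 < C ∧ 0 < α ∧ ∀ (Λ : ℝ) (μ : Measure (EuclideanSpace ℝ (Fin d))), 0 ≤ Λ →
      IsNice s Λ μ → ∀ φ : EuclideanSpace ℝ (Fin d) → ℝ, Continuous φ → HasCompactSupport φ →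
      (∀ y, 0 ≤ φ y) → (∀ y, φ y ≤ 1) → ∀ (g : EuclideanSpace ℝ (Fin d) → ℂ) (L : ℝ≥0),
      LipschitzWith L g → HasCompactSupport g → ∀ R M B : ℝ, 0 < R → 2 * R ≤ M →
      (∀ y ∈ Metric.ball 0 M, φ y = 1) → (∀ x ∉ Metric.ball 0 R, g x = 0) →
      (∀ x, ‖g x‖ ≤ B) → ∫ x, g x ∂μ = 0 → ∀ v,
      Tendsto (fun δ => pairing s Ω μ δ (fun y => (φ y : ℂ)) g) (𝓝[>] 0) (𝓝 v) →
      ∀ δ : ℝ, 0 < δ → δ ≤ R →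
      ‖pairing s Ω μ δ (fun y => (cutoff M y : ℂ)) g‖ ≤
        C * (L + B * M⁻¹) * Λ ^ 2 * R ^ s * δ + ‖v‖ +
          C * Λ ^ 2 * R ^ (s + α) * B * M ^ (-α) := by
  obtain ⟨C₁, hC₁, h1⟩ := exists_norm_pairing_sub_le (d := d) hs hΩ
  obtain ⟨C₂, α, hC₂, hα, h2⟩ := exists_norm_pairing_le (d := d) hs hΩ
  refine ⟨max C₁ C₂, α, by positivity, hα, ?_⟩
  intro Λ μ hΛ hμ φ hφ hφc hφ0 hφ1 g L hgL hgc R M B hR hRM hφM hgs hB hg0 v hv δ hδ hδR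
  have := hμ.isLocallyFiniteMeasure
  have hM : 0 < M := by linarith
  have hB0 : 0 ≤ B := (norm_nonneg _).trans (hB 0)
  have hg := hgL.continuous
  have hχ := continuous_ofReal_cutoff (d := d) M
  have hχc := hasCompactSupport_ofReal_cutoff (d := d) hM
  have hφ' : Continuous fun y => (φ y : ℂ) := Complex.continuous_ofReal.comp hφ
  have hφc' : HasCompactSupport fun y => (φ y : ℂ) :=
    hφc.comp_left (g := fun t : ℝ => (t : ℂ)) (by simp)
  have hd : Continuous fun y => (φ y : ℂ) - (cutoff M y : ℂ) := hφ'.sub hχ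
  have hdc : HasCompactSupport fun y => (φ y : ℂ) - (cutoff M y : ℂ) := hφc'.sub hχc
  have hlim : Tendsto (fun δ' => max C₁ C₂ * (L + B * M⁻¹) * Λ ^ 2 * R ^ s * δ +
      ‖pairing s Ω μ δ' (fun y => (φ y : ℂ)) g‖ +
      max C₁ C₂ * Λ ^ 2 * R ^ (s + α) * B * M ^ (-α)) (𝓝[>] 0)
      (𝓝 (max C₁ C₂ * (L + B * M⁻¹) * Λ ^ 2 * R ^ s * δ + ‖v‖ +
      max C₁ C₂ * Λ ^ 2 * R ^ (s + α) * B * M ^ (-α))) :=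
    (hv.norm.const_add _).add_const _
  refine ge_of_tendsto hlim ?_
  filter_upwards [self_mem_nhdsWithin, mem_nhdsWithin_of_mem_nhds (Iio_mem_nhds hδ)] with δ' h0 h3
  have h0' : (0 : ℝ) < δ' := h0
  have h3' : δ' < δ := h3
  have b1 := h1 Λ μ hΛ hμ (fun y => (cutoff M y : ℂ)) g hχ hχc hg hgc 0 R (L + B * M⁻¹) hR
    (by positivity) hgs (norm_mul_cutoff_sub_le hgL hB hM) δ δ' h0' h3'.le
  have b2 := h2 Λ μ hΛ hμ (fun y => (φ y : ℂ) - (cutoff M y : ℂ)) g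
    (hd.memLp_of_hasCompactSupport hdc) (fun y => by
      rw [← Complex.ofReal_sub, Complex.norm_real, Real.norm_eq_abs, abs_le]
      constructor <;> linarith [hφ0 y, hφ1 y, cutoff_nonneg M y, cutoff_le_one M y]) hg hgc R M B
    hR hRM (fun y hy => by
      rw [hφM y hy, cutoff_eq_one hM (by simpa using (Metric.mem_ball.1 hy).le)]
      simp) hgs hB hg0 δ' h0' (h3'.le.trans hδR)
  have b3 := pairing_sub_left hs hΛ hΩ hμ h0' (hφ'.memLp_of_hasCompactSupport hφc')
    (hχ.memLp_of_hasCompactSupport hχc) (integrable_smul_regOp hs hΩ h0' hd hdc hg hgc)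
    (integrable_smul_regOp hs hΩ h0' hχ hχc hg hgc)
  have b4 : C₁ * (L + B * M⁻¹) * Λ ^ 2 * R ^ s * δ ≤
      max C₁ C₂ * (L + B * M⁻¹) * Λ ^ 2 * R ^ s * δ := by
    gcongr
    exact le_max_left _ _
  have b5 : C₂ * Λ ^ 2 * R ^ (s + α) * B * M ^ (-α) ≤
      max C₁ C₂ * Λ ^ 2 * R ^ (s + α) * B * M ^ (-α) := by
    gcongr
    exact le_max_right _ _
  set P := pairing s Ω μ δ (fun y => (cutoff M y : ℂ)) g
  set P' := pairing s Ω μ δ' (fun y => (cutoff M y : ℂ)) g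
  set Q := pairing s Ω μ δ' (fun y => (φ y : ℂ)) g
  set D := pairing s Ω μ δ' (fun y => (φ y : ℂ) - (cutoff M y : ℂ)) g
  -- `P - P'` is the Cauchy error in `δ`, `Q` tends to `v`, and `D` is a tail, because `φ` and
  -- `cutoff M` agree on the ball of radius `M`.
  have e : P = (P - P') + Q - D := by
    rw [b3]
    abel
  have c1 : ‖P‖ ≤ ‖P - P'‖ + ‖Q‖ + ‖D‖ := by
    nth_rw 1 [e]
    exact (norm_sub_le _ _).trans (add_le_add (norm_add_le _ _) le_rfl)
  linarith

/-- The criterion for a good measure to be reflectionless: the pairings of large cutoff functions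
with functions of mean zero are asymptotically small. -/
lemma isReflectionless_of_pairing_cutoff_le (hs : 0 < s) (hΩ : IsCZNumerator Ω) (hΛ : 0 < Λ)
    (hν : IsGood s Ω Λ ν)
    (h : ∀ ψ : EuclideanSpace ℝ (Fin d) → ℂ, (∃ C : ℝ≥0, LipschitzWith C ψ) →
      HasCompactSupport ψ → ∫ x, ψ x ∂ν = 0 → ∃ D α R₀ : ℝ, 0 < α ∧ 0 < R₀ ∧
      ∀ M : ℝ, 2 * R₀ ≤ M → ∃ A : ℝ, ∀ δ : ℝ, 0 < δ → δ ≤ R₀ →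
      ‖pairing s Ω ν δ (fun y => (cutoff M y : ℂ)) ψ‖ ≤ A * δ + D * M ^ (-α)) :
    IsReflectionless s Ω ν := by
  refine ⟨⟨Λ, hΛ, hν⟩, fun ψ hψL hψc hψ0 x₀ R hsub z hz φ hφ hφ01 hφ1 => ?_⟩
  have := hν.1.isLocallyFiniteMeasure
  obtain ⟨D, α, R₀, hα, hR₀, hD⟩ := h ψ hψL hψc hψ0
  obtain ⟨C₁, β, hC₁, hβ, hP⟩ := exists_norm_renormPotential_le (d := d) hs hΩ
  have hψ : Continuous ψ := by
    obtain ⟨C, hC⟩ := hψL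
    exact hC.continuous
  obtain ⟨B, hB⟩ := hψ.bounded_above_of_compact_support hψc
  have hR : 0 < R := dist_nonneg.trans_lt (Metric.mem_ball.1 hz)
  have hψs : ∀ x ∉ Metric.ball x₀ R, ψ x = 0 := fun x hx =>
    image_eq_zero_of_notMem_tsupport fun hx' => hx (hsub hx')
  have hφC : MemLp (fun y => (φ y : ℂ)) 2 ν := hφ.ofReal
  set E := B * (C₁ * Λ * R ^ β) * (Λ * R ^ s) with hE
  have main : ∀ M : ℝ, 2 * R₀ ≤ M → 2 * ‖x₀‖ + 4 * R ≤ M → ∃ A : ℝ, ∀ δ : ℝ, 0 < δ → δ ≤ R₀ →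
      δ ≤ R → ‖pairing s Ω ν δ (fun y => (φ y : ℂ)) ψ + tailPairing s Ω ν φ z ψ‖ ≤
        A * δ + (D * M ^ (-α) + E * (M / 2) ^ (-β)) := by
    intro M hM1 hM2
    obtain ⟨A, hA⟩ := hD M hM1
    refine ⟨A, fun δ hδ hδ1 hδ2 => ?_⟩
    have hM : 0 < M := by linarith
    have hχ := continuous_ofReal_cutoff (d := d) M
    have hχc := hasCompactSupport_ofReal_cutoff (d := d) hM
    have hχL : MemLp (fun y => (cutoff M y : ℂ)) 2 ν := hχ.memLp_of_hasCompactSupport hχc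
    have hχ1 : ∀ y ∈ Metric.ball x₀ (M / 2), cutoff M y = 1 := fun y hy => by
      refine cutoff_eq_one hM ?_
      have h1 := norm_sub_norm_le y x₀
      rw [Metric.mem_ball, dist_eq_norm] at hy
      linarith [norm_nonneg x₀]
    have hM4 : 2 * R ≤ M / 2 := by linarith [norm_nonneg x₀]
    set f : EuclideanSpace ℝ (Fin d) → ℂ := fun y => (φ y : ℂ) - (cutoff M y : ℂ) with hf
    set k : EuclideanSpace ℝ (Fin d) → ℂ := fun y => 1 - (cutoff M y : ℂ) with hk
    have hfL : MemLp f 2 ν := hφC.sub hχL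
    have hf1 : ∀ y, ‖f y‖ ≤ 1 := fun y => by
      simp only [hf]
      rw [← Complex.ofReal_sub, Complex.norm_real, Real.norm_eq_abs, abs_le]
      constructor <;> linarith [(hφ01 y).1, (hφ01 y).2, cutoff_nonneg M y, cutoff_le_one M y]
    have hf0 : ∀ y ∈ Metric.ball x₀ (2 * R), f y = 0 := fun y hy => by
      simp [hf, hφ1 y hy, hχ1 y (Metric.ball_subset_ball hM4 hy)]
    have hkm : AEStronglyMeasurable k ν := (continuous_const.sub hχ).aestronglyMeasurable
    have hk1 : ∀ y, ‖k y‖ ≤ 1 := fun y => by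
      simp only [hk]
      rw [← Complex.ofReal_one, ← Complex.ofReal_sub, Complex.norm_real, Real.norm_eq_abs,
        abs_le]
      constructor <;> linarith [cutoff_nonneg M y, cutoff_le_one M y]
    have hk0 : ∀ y ∈ Metric.ball x₀ (M / 2), k y = 0 := fun y hy => by
      simp [hk, hχ1 y hy]
    obtain ⟨i1, i2, e1⟩ := pairing_eq_integral_renormPotential hs hΛ.le hΩ hν.1 hfL hf1 hψ hψc hR
      hψs hf0 hψ0 hz hδ hδ2
    have e2 := pairing_sub_left hs hΛ.le hΩ hν.1 hδ hφC hχL i1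
      (integrable_smul_regOp hs hΩ hδ hχ hχc hψ hψc)
    have hkP := fun x hx => hP Λ ν hΛ.le hν.1 k hkm hk1 x₀ R (M / 2) hR hM4 hk0 x hx z hz
    have hfP := fun x hx => hP Λ ν hΛ.le hν.1 f hfL.1 hf1 x₀ R _ hR le_rfl hf0 x hx z hz
    obtain ⟨i3, b3⟩ := norm_integral_smul_le_of_tsupport hΛ.le hν.1 hψ hR hψs hB
      (aestronglyMeasurable_renormPotential (s := s) hΩ hkm z) fun x hx => (hkP x hx).2
    -- With `k = 1 - cutoff M` and `f = φ - cutoff M` one has `1 - φ = k - f`. The `f`-term cancels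
    -- against the same term in the pairing of `φ`, so only the far tail `k` remains.
    have e3 : tailPairing s Ω ν φ z ψ = ∫ x, ψ x • renormPotential s Ω ν k z x ∂ν -
        ∫ x, ψ x • renormPotential s Ω ν f z x ∂ν := by
      rw [← integral_sub i3 i2, tailPairing]
      congr 1 with x : 1
      by_cases hx : x ∈ Metric.ball x₀ R
      · rw [← smul_sub]
        congr 1
        rw [renormPotential, renormPotential, ← integral_sub (hkP x hx).1 (hfP x hx).1]
        congr 1 with y : 1
        rw [← sub_smul, ← Complex.coe_smul]
        congr 1
        simp only [hk, hf]
        push_cast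
        ring
      · simp [hψs x hx]
    have e4 : pairing s Ω ν δ (fun y => (φ y : ℂ)) ψ + tailPairing s Ω ν φ z ψ =
        pairing s Ω ν δ (fun y => (cutoff M y : ℂ)) ψ +
          ∫ x, ψ x • renormPotential s Ω ν k z x ∂ν := by
      rw [e2, e3, e1]
      abel
    rw [e4, ← add_assoc]
    refine (norm_add_le _ _).trans (add_le_add (hA δ hδ hδ1) (b3.trans (le_of_eq ?_)))
    rw [hE]
    ring
  have hgoal : Tendsto (fun δ => pairing s Ω ν δ (fun y => (φ y : ℂ)) ψ +
      tailPairing s Ω ν φ z ψ) (𝓝[>] 0) (𝓝 0) := by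
    rw [Metric.tendsto_nhds]
    intro ε hε
    have hlimM : Tendsto (fun M : ℝ => D * M ^ (-α) + E * (M / 2) ^ (-β)) atTop (𝓝 0) := by
      have t1 := (tendsto_rpow_neg_atTop hα).const_mul D
      have t2 := ((tendsto_rpow_neg_atTop hβ).comp
        (tendsto_id.atTop_div_const (two_pos : (0 : ℝ) < 2))).const_mul E
      simpa using t1.add t2
    -- `M` must be fixed before `δ`, since the constant `A` depends on `M`.
    obtain ⟨M, ⟨hM1, hM2⟩, hM3⟩ := (((eventually_ge_atTop (2 * R₀)).and
      (eventually_ge_atTop (2 * ‖x₀‖ + 4 * R))).and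
      (hlimM.eventually (Iio_mem_nhds (half_pos hε)))).exists
    obtain ⟨A, hA⟩ := main M hM1 hM2
    have hlimδ : Tendsto (fun δ : ℝ => A * δ) (𝓝[>] 0) (𝓝 0) := by
      have : Continuous fun δ : ℝ => A * δ := by fun_prop
      simpa using (this.tendsto 0).mono_left nhdsWithin_le_nhds
    filter_upwards [self_mem_nhdsWithin, mem_nhdsWithin_of_mem_nhds (Iio_mem_nhds hR₀),
      mem_nhdsWithin_of_mem_nhds (Iio_mem_nhds hR), hlimδ.eventually (Iio_mem_nhds (half_pos hε))]
      with δ h1 h2 h3 h4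
    rw [dist_zero_right]
    have h5 := hA δ h1 (le_of_lt h2) (le_of_lt h3)
    have h6 : A * δ < ε / 2 := h4
    have h7 : D * M ^ (-α) + E * (M / 2) ^ (-β) < ε / 2 := hM3
    linarith
  have h6 := hgoal.sub_const (tailPairing s Ω ν φ z ψ)
  simp only [add_sub_cancel_right] at h6
  exact h6

lemma hasCompactSupport_cutoff_add_smul {N : ℝ} (hN : 0 < N) (x : EuclideanSpace ℝ (Fin d)) {r : ℝ}
    (hr : 0 < r) : HasCompactSupport fun u : EuclideanSpace ℝ (Fin d) => cutoff N (x + r • u) := by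
  have h := HasCompactSupport.comp_zoom (hasCompactSupport_cutoff (d := d) hN) (-(r⁻¹ • x))
    (inv_pos.2 hr)
  convert h using 3 with u
  simp [zoom, smul_smul, mul_inv_cancel₀ hr.ne', add_comm]

/-- A continuous test function records the mass of the unit ball, so the lower bound survives the
vague limit and makes it nonzero. -/
lemma le_integral_cutoff_blowUp (hμ : IsNice s Λ μ) (x : EuclideanSpace ℝ (Fin d)) {r c : ℝ}
    (hr : 0 < r) (hc : 0 < c) (h : ENNReal.ofReal (c * r ^ s) < μ (Metric.ball x r)) :
    c ≤ ∫ y, cutoff 1 y ∂(blowUp s μ x r) := by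
  have hn := hμ.isNice_blowUp x hr
  have := hn.isLocallyFiniteMeasure
  have hfin : blowUp s μ x r (Metric.ball 0 1) ≠ ∞ :=
    ((hn 0 1 one_pos).trans_lt ENNReal.ofReal_lt_top).ne
  calc c ≤ (blowUp s μ x r).real (Metric.ball 0 1) := by
        rw [Measure.real, ← ENNReal.ofReal_le_iff_le_toReal hfin, blowUp_ball x 0 hr, smul_zero,
          add_zero, mul_one]
        calc ENNReal.ofReal c = ENNReal.ofReal (r ^ (-s)) * ENNReal.ofReal (c * r ^ s) := by
              rw [← ENNReal.ofReal_mul (by positivity), Real.rpow_neg hr.le]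
              congr 1
              field_simp
          _ ≤ _ := mul_le_mul_right h.le _
    _ = ∫ y, (Metric.ball 0 1).indicator (fun _ => (1 : ℝ)) y ∂(blowUp s μ x r) := by
        rw [integral_indicator Metric.isOpen_ball.measurableSet]
        simp
    _ ≤ _ := by
        refine integral_mono ((integrable_indicator_iff Metric.isOpen_ball.measurableSet).2
          (integrableOn_const hfin)) ((continuous_cutoff 1).integrable_of_hasCompactSupport
          (hasCompactSupport_cutoff one_pos)) fun y => ?_
        by_cases hy : y ∈ Metric.ball (0 : EuclideanSpace ℝ (Fin d)) 1
        · simp only [Set.indicator_of_mem hy]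
          rw [cutoff_eq_one one_pos (by simpa using (Metric.mem_ball.1 hy).le)]
        · simpa only [Set.indicator_of_notMem hy] using cutoff_nonneg 1 y

/-- At a Lebesgue point of `T_μ(1)` with positive upper density there is a nonzero reflectionless
tangent measure. -/
theorem IsGood.exists_isReflectionless_ne_zero (hs : 0 < s) (hΛ : 0 < Λ) (hΩ : IsCZNumerator Ω)
    (hμ : IsGood s Ω Λ μ) {N : ℝ} {x : EuclideanSpace ℝ (Fin d)} (hxN : ‖x‖ < N)
    {F : EuclideanSpace ℝ (Fin d) → EuclideanSpace ℂ (Fin d')} (hF : MemLp F 2 μ)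
    (hFp : ∀ g : EuclideanSpace ℝ (Fin d) → ℂ, (∃ C : ℝ≥0, LipschitzWith C g) →
      HasCompactSupport g → Tendsto (fun δ => pairing s Ω μ δ (fun x => (cutoff N x : ℂ)) g)
        (𝓝[>] 0) (𝓝 (∫ x, g x • F x ∂μ)))
    (hx : ∀ R : ℝ, 0 < R →
      Tendsto (fun r => r ^ (-s) * ∫ y in Metric.closedBall x (R * r), ‖F y - F x‖ ∂μ)
        (𝓝[>] 0) (𝓝 0))
    {c : ℝ} (hc : 0 < c)
    (hden : ∃ᶠ r in 𝓝[>] (0 : ℝ), ENNReal.ofReal (c * r ^ s) < μ (Metric.ball x r)) :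
    ∃ ν, IsReflectionless s Ω ν ∧ ν ≠ 0 := by
  have := hμ.1.isLocallyFiniteMeasure
  have hN : 0 < N := (norm_nonneg x).trans_lt hxN
  have hne : (𝓝[>] (0 : ℝ) ⊓ 𝓟 {r | ENNReal.ofReal (c * r ^ s) < μ (Metric.ball x r)}).NeBot :=
    frequently_mem_iff_neBot.1 hden
  -- The density is only frequently large, so the ultrafilter is chosen to concentrate on the scales
  -- where it is.
  set U : Ultrafilter ℝ := Ultrafilter.of
    (𝓝[>] (0 : ℝ) ⊓ 𝓟 {r | ENNReal.ofReal (c * r ^ s) < μ (Metric.ball x r)})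
  have hU : (U : Filter ℝ) ≤ 𝓝[>] 0 := (Ultrafilter.of_le _).trans inf_le_left
  have hUd : ∀ᶠ r in U, ENNReal.ofReal (c * r ^ s) < μ (Metric.ball x r) :=
    ((Ultrafilter.of_le _).trans inf_le_right) (mem_principal_self _)
  have hpos : ∀ᶠ r in U, (0 : ℝ) < r := hU self_mem_nhdsWithin
  have hm : ∀ᶠ r in U, IsGood s Ω Λ (blowUp s μ x r) := hpos.mono fun r hr => hμ.isGood_blowUp hΩ x hr
  have hm' : ∀ᶠ r in U, IsNice s Λ (blowUp s μ x r) := hm.mono fun r hr => hr.1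
  obtain ⟨ν, hν, hv⟩ := exists_tendstoVaguely U hΛ.le hm'
  have hνg := hv.isGood hs hΛ.le hΩ hm hν
  have hη := continuous_cutoff (d := d) 1
  have hηc := hasCompactSupport_cutoff (d := d) one_pos
  set a : ℝ → ℝ := fun r => ∫ y, cutoff 1 y ∂(blowUp s μ x r) with ha
  set J := ∫ y, cutoff 1 y ∂ν with hJ
  have haJ : Tendsto a U (𝓝 J) := hv _ hη hηc
  have hcJ : c ≤ J := by
    refine ge_of_tendsto haJ ?_
    filter_upwards [hpos, hUd] with r hr hrd
    exact le_integral_cutoff_blowUp hμ.1 x hr hc hrd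
  have hJ0 : 0 < J := hc.trans_le hcJ
  refine ⟨ν, ?_, fun h0 => ?_⟩
  swap
  · rw [hJ, h0] at hJ0
    simp at hJ0
  refine isReflectionless_of_pairing_cutoff_le hs hΩ hΛ hνg ?_
  rintro ψ ⟨L, hψL⟩ hψc hψ0
  obtain ⟨C, α, hC, hα, hmain⟩ := exists_norm_pairing_cutoff_le (d := d) hs hΩ
  have hψ := hψL.continuous
  obtain ⟨B, hB⟩ := hψ.bounded_above_of_compact_support hψc
  have hB0 : 0 ≤ B := (norm_nonneg _).trans (hB 0)
  obtain ⟨ρ, hρ, hρψ⟩ := exists_tsupport_subset_closedBall hψc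
  have hψs : ∀ y ∉ Metric.closedBall 0 ρ, ψ y = 0 := fun y hy =>
    image_eq_zero_of_notMem_tsupport fun h => hy (hρψ h)
  -- A common radius for the supports of `ψ` and of `cutoff 1`.
  set R := ρ + 2 with hR
  have hR0 : 0 < R := by positivity
  set η : EuclideanSpace ℝ (Fin d) → ℂ := fun y => (cutoff 1 y : ℂ) with hηdef
  have hη' : Continuous η := continuous_ofReal_cutoff 1
  have hηc' : HasCompactSupport η := hasCompactSupport_ofReal_cutoff one_pos
  have hη1 : ∀ y, ‖η y‖ ≤ 1 := fun y => by
    simp only [hηdef]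
    rw [Complex.norm_real, Real.norm_of_nonneg (cutoff_nonneg _ _)]
    exact cutoff_le_one _ _
  have hη0 : ∀ y ∉ Metric.ball (0 : EuclideanSpace ℝ (Fin d)) 2, η y = 0 := fun y hy => by
    have : cutoff 1 y = 0 := cutoff_eq_zero one_pos (by simpa using hy)
    simp [hηdef, this]
  set b : ℝ → ℂ := fun r => ∫ y, ψ y ∂(blowUp s μ x r) with hb
  have hb0 : Tendsto b U (𝓝 0) := by
    have := hv.tendsto_integral hm' hν hψ hψc
    rwa [hψ0] at this
  have haC : ∀ r, ∫ y, η y ∂(blowUp s μ x r) = (a r : ℂ) := fun r => integral_ofReal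
  set V := Λ * (2 * 2) ^ s with hV
  set W := B * (Λ * (2 * ρ) ^ s) with hW
  have hV0 : 0 ≤ V := by positivity
  have hW0 : 0 ≤ W := by positivity
  set B' := V * B + W with hB'
  have hB'0 : 0 ≤ B' := by positivity
  set L' : ℝ≥0 := (V * L + W).toNNReal with hL'
  -- `ψ` has mean zero for `ν` but not for the blow-ups. This combination has mean zero for each
  -- blow-up and approaches `J • ψ`, as `b` tends to `0` and `a` to `J > 0`; its size and Lipschitz
  -- constant stay bounded in `r`.
  set g : ℝ → EuclideanSpace ℝ (Fin d) → ℂ := fun r y => (a r : ℂ) * ψ y - b r * η y with hg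
  set D := C * Λ ^ 2 * R ^ (s + α) * B' with hD
  refine ⟨D / J, α, R, hα, hR0, fun M hM => ⟨C * (L' + B' * M⁻¹) * Λ ^ 2 * R ^ s / J,
    fun δ hδ hδR => ?_⟩⟩
  have hM0 : 0 < M := by linarith
  have hχ := continuous_ofReal_cutoff (d := d) M
  have hχc := hasCompactSupport_ofReal_cutoff (d := d) hM0
  have hνl := hν.isLocallyFiniteMeasure
  have hbound : ∀ᶠ r in U,
      ‖(a r : ℂ) • pairing s Ω (blowUp s μ x r) δ (fun y => (cutoff M y : ℂ)) ψ -
        b r • pairing s Ω (blowUp s μ x r) δ (fun y => (cutoff M y : ℂ)) η‖ ≤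
      C * (L' + B' * M⁻¹) * Λ ^ 2 * R ^ s * δ +
        B' * (r ^ (-s) * ∫ y in Metric.closedBall x (R * r), ‖F y - F x‖ ∂μ) + D * M ^ (-α) := by
    -- At such scales the rescaled cutoff `cutoff N (x + r • u)` equals `1` for `‖u‖ ≤ M`; this is
    -- where `‖x‖ < N` is needed.
    have hsmall : ∀ᶠ r in U, r * M < N - ‖x‖ := by
      have h1 : Continuous fun r : ℝ => r * M := by fun_prop
      have h2 : ∀ᶠ r in 𝓝 (0 : ℝ), r * M < N - ‖x‖ :=
        h1.tendsto 0 (Iio_mem_nhds (by simpa using hxN))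
      exact hU (mem_nhdsWithin_of_mem_nhds h2)
    filter_upwards [hpos, hm', hsmall] with r hr hnr hrM
    have hrl := hnr.isLocallyFiniteMeasure
    have hav : ‖(a r : ℂ)‖ ≤ V := by
      rw [← haC]
      refine (hnr.norm_integral_le (B := 1) hΛ.le two_pos zero_le_one
        (fun y hy => hη0 y fun h => hy (Metric.ball_subset_closedBall h)) fun y _ => hη1 y).trans ?_
      rw [one_mul]
    have hbv : ‖b r‖ ≤ W := hnr.norm_integral_le hΛ.le hρ hB0 hψs fun y _ => hB y
    have hgL : LipschitzWith L' (g r) := by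
      refine LipschitzWith.of_dist_le_mul fun y w => ?_
      rw [dist_eq_norm, dist_eq_norm, hL', Real.coe_toNNReal _ (by positivity), add_mul]
      have e : g r y - g r w = (a r : ℂ) * (ψ y - ψ w) - b r * (η y - η w) := by
        simp only [hg]
        ring
      have h1 : ‖η y - η w‖ ≤ ‖y - w‖ := by
        simp only [hηdef]
        rw [← Complex.ofReal_sub, Complex.norm_real, Real.norm_eq_abs]
        simpa using abs_cutoff_sub_le one_pos y w
      rw [e]
      refine (norm_sub_le _ _).trans (add_le_add ?_ ?_)
      · rw [norm_mul, mul_assoc]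
        exact mul_le_mul hav (hψL.norm_sub_le y w) (norm_nonneg _) hV0
      · rw [norm_mul]
        exact mul_le_mul hbv h1 (norm_nonneg _) hW0
    have hgB : ∀ y, ‖g r y‖ ≤ B' := fun y => by
      refine (norm_sub_le _ _).trans (add_le_add ?_ ?_)
      · rw [norm_mul]
        exact mul_le_mul hav (hB y) (norm_nonneg _) hV0
      · rw [norm_mul, ← mul_one W]
        exact mul_le_mul hbv (hη1 y) (norm_nonneg _) hW0
    have hgs : ∀ y ∉ Metric.ball 0 R, g r y = 0 := fun y hy => by
      have h1 : R ≤ ‖y‖ := by simpa using hy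
      have h2 : ψ y = 0 := hψs y (by simp only [Metric.mem_closedBall, dist_zero_right]; linarith)
      have h3 : η y = 0 := hη0 y (by simp only [Metric.mem_ball, dist_zero_right]; linarith)
      simp [hg, h2, h3]
    have hgc : HasCompactSupport (g r) := (hψc.mul_left (f := fun _ => (a r : ℂ))).sub
      (hηc'.mul_left (f := fun _ => b r))
    have hg0 : ∫ y, g r y ∂(blowUp s μ x r) = 0 := by
      have i1 : Integrable ψ (blowUp s μ x r) := hψ.integrable_of_hasCompactSupport hψc
      have i2 : Integrable η (blowUp s μ x r) := hη'.integrable_of_hasCompactSupport hηc'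
      simp only [hg]
      rw [integral_sub (i1.const_mul _) (i2.const_mul _), integral_const_mul, integral_const_mul,
        haC, mul_comm, sub_self]
    obtain ⟨v, hv1, hv2⟩ := exists_tendsto_pairing_blowUp hΩ hF hFp x hr hgL hgc hgs hgB hg0
    have hcomp : Continuous fun u : EuclideanSpace ℝ (Fin d) => cutoff N (x + r • u) :=
      (continuous_cutoff N).comp (by fun_prop)
    have h1 := hmain Λ _ hΛ.le hnr _ hcomp (hasCompactSupport_cutoff_add_smul hN x hr)
      (fun y => cutoff_nonneg _ _) (fun y => cutoff_le_one _ _) (g r) L' hgL hgc R M B' hR0 hM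
      (fun y hy => cutoff_eq_one hN (by
        have h2 : ‖y‖ < M := by simpa using hy
        refine (norm_add_le _ _).trans ?_
        rw [norm_smul, Real.norm_of_nonneg hr.le]
        have := mul_le_mul_of_nonneg_left h2.le hr.le
        linarith)) hgs hgB hg0 v hv1 δ hδ hδR
    rw [← pairing_mul_sub_mul_right hs hΩ hδ hχ hχc hψ hψc hη' hηc']
    refine h1.trans ?_
    gcongr
  -- With `δ` and `M` fixed let `r → 0` along `U`: the correction by `η` and the Lebesgue-point term
  -- vanish, and dividing by `J` gives the criterion.
  have hl1 := ((Complex.continuous_ofReal.tendsto J).comp haJ).smul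
    (hv.tendsto_pairing hs hΛ.le hΩ hm' hν hδ hχ hχc hψ hψc)
  have hl2 := hb0.smul (hv.tendsto_pairing hs hΛ.le hΩ hm' hν hδ hχ hχc hη' hηc')
  have hl3 := (((hx R hR0).mono_left hU).const_mul B').const_add
    (C * (L' + B' * M⁻¹) * Λ ^ 2 * R ^ s * δ) |>.add_const (D * M ^ (-α))
  have hfin := le_of_tendsto_of_tendsto (hl1.sub hl2).norm hl3 hbound
  rw [zero_smul, sub_zero, norm_smul, Complex.norm_real, Real.norm_of_nonneg hJ0.le, mul_zero,
    add_zero] at hfin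
  rw [div_mul_eq_mul_div, div_mul_eq_mul_div, ← add_div, le_div_iff₀ hJ0, mul_comm]
  exact hfin

/-- A nonzero good measure whose support has finite Hausdorff measure has a nonzero reflectionless
tangent measure. -/
theorem IsGood.exists_isReflectionless_of_hausdorffMeasure_lt_top (hs : 0 < s) (hΛ : 0 < Λ)
    (hΩ : IsCZNumerator Ω) (hμ : IsGood s Ω Λ μ)
    (hH : Measure.hausdorffMeasure s μ.support < ∞) (hμ0 : μ ≠ 0) :
    ∃ ν, IsReflectionless s Ω ν ∧ ν ≠ 0 := by
  have hlf := hμ.1.isLocallyFiniteMeasure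
  have hP := measure_upperDensity_pos_ne_zero hs hμ.1 hH hμ0
  set P := {x | ∃ c : ℝ, 0 < c ∧ ∃ᶠ r in 𝓝[>] (0 : ℝ),
      ENNReal.ofReal (c * r ^ s) < μ (Metric.ball x r)}
  -- Localization lets one cutoff be `1` around the point to be chosen; the set found has positive
  -- measure, so it contains a Lebesgue point of the corresponding `F`.
  obtain ⟨n, hn⟩ : ∃ n : ℕ, μ (P ∩ Metric.ball 0 n) ≠ 0 := by
    by_contra! h
    refine hP (measure_mono_null (t := ⋃ n : ℕ, P ∩ Metric.ball 0 n) (fun x hx => ?_)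
      (measure_iUnion_null h))
    obtain ⟨n, hn⟩ := exists_nat_gt ‖x‖
    exact Set.mem_iUnion.2 ⟨n, hx, by simpa using hn⟩
  have hn0 : (0 : ℝ) < n := by
    rcases n.eq_zero_or_pos with h | h
    · simp [h] at hn
    · exact_mod_cast h
  obtain ⟨F, hF, hFp⟩ := hμ.exists_memLp_tendsto_pairing hs hΛ.le hΩ hn0
  have hae := hμ.1.ae_tendsto_rpow_mul_setIntegral hΛ.le (hF.locallyIntegrable one_le_two)
  obtain ⟨x, ⟨⟨c, hc, hden⟩, hxn⟩, hx⟩ :=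
    ((frequently_ae_mem_iff.2 hn).and_eventually hae).exists
  exact hμ.exists_isReflectionless_ne_zero hs hΛ hΩ (by simpa using hxn) hF hFp hx hc hden

end CZReflectionless

end

theorem theorem1p1 (d d' : ℕ) (hd : 2 ≤ d) (hd' : 1 ≤ d') (s : ℝ) (hs : 0 < s) (hsd : s < d)
    (Ω : EuclideanSpace ℝ (Fin d) → EuclideanSpace ℂ (Fin d'))
    (hΩ : CZReflectionless.IsCZNumerator Ω)
    (hrefl : ∀ μ : MeasureTheory.Measure (EuclideanSpace ℝ (Fin d)),
      CZReflectionless.IsReflectionless s Ω μ → μ = 0) :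
    ∀ μ : MeasureTheory.Measure (EuclideanSpace ℝ (Fin d)),
      CZReflectionless.IsDimensional s μ → CZReflectionless.IsBoundedL2 s Ω μ → μ = 0 := by
  rintro μ ⟨-, hH⟩ ⟨Λ, hΛ, hμ⟩
  by_contra h0
  obtain ⟨ν, hν, hν0⟩ := hμ.exists_isReflectionless_of_hausdorffMeasure_lt_top hs hΛ hΩ hH h0
  exact hν0 (hrefl ν hν)
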